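/- All objects are smooth and $\mathbb Z_2$-graded ("manifold" means smooth supermanifold, Hausdorff and second countable); $\widetilde{A}$ denotes Grassmann parity. Let $M$ be a manifold with local coordinates $x^A$, and let $E\to M$ be a vector bundle of finite rank with linear fibre coordinates $e^\alpha$, $\widetilde{e^\alpha}=\widetilde\alpha$, and changes of coordinates $\bar x^A=\bar x^A(x)$, $\bar e^\alpha=e^\beta T_\beta{}^\alpha(x)$. Let $\Pi E$ and $\Pi E^*$ be the total spaces of the parity reversed bundle and of the parity reversed dual bundle, with coordinates $(x^A,\xi^\alpha)$ and $(x^A,\eta_\alpha)$, $\widetilde{\xi^\alpha}=\widetilde{\eta_\alpha}=\widetilde\alpha+1$, $\bar\xi^\alpha=\xi^\beta T_\beta{}^\alpha$, $\bar\eta_\alpha=(T^{-1})_\alpha{}^\beta\eta_\beta$, and let $(x^A,\xi^\alpha,p_A,\pi_\alpha)$ and $(x^A,\eta_\alpha,p_A,\pi^\alpha)$ be the induced coordinates on $T^*(\Pi E)$ and $T^*(\Pi E^*)$. On the cotangent bundle of a manifold with coordinates $x^A$ and momenta $p_A$ use the canonical Poisson bracket $$\{F,G\}=(-1)^{\widetilde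 A\widetilde F+\widetilde A}\frac{\partial F}{\partial p_A}\frac{\partial G}{\partial x^A}-(-1)^{\widetilde A\widetilde F}\frac{\partial F}{\partial x^A}\frac{\partial G}{\partial p_A}.$$ The symbol of a vector field $X=X^A\frac{\partial}{\partial x^A}$ is the function $X^Ap_A$ on the cotangent bundle. A Jacobi algebroid structure on $E$ is an odd Jacobi structure of weight $-1$ on $\Pi E^*$: a pair $(S,Q)$ of an odd function $S\in C^\infty(T^*(\Pi E^*))$, of degree two in the momenta, and an odd vector field $Q$ on $\Pi E^*$ with symbol $\mathcal Q$, such that $$[Q,Q]=0,\qquad \{\mathcal Q,S\}=0,\qquad \{S,S\}=-2\,\mathcal Q\,S,$$ where $S$ and $Q$ have weight $-1$ for the weights $w(x^A)=w(p_A)=0$, $w(\eta_\alpha)=1$, $w(\pi^\alpha)=-1$. A weight-one quasi Q-structure on $\Pi E$ is a pair $(D,q)$ of an odd vector field $D$ and an odd function $q$ on $\Pi E$ such that $$[D,D]=2qD,\qquad D(q)=0,$$ where $D$ and $q$ have weight $1$ for the weights $\bar w(x^A)=0$, $\bar w(\xi^\alpha)=1$; that is, $[\Xi,D]=D$ and $\Xi(q)=q$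 for the Euler vector field $\Xi=\xi^\alpha\frac{\partial}{\partial\xi^\alpha}$. Let $R:T^*(\Pi E^*)\to T^*(\Pi E)$ be the canonical double vector bundle morphism, given by $R^*x^A=x^A$, $R^*p_A=p_A$, $R^*\xi^\alpha=(-1)^{\widetilde\alpha}\pi^\alpha$, $R^*\pi_\alpha=\eta_\alpha$. **Theorem (Jacobi algebroid $\Leftrightarrow$ weight-one quasi Q-manifold).** Jacobi algebroid structures $(S,Q)$ on $E$ are equivalent to weight-one quasi Q-structures $(D,q)$ on $\Pi E$: there is a bijection $(S,Q)\mapsto(D,q)$ between the two sets of structures, determined by $$S=R^*(\text{symbol of }D),\qquad \mathcal Q=-R^*q .$$ -/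

import Mathlib

open scoped ContDiff

universe u

noncomputable section

namespace SuperGeom

/-! ### Grassmann algebras and superfunctions -/

/-- The real Grassmann algebra on odd generators indexed by `b`. -/
abbrev Gr (b : Type) : Type := ExteriorAlgebra ℝ (b → ℝ)

instance grFinite (b : Type) [Fintype b] : Module.Finite ℝ (Gr b) := by
  classical
  let _ : LinearOrder b := LinearOrder.lift' (Fintype.equivFin b) (Fintype.equivFin b).injective
  exact Module.Finite.of_basis (Pi.basisFun ℝ b).ExteriorAlgebra

/-- Coordinates of the Grassmann algebra with respect to some basis. -/
def grCoords (b : Type) [Fintype b] : Gr b ≃ₗ[ℝ] (Fin (Module.finrank ℝ (Gr b)) → ℝ) :=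
  (Module.finBasis ℝ (Gr b)).equivFun

/-- The Grassmann algebra is a finite-dimensional real vector space, so all norms on it are
equivalent; this one serves only to speak of smooth functions with values in it. -/
instance grNormedAddCommGroup (b : Type) [Fintype b] : NormedAddCommGroup (Gr b) :=
  NormedAddCommGroup.induced (Gr b) (Fin (Module.finrank ℝ (Gr b)) → ℝ)
    (grCoords b) (grCoords b).injective

instance grNormedSpace (b : Type) [Fintype b] : NormedSpace ℝ (Gr b) :=
  NormedSpace.induced ℝ (Gr b) (Fin (Module.finrank ℝ (Gr b)) → ℝ) (grCoords b).toLinearMap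

/-- Superfunctions in even coordinates indexed by `a` and odd coordinates indexed by `b`:
functions of the even coordinates with values in the Grassmann algebra of the odd ones.
Only the values on an open set (the domain at hand) matter, and the elements of
`C^∞(U) ⊗ Λ(b)` are those that satisfy `ContDiffOn ℝ ∞ f U`. -/
abbrev SFun (a b : Type) : Type := (a → ℝ) → Gr b

/-- Grassmann parity of a coordinate: `Sum.inl` are the even, `Sum.inr` the odd coordinates. -/
def par {a b : Type} : a ⊕ b → ZMod 2 := Sum.elim (fun _ => 0) (fun _ => 1)

/-- `f` is homogeneous of Grassmann parity `ε` on `U`. -/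
def ParityOn {a b : Type} (U : Set (a → ℝ)) (ε : ZMod 2) (f : SFun a b) : Prop :=
  ∀ x ∈ U, f x ∈ CliffordAlgebra.evenOdd (0 : QuadraticForm ℝ (b → ℝ)) ε

/-- The grading automorphism `f ↦ (-1)^ε f`. -/
def invol {a b : Type} (f : SFun a b) : SFun a b := fun x => CliffordAlgebra.involute (f x)

section Local

variable {a b a' b' : Type} [Fintype a] [DecidableEq a] [Fintype b] [DecidableEq b]
  [Fintype a'] [DecidableEq a'] [Fintype b'] [DecidableEq b']

/-- The coordinate functions. -/
def coord : a ⊕ b → SFun a b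
  | Sum.inl s => fun x => algebraMap ℝ (Gr b) (x s)
  | Sum.inr m => fun _ => ExteriorAlgebra.ι ℝ (Pi.single m (1 : ℝ))

/-- The partial derivatives; those along odd coordinates are left derivatives. -/
def pd : a ⊕ b → SFun a b → SFun a b
  | Sum.inl s => fun f x => fderiv ℝ f x (Pi.single s 1)
  | Sum.inr m => fun f x =>
      CliffordAlgebra.contractLeft (LinearMap.proj m : (b → ℝ) →ₗ[ℝ] ℝ) (f x)

/-- The body (real part) of a Grassmann number. -/
def body : Gr b →ₐ[ℝ] ℝ := ExteriorAlgebra.algebraMapInv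

/-- The nilpotent part of a Grassmann number. -/
def soul (g : Gr b) : Gr b := g - algebraMap ℝ (Gr b) (body g)

open Classical in
/-- The algebra homomorphism of Grassmann algebras that sends the generators to given odd
elements (the other branch is a junk value for elements that are not odd). -/
def grHom (t : b' → Gr b) : Gr b' →ₐ[ℝ] Gr b :=
  if h : ∀ m : b' → ℝ, Fintype.linearCombination ℝ t m * Fintype.linearCombination ℝ t m = 0 then
    ExteriorAlgebra.lift ℝ ⟨Fintype.linearCombination ℝ t, h⟩
  else (Algebra.ofId ℝ (Gr b)).comp body

/-- The body of a coordinate change `φ`. -/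
def bodyMap (φ : a' ⊕ b' → SFun a b) (x : a → ℝ) : a' → ℝ := fun s => body (φ (Sum.inl s) x)

/-- The pullback `φ^* f = f(φ)`: substitute the even superfunctions `φ (inl s)` for the even
coordinates and the odd superfunctions `φ (inr m)` for the odd coordinates of `f`, by Taylor
expansion in the souls of the even ones (a finite sum, as the souls are nilpotent). -/
def subst (φ : a' ⊕ b' → SFun a b) (f : SFun a' b') : SFun a b := fun x =>
  ∑ k ∈ Finset.range (Fintype.card b + 1), ((k.factorial : ℝ)⁻¹) •
    ∑ j : Fin k → a',
      (List.ofFn fun l => soul (φ (Sum.inl (j l)) x)).prod *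
        grHom (fun m => φ (Sum.inr m) x)
          (iteratedFDeriv ℝ k f (bodyMap φ x) (fun l => Pi.single (j l) (1 : ℝ)))

/-- The action `X(f) = X^A ∂f/∂x^A` of a vector field with components `X^A`. -/
def act (X : a ⊕ b → SFun a b) (f : SFun a b) : SFun a b := ∑ A, X A * pd A f

/-- Components of the commutator of vector fields of parities `ε`, `ε'`:
`[X,Y]^A = X(Y^A) - (-1)^(ε ε') Y(X^A)`. -/
def lieBr (ε ε' : ZMod 2) (X Y : a ⊕ b → SFun a b) : a ⊕ b → SFun a b := fun A =>
  act X (Y A) - (if ε * ε' = 1 then (-1 : ℝ) else 1) • act Y (X A)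

/-- The Euler vector field of an assignment of weights to the coordinates. -/
def euler (w : a ⊕ b → ℤ) : a ⊕ b → SFun a b := fun A => (w A : ℝ) • coord A

/-- The superfunction `f` has weight `r` on `U`. -/
def FunWeightOn (U : Set (a → ℝ)) (w : a ⊕ b → ℤ) (r : ℤ) (f : SFun a b) : Prop :=
  ∀ x ∈ U, act (euler w) f x = (r : ℝ) • f x

/-- The vector field `X` of parity `ε` has weight `r` on `U`: `[Ξ, X] = r X`. -/
def VectWeightOn (U : Set (a → ℝ)) (w : a ⊕ b → ℤ) (r : ℤ) (ε : ZMod 2)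
    (X : a ⊕ b → SFun a b) : Prop :=
  ∀ A, ∀ x ∈ U, lieBr 0 ε (euler w) X A x = (r : ℝ) • X A x

end Local

/-! ### Supermanifolds, functions and vector fields -/

/-- Gluing data for a supermanifold of dimension `a|b`: superdomains `dom i` of coordinates,
the parts `ovl i j ⊆ dom i` that are also covered by the chart `j`, and the coordinates
`tr i j A` of the chart `j` as superfunctions of the coordinates of the chart `i`. -/
structure SuperAtlas (a b : Type) where
  Idx : Type u
  dom : Idx → Set (a → ℝ)
  ovl : Idx → Idx → Set (a → ℝ)
  tr : Idx → Idx → a ⊕ b → SFun a b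

section Global

variable {a b : Type} [Fintype a] [DecidableEq a] [Fintype b] [DecidableEq b]

/-- The gluing data define a smooth supermanifold (Hausdorff and second countable). -/
structure SuperAtlas.IsSupermanifold (M : SuperAtlas.{u} a b) : Prop where
  isOpen_dom : ∀ i, IsOpen (M.dom i)
  isOpen_ovl : ∀ i j, IsOpen (M.ovl i j)
  ovl_subset : ∀ i j, M.ovl i j ⊆ M.dom i
  ovl_self : ∀ i, M.ovl i i = M.dom i
  smooth : ∀ i j A, ContDiffOn ℝ ∞ (M.tr i j A) (M.ovl i j)
  parity : ∀ i j A, ParityOn (M.ovl i j) (par A) (M.tr i j A)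
  mapsTo : ∀ i j, Set.MapsTo (bodyMap (M.tr i j)) (M.ovl i j) (M.ovl j i)
  tr_self : ∀ i A, ∀ x ∈ M.dom i, M.tr i i A x = coord A x
  cocycle : ∀ i j k, ∀ x ∈ M.ovl i j, bodyMap (M.tr i j) x ∈ M.ovl j k →
    x ∈ M.ovl i k ∧ ∀ A, M.tr i k A x = subst (M.tr i j) (M.tr j k A) x
  hausdorff : ∀ i j, ∀ x ∈ M.dom i, ∀ y ∈ M.dom j,
    ¬ (x ∈ M.ovl i j ∧ bodyMap (M.tr i j) x = y) →
    ∃ V ∈ nhds x, ∃ W ∈ nhds y, ∀ z ∈ V ∩ M.ovl i j, bodyMap (M.tr i j) z ∉ W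
  countable_cover : ∃ J : Set M.Idx, J.Countable ∧
    ∀ i, ∀ x ∈ M.dom i, ∃ j ∈ J, x ∈ M.ovl i j

/-- Smooth functions on a supermanifold: compatible families of local superfunctions
(set to zero outside the domains of the charts, so that equality is equality on the domains). -/
structure SmoothFn (M : SuperAtlas.{u} a b) where
  loc : M.Idx → SFun a b
  smooth : ∀ i, ContDiffOn ℝ ∞ (loc i) (M.dom i)
  compat : ∀ i j, ∀ x ∈ M.ovl i j, loc i x = subst (M.tr i j) (loc j) x
  off : ∀ i, ∀ x ∉ M.dom i, loc i x = 0

/-- Vector fields on a supermanifold: in the chart `i` the vector field is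
`comp i A * ∂/∂x^A`, and the components transform as `X(x̄^A) = X̄^A`. -/
structure VectField (M : SuperAtlas.{u} a b) where
  comp : M.Idx → a ⊕ b → SFun a b
  smooth : ∀ i A, ContDiffOn ℝ ∞ (comp i A) (M.dom i)
  compat : ∀ i j A, ∀ x ∈ M.ovl i j,
    act (comp i) (M.tr i j A) x = subst (M.tr i j) (comp j A) x
  off : ∀ i A, ∀ x ∉ M.dom i, comp i A x = 0

/-- An odd function. -/
def SmoothFn.IsOdd {M : SuperAtlas.{u} a b} (f : SmoothFn M) : Prop :=
  ∀ i, ParityOn (M.dom i) 1 (f.loc i)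

/-- An odd vector field. -/
def VectField.IsOdd {M : SuperAtlas.{u} a b} (X : VectField M) : Prop :=
  ∀ i A, ParityOn (M.dom i) (par A + 1) (X.comp i A)

/-! ### The cotangent bundle -/

/-- The coordinate `x^A` among the coordinates `(x^A, p_A)` of the cotangent bundle. -/
def qIdx : a ⊕ b → (a ⊕ a) ⊕ (b ⊕ b) := Sum.map Sum.inl Sum.inl

/-- The momentum `p_A` among the coordinates `(x^A, p_A)` of the cotangent bundle. -/
def pIdx : a ⊕ b → (a ⊕ a) ⊕ (b ⊕ b) := Sum.map Sum.inr Sum.inr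

/-- Functions of `x` as functions of `(x, p)`. -/
def liftCot (f : SFun a b) : SFun (a ⊕ a) (b ⊕ b) := subst (fun A => coord (qIdx A)) f

/-- The cotangent bundle: `p̄_A = (∂x^B/∂x̄^A) p_B`. -/
def cot (N : SuperAtlas.{u} a b) : SuperAtlas.{u} (a ⊕ a) (b ⊕ b) where
  Idx := N.Idx
  dom i := {z | z ∘ Sum.inl ∈ N.dom i}
  ovl i j := {z | z ∘ Sum.inl ∈ N.ovl i j}
  tr i j
    | Sum.inl (Sum.inl s) => liftCot (N.tr i j (Sum.inl s))
    | Sum.inr (Sum.inl m) => liftCot (N.tr i j (Sum.inr m))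
    | Sum.inl (Sum.inr s) =>
        ∑ B, liftCot (subst (N.tr i j) (pd (Sum.inl s) (N.tr j i B))) * coord (pIdx B)
    | Sum.inr (Sum.inr m) =>
        ∑ B, liftCot (subst (N.tr i j) (pd (Sum.inr m) (N.tr j i B))) * coord (pIdx B)

/-- The canonical Poisson bracket on the cotangent bundle,
`{F,G} = (-1)^(ÃF̃+Ã) ∂F/∂p_A ∂G/∂x^A - (-1)^(ÃF̃) ∂F/∂x^A ∂G/∂p_A`,
where `(-1)^(ÃF̃) F` is `F` for even `A` and `invol F` for odd `A`. -/
def poisson (F G : SFun (a ⊕ a) (b ⊕ b)) : SFun (a ⊕ a) (b ⊕ b) :=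
  (∑ s : a, (pd (pIdx (Sum.inl s)) F * pd (qIdx (Sum.inl s)) G
      - pd (qIdx (Sum.inl s)) F * pd (pIdx (Sum.inl s)) G)) +
  (∑ m : b, (- (pd (pIdx (Sum.inr m)) (invol F) * pd (qIdx (Sum.inr m)) G)
      - pd (qIdx (Sum.inr m)) (invol F) * pd (pIdx (Sum.inr m)) G))

/-- The degree in the momenta. -/
def momDeg : (a ⊕ a) ⊕ (b ⊕ b) → ℤ :=
  Sum.elim (Sum.elim (fun _ => 0) (fun _ => 1)) (Sum.elim (fun _ => 0) (fun _ => 1))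

/-- The natural weight on the cotangent bundle: `w(p_A) = - w(x^A)`. -/
def cotWt (w : a ⊕ b → ℤ) : (a ⊕ a) ⊕ (b ⊕ b) → ℤ :=
  Sum.elim (Sum.elim (fun s => w (Sum.inl s)) (fun s => - w (Sum.inl s)))
    (Sum.elim (fun m => w (Sum.inr m)) (fun m => - w (Sum.inr m)))

/-- The symbol (Hamiltonian) `X^A p_A` of a vector field, in the chart `i`. -/
def VectField.symbol {N : SuperAtlas.{u} a b} (X : VectField N) (i : N.Idx) :
    SFun (a ⊕ a) (b ⊕ b) :=
  ∑ A, liftCot (X.comp i A) * coord (pIdx A)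

/-! ### Odd Jacobi structures and quasi Q-structures -/

/-- An odd Jacobi structure on `N`: an odd function `S` on the cotangent bundle, of degree two
in the momenta, and an odd vector field `Q`, with `[Q,Q] = 0`, `{𝒬,S} = 0` (that is, `L_Q S = 0`)
and `{S,S} = -2𝒬S`, where `𝒬` is the symbol of `Q`. -/
structure OddJacobi (N : SuperAtlas.{u} a b) where
  S : SmoothFn (cot N)
  Q : VectField N
  S_odd : S.IsOdd
  S_deg : ∀ i, FunWeightOn ((cot N).dom i) momDeg 2 (S.loc i)
  Q_odd : Q.IsOdd
  homological : ∀ i A, ∀ x ∈ N.dom i, lieBr 1 1 (Q.comp i) (Q.comp i) A x = 0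
  invariant : ∀ i, ∀ z ∈ (cot N).dom i, poisson (Q.symbol i) (S.loc i) z = 0
  compatible : ∀ i, ∀ z ∈ (cot N).dom i,
    poisson (S.loc i) (S.loc i) z = (-2 : ℝ) • (Q.symbol i z * S.loc i z)

/-- A quasi Q-structure on `N`: an odd vector field `D` and an odd function `q` with
`[D,D] = 2qD` and `D(q) = 0`. -/
structure QuasiQ (N : SuperAtlas.{u} a b) where
  D : VectField N
  q : SmoothFn N
  D_odd : D.IsOdd
  q_odd : q.IsOdd
  almost_homological : ∀ i A, ∀ x ∈ N.dom i,
    lieBr 1 1 (D.comp i) (D.comp i) A x = (2 : ℝ) • (q.loc i x * D.comp i A x)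
  curving : ∀ i, ∀ x ∈ N.dom i, act (D.comp i) (q.loc i) x = 0

/-! ### Vector bundles, with the total spaces `ΠE` and `ΠE*` -/

variable {c d : Type} [Fintype c] [DecidableEq c] [Fintype d] [DecidableEq d]

/-- Data of a (super) vector bundle of rank `c|d` over `M`, trivialised over the charts of `M`:
the fibre coordinates `e^α` change by `ē^α = e^β T_β^α(x)`, with `T i j β α = T_β^α`
a function of the coordinates of the chart `i`. -/
structure SuperBundle (M : SuperAtlas.{u} a b) (c d : Type) where
  T : M.Idx → M.Idx → c ⊕ d → c ⊕ d → SFun a b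

/-- The transition functions are smooth, even as matrices, and satisfy the cocycle condition. -/
structure SuperBundle.IsVectorBundle {M : SuperAtlas.{u} a b} (E : SuperBundle M c d) :
    Prop where
  smooth : ∀ i j β α, ContDiffOn ℝ ∞ (E.T i j β α) (M.ovl i j)
  parity : ∀ i j β α, ParityOn (M.ovl i j) (par β + par α) (E.T i j β α)
  T_self : ∀ i β α, ∀ x ∈ M.dom i, E.T i i β α x = if β = α then 1 else 0
  cocycle : ∀ i j k β α, ∀ x ∈ M.ovl i j, bodyMap (M.tr i j) x ∈ M.ovl j k →
    E.T i k β α x = ∑ γ, E.T i j β γ x * subst (M.tr i j) (E.T j k γ α) x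

/-- The base coordinate `x^A` on the total space of `ΠE` or `ΠE*`. -/
def baseIdx : a ⊕ b → (a ⊕ d) ⊕ (b ⊕ c) := Sum.map Sum.inl Sum.inl

/-- The fibre coordinate of index `α` on `ΠE` or `ΠE*`, of parity opposite to that of `α`. -/
def fibIdx : c ⊕ d → (a ⊕ d) ⊕ (b ⊕ c)
  | Sum.inl γ => Sum.inr (Sum.inr γ)
  | Sum.inr δ => Sum.inl (Sum.inr δ)

/-- Functions on the base as functions on the total space. -/
def liftTot (f : SFun a b) : SFun (a ⊕ d) (b ⊕ c) :=
  subst (fun A => coord (baseIdx (c := c) (d := d) A)) f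

/-- The total space of `ΠE`, with coordinates `(x^A, ξ^α)` and `ξ̄^α = ξ^β T_β^α`. -/
def SuperBundle.PiTot {M : SuperAtlas.{u} a b} (E : SuperBundle M c d) :
    SuperAtlas.{u} (a ⊕ d) (b ⊕ c) where
  Idx := M.Idx
  dom i := {z | z ∘ Sum.inl ∈ M.dom i}
  ovl i j := {z | z ∘ Sum.inl ∈ M.ovl i j}
  tr i j
    | Sum.inl (Sum.inl s) => liftTot (M.tr i j (Sum.inl s))
    | Sum.inr (Sum.inl m) => liftTot (M.tr i j (Sum.inr m))
    | Sum.inl (Sum.inr δ) => ∑ β, coord (fibIdx β) * liftTot (E.T i j β (Sum.inr δ))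
    | Sum.inr (Sum.inr γ) => ∑ β, coord (fibIdx β) * liftTot (E.T i j β (Sum.inl γ))

/-- The total space of `ΠE*`, with coordinates `(x^A, η_α)` and `η̄_α = (T⁻¹)_α^β η_β`; the
inverse of the transition matrix from `i` to `j` is the one from `j` to `i`, written in the
coordinates of the chart `i`. -/
def SuperBundle.PiDualTot {M : SuperAtlas.{u} a b} (E : SuperBundle M c d) :
    SuperAtlas.{u} (a ⊕ d) (b ⊕ c) where
  Idx := M.Idx
  dom i := {z | z ∘ Sum.inl ∈ M.dom i}
  ovl i j := {z | z ∘ Sum.inl ∈ M.ovl i j}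
  tr i j
    | Sum.inl (Sum.inl s) => liftTot (M.tr i j (Sum.inl s))
    | Sum.inr (Sum.inl m) => liftTot (M.tr i j (Sum.inr m))
    | Sum.inl (Sum.inr δ) =>
        ∑ β, liftTot (subst (M.tr i j) (E.T j i (Sum.inr δ) β)) * coord (fibIdx β)
    | Sum.inr (Sum.inr γ) =>
        ∑ β, liftTot (subst (M.tr i j) (E.T j i (Sum.inl γ) β)) * coord (fibIdx β)

/-- The natural weight on the total space: `0` for the base and `1` for the fibre coordinates. -/
def fibWt : (a ⊕ d) ⊕ (b ⊕ c) → ℤ :=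
  Sum.elim (Sum.elim (fun _ => 0) (fun _ => 1)) (Sum.elim (fun _ => 0) (fun _ => 1))

/-- A Jacobi algebroid structure on `E`: an odd Jacobi structure on `ΠE*` of weight `-1`. -/
structure JacobiAlgebroid {M : SuperAtlas.{u} a b} (E : SuperBundle M c d) extends
    OddJacobi E.PiDualTot where
  S_weight : ∀ i, FunWeightOn ((cot E.PiDualTot).dom i) (cotWt fibWt) (-1) (S.loc i)
  Q_weight : ∀ i, VectWeightOn (E.PiDualTot.dom i) fibWt (-1) 1 (Q.comp i)

/-- A quasi Q-structure on `ΠE` of weight `1`. -/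
structure WeightOneQuasiQ {M : SuperAtlas.{u} a b} (E : SuperBundle M c d) extends
    QuasiQ E.PiTot where
  D_weight : ∀ i, VectWeightOn (E.PiTot.dom i) fibWt 1 1 (D.comp i)
  q_weight : ∀ i, FunWeightOn (E.PiTot.dom i) fibWt 1 (q.loc i)

/-- The canonical map `R : T*(ΠE*) → T*(ΠE)`: the coordinates `(x^A, ξ^α, p_A, π_α)` of `T*(ΠE)`
as functions of the coordinates `(x^A, η_α, p_A, π^α)` of `T*(ΠE*)`, namely `x^A ↦ x^A`,
`p_A ↦ p_A`, `ξ^α ↦ (-1)^α̃ π^α`, `π_α ↦ η_α`. -/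
def Rmap : ((a ⊕ d) ⊕ (a ⊕ d)) ⊕ ((b ⊕ c) ⊕ (b ⊕ c)) →
    SFun ((a ⊕ d) ⊕ (a ⊕ d)) ((b ⊕ c) ⊕ (b ⊕ c))
  | Sum.inl (Sum.inl (Sum.inl s)) => coord (qIdx (baseIdx (Sum.inl s)))
  | Sum.inr (Sum.inl (Sum.inl m)) => coord (qIdx (baseIdx (Sum.inr m)))
  | Sum.inl (Sum.inr (Sum.inl s)) => coord (pIdx (baseIdx (Sum.inl s)))
  | Sum.inr (Sum.inr (Sum.inl m)) => coord (pIdx (baseIdx (Sum.inr m)))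
  | Sum.inr (Sum.inl (Sum.inr γ)) => coord (pIdx (fibIdx (Sum.inl γ)))
  | Sum.inl (Sum.inl (Sum.inr δ)) => - coord (pIdx (fibIdx (Sum.inr δ)))
  | Sum.inr (Sum.inr (Sum.inr γ)) => coord (qIdx (fibIdx (Sum.inl γ)))
  | Sum.inl (Sum.inr (Sum.inr δ)) => coord (qIdx (fibIdx (Sum.inr δ)))

end Global

end SuperGeom

end

/-!
The canonical map `R : T*(ΠE*) → T*(ΠE)` is a symplectomorphism that exchanges the fibre
coordinates `ξ^α` of `ΠE` with the momenta of `ΠE*`, and the fibre coordinates `η_α` of `ΠE*` with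
the momenta of `ΠE`. On both cotangent bundles there is the degree in the momenta and the natural
weight that comes from the Euler field of the vector bundle; `R^*` turns the first into the sum of
both and reverses the sign of the second (`momDeg_relabel_swapFib`, `cotWt_relabel_swapFib`). Hence
symbols of vector fields of weight `1` on `ΠE` (degree `1`, weight `1`) correspond to functions of
degree `2` and weight `-1` on `T*(ΠE*)`, and functions of weight `1` on `ΠE` (degree `0`, weight
`1`) correspond to symbols of vector fields of weight `-1` on `ΠE*` (degree `1`, weight `-1`).

Functions of degree `0` in the momenta are functions on the base, and odd functions of degree `1`
are symbols of vector fields (`eq_liftCot_of_momDeg_zero`, `eq_sym_of_momDeg_one`), compatibly with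
coordinate changes (`liftCot_compat_iff`, `sym_compat_iff`). Thus the pairs `(S, Q)` and `(D, q)`
correspond to each other bijectively, the sign in `𝒬 = -R^*q` being immaterial here.

The structure equations correspond because `R^*` preserves Poisson brackets (`poisson_subst_Rmap`),
and because the bracket of symbols is the symbol of the commutator: `{𝒟, 𝒟}` is the symbol of
`[D, D]`, so that `{S, S} = -2𝒬S` is `[D, D] = 2qD`; the bracket of `q` with `𝒟` is `D(q)`, so that
`{𝒬, S} = 0` is `D(q) = 0`; and `[Q, Q] = 0` holds automatically, as `{q, q} = 0`.

That `R` is globally defined means that it intertwines the coordinate changes of the two cotangent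
bundles (`subst_Rmap_cot_tr`). The essential point is the transformation law of the momenta `p_A`,
in which the derivative of the transition matrix of `E` appears on one side and that of its inverse
on the other (`SuperBundle.IsVectorBundle.dInvT_mul_invT`).

All of this rests on the calculus of superfunctions: pullback, defined by Taylor expansion in the
souls of the even coordinates, is an algebra homomorphism (`subst_mul`), satisfies the chain rule
(`pd_subst`), and is functorial as far as needed (`subst_subst_of_soul_eq_zero`,
`subst_subst_relabel`).
-/

noncomputable section

set_option linter.unusedSectionVars false

namespace SuperGeom

/-! ### Grassmann algebra -/

section Grassmann

variable {b b' : Type}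

/-- The part of Grassmann parity `ε` of the Grassmann algebra. -/
abbrev grPart (b : Type) (ε : ZMod 2) : Submodule ℝ (Gr b) :=
  CliffordAlgebra.evenOdd (0 : QuadraticForm ℝ (b → ℝ)) ε

theorem mul_mem_grPart {ε δ : ZMod 2} {x y : Gr b} (hx : x ∈ grPart b ε) (hy : y ∈ grPart b δ) :
    x * y ∈ grPart b (ε + δ) :=
  CliffordAlgebra.evenOdd_mul_le _ _ _ (Submodule.mul_mem_mul hx hy)

theorem algebraMap_mem_grPart (r : ℝ) : algebraMap ℝ (Gr b) r ∈ grPart b 0 :=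
  CliffordAlgebra.one_le_evenOdd_zero _ (Submodule.algebraMap_mem r)

theorem ι_mem_grPart (v : b → ℝ) : ExteriorAlgebra.ι ℝ v ∈ grPart b 1 :=
  CliffordAlgebra.ι_mem_evenOdd_one _ v

theorem ι_mul_eq (v : b → ℝ) (y : Gr b) :
    ExteriorAlgebra.ι ℝ v * y = CliffordAlgebra.involute y * ExteriorAlgebra.ι ℝ v := by
  induction y using ExteriorAlgebra.induction with
  | algebraMap r =>
    rw [AlgHom.commutes, Algebra.commutes]
  | ι w =>
    rw [show CliffordAlgebra.involute (ExteriorAlgebra.ι ℝ w) = - ExteriorAlgebra.ι ℝ w from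
      CliffordAlgebra.involute_ι w, neg_mul]
    exact eq_neg_of_add_eq_zero_left (ExteriorAlgebra.ι_add_mul_swap v w)
  | mul x y hx hy => rw [← mul_assoc, hx, mul_assoc, hy, map_mul, mul_assoc]
  | add x y hx hy => rw [mul_add, hx, hy, map_add, add_mul]

theorem even_mul_comm {x : Gr b} (hx : x ∈ grPart b 0) (y : Gr b) : x * y = y * x := by
  induction x, hx using CliffordAlgebra.even_induction with
  | algebraMap r => rw [Algebra.commutes]
  | add x y _ _ h1 h2 => rw [add_mul, mul_add, h1, h2]
  | ι_mul_ι_mul m₁ m₂ x hx ih =>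
    have h1 := ι_mul_eq m₁ (CliffordAlgebra.involute y)
    have h2 := ι_mul_eq m₂ y
    rw [CliffordAlgebra.involute_involute] at h1
    change ExteriorAlgebra.ι ℝ m₁ * ExteriorAlgebra.ι ℝ m₂ * x * y
      = y * (ExteriorAlgebra.ι ℝ m₁ * ExteriorAlgebra.ι ℝ m₂ * x)
    rw [mul_assoc, ih, ← mul_assoc, mul_assoc _ _ y, h2, ← mul_assoc, h1]
    simp only [mul_assoc]

theorem odd_mul_eq {x : Gr b} (hx : x ∈ grPart b 1) (y : Gr b) :
    x * y = CliffordAlgebra.involute y * x := by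
  induction x, hx using CliffordAlgebra.odd_induction with
  | ι v => exact ι_mul_eq v y
  | add x y _ _ h1 h2 => rw [add_mul, mul_add, h1, h2]
  | ι_mul_ι_mul m₁ m₂ x hx ih =>
    change ExteriorAlgebra.ι ℝ m₁ * ExteriorAlgebra.ι ℝ m₂ * x * y
      = CliffordAlgebra.involute y * (ExteriorAlgebra.ι ℝ m₁ * ExteriorAlgebra.ι ℝ m₂ * x)
    have := even_mul_comm
      (CliffordAlgebra.ι_mul_ι_mem_evenOdd_zero (0 : QuadraticForm ℝ (b → ℝ)) m₁ m₂)
      (CliffordAlgebra.involute y)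
    rw [mul_assoc, ih, ← mul_assoc]
    erw [this]
    simp only [mul_assoc]

theorem involute_even {x : Gr b} (hx : x ∈ grPart b 0) : CliffordAlgebra.involute x = x :=
  CliffordAlgebra.involute_eq_of_mem_even hx

theorem involute_odd {x : Gr b} (hx : x ∈ grPart b 1) : CliffordAlgebra.involute x = -x :=
  CliffordAlgebra.involute_eq_of_mem_odd hx

theorem odd_mul_odd {x y : Gr b} (hx : x ∈ grPart b 1) (hy : y ∈ grPart b 1) :
    x * y = - (y * x) := by
  rw [odd_mul_eq hx, involute_odd hy, neg_mul]

theorem odd_mul_self {x : Gr b} (hx : x ∈ grPart b 1) : x * x = 0 := by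
  have h := odd_mul_odd hx hx
  have h2 : (2 : ℝ) • (x * x) = 0 := by
    rw [two_smul]; nth_rewrite 1 [h]; exact neg_add_cancel _
  exact (smul_eq_zero.1 h2).resolve_left two_ne_zero

/-- Contraction with a covector is a graded derivation of the Grassmann algebra. -/
theorem contractLeft_mul (d : Module.Dual ℝ (b → ℝ)) (x y : Gr b) :
    CliffordAlgebra.contractLeft d (x * y) = CliffordAlgebra.contractLeft d x * y
      + CliffordAlgebra.involute x * CliffordAlgebra.contractLeft d y := by
  induction x using CliffordAlgebra.left_induction generalizing y with
  | algebraMap r =>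
    rw [CliffordAlgebra.contractLeft_algebraMap_mul, CliffordAlgebra.contractLeft_algebraMap,
      AlgHom.commutes, zero_mul, zero_add]
  | add x z hx hz => simp only [add_mul, map_add, hx, hz]; abel
  | ι_mul x v hx =>
    rw [mul_assoc, CliffordAlgebra.contractLeft_ι_mul, CliffordAlgebra.contractLeft_ι_mul, hx,
      map_mul, CliffordAlgebra.involute_ι, mul_add, sub_mul, smul_mul_assoc]
    simp only [neg_mul, mul_assoc]
    abel

theorem contractLeft_involute (d : Module.Dual ℝ (b → ℝ)) (x : Gr b) :
    CliffordAlgebra.contractLeft d (CliffordAlgebra.involute x)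
      = - CliffordAlgebra.involute (CliffordAlgebra.contractLeft d x) := by
  induction x using CliffordAlgebra.left_induction with
  | algebraMap r => simp
  | add x y hx hy => simp only [map_add, hx, hy, neg_add]
  | ι_mul x v hx =>
    simp only [map_mul, CliffordAlgebra.involute_ι, CliffordAlgebra.contractLeft_ι_mul, neg_mul,
      map_neg, hx, map_sub, map_smul]
    simp [sub_eq_add_neg, add_comm]

theorem mem_even_iff {x : Gr b} : x ∈ grPart b 0 ↔ CliffordAlgebra.involute x = x := by
  refine ⟨involute_even, fun h => ?_⟩
  obtain ⟨y, z, hy, hz, rfl⟩ := Submodule.codisjoint_iff_exists_add_eq.1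
    (CliffordAlgebra.evenOdd_isCompl (Q := (0 : QuadraticForm ℝ (b → ℝ)))).codisjoint x
  rw [map_add, involute_even hy, involute_odd hz, add_right_inj, neg_eq_iff_add_eq_zero,
    ← two_smul ℝ] at h
  rw [(smul_eq_zero.1 h).resolve_left two_ne_zero, add_zero]
  exact hy

theorem mem_odd_iff {x : Gr b} : x ∈ grPart b 1 ↔ CliffordAlgebra.involute x = -x := by
  refine ⟨involute_odd, fun h => ?_⟩
  obtain ⟨y, z, hy, hz, rfl⟩ := Submodule.codisjoint_iff_exists_add_eq.1
    (CliffordAlgebra.evenOdd_isCompl (Q := (0 : QuadraticForm ℝ (b → ℝ)))).codisjoint x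
  rw [map_add, involute_even hy, involute_odd hz, neg_add, add_left_inj, eq_neg_iff_add_eq_zero,
    ← two_smul ℝ] at h
  rw [(smul_eq_zero.1 h).resolve_left two_ne_zero, zero_add]
  exact hz

theorem zmod_two_cases (ε : ZMod 2) : ε = 0 ∨ ε = 1 := by
  fin_cases ε
  · exact Or.inl rfl
  · exact Or.inr rfl

theorem contractLeft_mem {ε : ZMod 2} (d : Module.Dual ℝ (b → ℝ)) {x : Gr b}
    (hx : x ∈ grPart b ε) : CliffordAlgebra.contractLeft d x ∈ grPart b (ε + 1) := by
  rcases zmod_two_cases ε with rfl | rfl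
  · rw [zero_add, mem_odd_iff]
    have := contractLeft_involute d x
    rw [involute_even hx] at this
    exact neg_eq_iff_eq_neg.1 this.symm
  · rw [show (1 : ZMod 2) + 1 = 0 from rfl, mem_even_iff]
    have := contractLeft_involute d x
    rw [involute_odd hx, map_neg, neg_inj] at this
    exact this.symm

theorem body_algebraMap (r : ℝ) : body (algebraMap ℝ (Gr b) r) = r :=
  ExteriorAlgebra.algebraMap_leftInverse _ r

theorem body_ι (v : b → ℝ) : body (ExteriorAlgebra.ι ℝ v) = 0 := by
  simp [body, ExteriorAlgebra.algebraMapInv]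

theorem body_involute (x : Gr b) : body (CliffordAlgebra.involute x) = body x := by
  induction x using ExteriorAlgebra.induction with
  | algebraMap r => rw [AlgHom.commutes]
  | ι v =>
    rw [show CliffordAlgebra.involute (ExteriorAlgebra.ι ℝ v) = - ExteriorAlgebra.ι ℝ v from
      CliffordAlgebra.involute_ι v, map_neg, body_ι, neg_zero]
  | mul x y hx hy => simp only [map_mul, hx, hy]
  | add x y hx hy => simp only [map_add, hx, hy]

theorem body_odd {x : Gr b} (hx : x ∈ grPart b 1) : body x = 0 := by
  have h := body_involute x
  rw [involute_odd hx, map_neg] at h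
  linarith

theorem soul_mem {x : Gr b} (hx : x ∈ grPart b 0) : soul x ∈ grPart b 0 :=
  Submodule.sub_mem _ hx (algebraMap_mem_grPart _)

theorem body_soul (x : Gr b) : body (soul x) = 0 := by
  rw [soul, map_sub, body_algebraMap, sub_self]

theorem body_add_soul (x : Gr b) : algebraMap ℝ (Gr b) (body x) + soul x = x := by
  rw [soul, add_sub_cancel]

/-- The ideal of nilpotent elements of the Grassmann algebra, as a subspace. -/
def augIdeal (b : Type) : Submodule ℝ (Gr b) := LinearMap.ker (body (b := b)).toLinearMap

theorem mem_augIdeal {x : Gr b} : x ∈ augIdeal b ↔ body x = 0 := Iff.rfl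

theorem augIdeal_le :
    augIdeal b ≤ LinearMap.range (ExteriorAlgebra.ι ℝ (M := b → ℝ)) * ⊤ := by
  have key : ∀ x : Gr b, x - algebraMap ℝ (Gr b) (body x) ∈
      LinearMap.range (ExteriorAlgebra.ι ℝ (M := b → ℝ)) * (⊤ : Submodule ℝ (Gr b)) := by
    intro x
    induction x using CliffordAlgebra.left_induction with
    | algebraMap r =>
      rw [show body (algebraMap ℝ (CliffordAlgebra (0 : QuadraticForm ℝ (b → ℝ))) r) = r from
        body_algebraMap r, sub_self]
      exact Submodule.zero_mem _
    | add x y hx hy =>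
      have := Submodule.add_mem _ hx hy
      rwa [← add_sub_add_comm, ← map_add, ← map_add] at this
    | ι_mul x v hx =>
      rw [map_mul, show body (CliffordAlgebra.ι (0 : QuadraticForm ℝ (b → ℝ)) v) = 0 from body_ι v,
        zero_mul, map_zero, sub_zero]
      exact Submodule.mul_mem_mul ⟨v, rfl⟩ Submodule.mem_top
  intro x hx
  have := key x
  rwa [mem_augIdeal.1 hx, map_zero, sub_zero] at this

theorem top_mul_range_ι_le :
    (⊤ : Submodule ℝ (Gr b)) * LinearMap.range (ExteriorAlgebra.ι ℝ (M := b → ℝ)) ≤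
      LinearMap.range (ExteriorAlgebra.ι ℝ (M := b → ℝ)) * ⊤ := by
  rw [Submodule.mul_le]
  rintro x - _ ⟨v, rfl⟩
  have := ι_mul_eq v (CliffordAlgebra.involute x)
  rw [CliffordAlgebra.involute_involute] at this
  rw [← this]
  exact Submodule.mul_mem_mul ⟨v, rfl⟩ Submodule.mem_top

theorem augIdeal_pow_le (k : ℕ) :
    augIdeal b ^ k ≤ LinearMap.range (ExteriorAlgebra.ι ℝ (M := b → ℝ)) ^ k * ⊤ := by
  set V := LinearMap.range (ExteriorAlgebra.ι ℝ (M := b → ℝ)) with hV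
  induction k with
  | zero => rw [pow_zero, pow_zero, one_mul]; exact le_top
  | succ k ih =>
    rw [pow_succ, pow_succ]
    calc augIdeal b ^ k * augIdeal b ≤ V ^ k * ⊤ * (V * ⊤) := mul_le_mul' ih augIdeal_le
      _ = V ^ k * (⊤ * V) * ⊤ := by simp only [mul_assoc]
      _ ≤ V ^ k * (V * ⊤) * ⊤ :=
        mul_le_mul' (mul_le_mul' le_rfl top_mul_range_ι_le) le_rfl
      _ = V ^ k * V * (⊤ * ⊤) := by simp only [mul_assoc]
      _ ≤ V ^ k * V * ⊤ := mul_le_mul' le_rfl le_top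

/-- A product of more nilpotent elements than there are odd generators vanishes. -/
theorem augIdeal_pow_eq_bot [Fintype b] {k : ℕ} (hk : Fintype.card b < k) :
    augIdeal b ^ k = ⊥ := by
  have h : LinearMap.range (ExteriorAlgebra.ι ℝ (M := b → ℝ)) ^ k = ⊥ := by
    have h1 : Module.finrank ℝ (⋀[ℝ]^k (b → ℝ)) = 0 := by
      rw [exteriorPower.finrank_eq, Module.finrank_fintype_fun_eq_card, Nat.choose_eq_zero_of_lt hk]
    exact Submodule.finrank_eq_zero.1 h1
  have := augIdeal_pow_le (b := b) k
  rwa [h, Submodule.bot_mul, le_bot_iff] at this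

/-! ### Homomorphisms of Grassmann algebras -/

section GrHom

variable [Fintype b] [DecidableEq b] [Fintype b'] [DecidableEq b'] {t : b' → Gr b}

theorem linearCombination_odd (ht : ∀ m, t m ∈ grPart b 1) (v : b' → ℝ) :
    Fintype.linearCombination ℝ t v ∈ grPart b 1 := by
  rw [Fintype.linearCombination_apply]
  exact Submodule.sum_mem _ fun m _ => Submodule.smul_mem _ _ (ht m)

theorem grHom_ι (ht : ∀ m, t m ∈ grPart b 1) (v : b' → ℝ) :
    grHom t (ExteriorAlgebra.ι ℝ v) = ∑ m, v m • t m := by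
  rw [grHom, dif_pos fun m => odd_mul_self (linearCombination_odd ht m),
    ExteriorAlgebra.lift_ι_apply, Fintype.linearCombination_apply]

theorem grHom_gen (ht : ∀ m, t m ∈ grPart b 1) (m : b') :
    grHom t (ExteriorAlgebra.ι ℝ (Pi.single m 1)) = t m := by
  rw [grHom_ι ht, Finset.sum_eq_single m] <;> simp +contextual

theorem algHom_ext_gen {A : Type*} [Semiring A] [Algebra ℝ A] {f g : Gr b' →ₐ[ℝ] A}
    (h : ∀ m, f (ExteriorAlgebra.ι ℝ (Pi.single m 1)) = g (ExteriorAlgebra.ι ℝ (Pi.single m 1))) :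
    f = g := by
  apply ExteriorAlgebra.hom_ext
  refine LinearMap.pi_ext' fun m => LinearMap.ext_ring ?_
  simpa using h m

theorem body_grHom (ht : ∀ m, t m ∈ grPart b 1) (g : Gr b') : body (grHom t g) = body g := by
  have : (body (b := b)).comp (grHom t) = body := algHom_ext_gen fun m => by
    rw [AlgHom.comp_apply, grHom_gen ht, body_odd (ht m), body_ι]
  exact DFunLike.congr_fun this g

theorem involute_grHom (ht : ∀ m, t m ∈ grPart b 1) (g : Gr b') :
    CliffordAlgebra.involute (grHom t g) = grHom t (CliffordAlgebra.involute g) := by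
  have : AlgHom.comp (CliffordAlgebra.involute (Q := (0 : QuadraticForm ℝ (b → ℝ)))) (grHom t)
      = (grHom t).comp (CliffordAlgebra.involute (Q := (0 : QuadraticForm ℝ (b' → ℝ)))) :=
    algHom_ext_gen fun m => by
      rw [AlgHom.comp_apply, grHom_gen ht, involute_odd (ht m), AlgHom.comp_apply]
      rw [involute_odd (ι_mem_grPart _), map_neg, grHom_gen ht]
  exact DFunLike.congr_fun this g

theorem grHom_mem (ht : ∀ m, t m ∈ grPart b 1) {ε : ZMod 2} {g : Gr b'} (hg : g ∈ grPart b' ε) :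
    grHom t g ∈ grPart b ε := by
  rcases zmod_two_cases ε with rfl | rfl
  · rw [mem_even_iff, involute_grHom ht, involute_even hg]
  · rw [mem_odd_iff, involute_grHom ht, involute_odd hg, map_neg]

theorem grHom_grHom {b'' : Type} [Fintype b''] [DecidableEq b''] (ht : ∀ m, t m ∈ grPart b 1)
    {u : b'' → Gr b'} (hu : ∀ m, u m ∈ grPart b' 1) (g : Gr b'') :
    grHom t (grHom u g) = grHom (fun m => grHom t (u m)) g := by
  have : (grHom t).comp (grHom u) = grHom (fun m => grHom t (u m)) := algHom_ext_gen fun m => by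
    rw [AlgHom.comp_apply, grHom_gen hu, grHom_gen fun m => grHom_mem ht (hu m)]
  exact DFunLike.congr_fun this g

theorem grHom_gen_self (g : Gr b') :
    grHom (fun m : b' => ExteriorAlgebra.ι ℝ (Pi.single m (1 : ℝ))) g = g := by
  have : grHom (fun m : b' => ExteriorAlgebra.ι ℝ (Pi.single m (1 : ℝ))) = AlgHom.id ℝ (Gr b') :=
    algHom_ext_gen fun m => by
      rw [grHom_gen fun m => ι_mem_grPart (Pi.single m (1 : ℝ))]; rfl
  exact DFunLike.congr_fun this g

/-- The generator of the Grassmann algebra of index `m`. -/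
def gen {b : Type} [DecidableEq b] (m : b) : Gr b := ExteriorAlgebra.ι ℝ (Pi.single m (1 : ℝ))

/-- The left derivative along the generator of index `m`. -/
def oddDeriv {b : Type} (m : b) : Gr b →ₗ[ℝ] Gr b :=
  CliffordAlgebra.contractLeft (LinearMap.proj m : (b → ℝ) →ₗ[ℝ] ℝ)

/-- The grading automorphism of the Grassmann algebra. -/
def grInv {b : Type} : Gr b →ₐ[ℝ] Gr b := CliffordAlgebra.involute

theorem gen_odd (m : b) : gen m ∈ grPart b 1 := ι_mem_grPart _

theorem grHom_gen' (ht : ∀ m, t m ∈ grPart b 1) (m : b') : grHom t (gen m) = t m :=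
  grHom_gen ht m

theorem grInv_grInv (x : Gr b) : grInv (grInv x) = x := CliffordAlgebra.involute_involute x

theorem grInv_even {x : Gr b} (hx : x ∈ grPart b 0) : grInv x = x := involute_even hx

theorem grInv_odd {x : Gr b} (hx : x ∈ grPart b 1) : grInv x = -x := involute_odd hx

theorem oddDeriv_mul (m : b) (x y : Gr b) :
    oddDeriv m (x * y) = oddDeriv m x * y + grInv x * oddDeriv m y := contractLeft_mul _ x y

theorem oddDeriv_algebraMap (m : b) (r : ℝ) : oddDeriv m (algebraMap ℝ (Gr b) r) = 0 :=
  CliffordAlgebra.contractLeft_algebraMap (Q := 0) _ _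

theorem oddDeriv_gen (m k : b) : oddDeriv m (gen k) = if m = k then 1 else 0 := by
  have : oddDeriv m (gen k) = algebraMap ℝ (Gr b) ((Pi.single k (1 : ℝ) : b → ℝ) m) :=
    CliffordAlgebra.contractLeft_ι (Q := 0) _ _
  rw [this, Pi.single_apply]
  split_ifs <;> simp

theorem oddDeriv_mem {ε : ZMod 2} (m : b) {x : Gr b} (hx : x ∈ grPart b ε) :
    oddDeriv m x ∈ grPart b (ε + 1) := contractLeft_mem _ hx

theorem oddDeriv_odd (m : b) {x : Gr b} (hx : x ∈ grPart b 1) : oddDeriv m x ∈ grPart b 0 := by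
  have := oddDeriv_mem m hx
  rwa [show (1 : ZMod 2) + 1 = 0 from rfl] at this

theorem ι_eq_sum_gen (v : b → ℝ) : ExteriorAlgebra.ι ℝ v = ∑ m, v m • gen m := by
  conv_lhs => rw [show v = ∑ m, v m • (Pi.single m (1 : ℝ) : b → ℝ) from by
    ext k; simp [Finset.sum_apply, Pi.single_apply]]
  rw [map_sum]
  exact Finset.sum_congr rfl fun m _ => map_smul _ _ _

/-- Induction on Grassmann elements: every element is built from scalars by sums and left
multiplications with generators. -/
theorem gr_induction {P : Gr b → Prop} (hr : ∀ r, P (algebraMap ℝ (Gr b) r))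
    (ha : ∀ x y, P x → P y → P (x + y)) (hg : ∀ m x, P x → P (gen m * x)) (g : Gr b) : P g := by
  suffices h : ∀ r : ℝ, P (r • g) by simpa using h 1
  induction g using CliffordAlgebra.left_induction with
  | algebraMap s =>
    intro r
    have h : r • algebraMap ℝ (Gr b) s = algebraMap ℝ (Gr b) (r * s) := by
      rw [map_mul, Algebra.smul_def]
    exact h ▸ hr _
  | add x y hx hy => intro r; rw [smul_add]; exact ha _ _ (hx r) (hy r)
  | ι_mul x v hx =>
    intro r
    have h1 : r • (CliffordAlgebra.ι (0 : QuadraticForm ℝ (b → ℝ)) v * x) =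
        ∑ m, gen m * ((r * v m) • x) := by
      rw [show CliffordAlgebra.ι (0 : QuadraticForm ℝ (b → ℝ)) v = ∑ m, v m • gen m from
        ι_eq_sum_gen v, Finset.sum_mul, Finset.smul_sum]
      refine Finset.sum_congr rfl fun m _ => ?_
      rw [smul_mul_assoc, mul_smul_comm, smul_smul]
    rw [h1]
    refine Finset.sum_induction _ P ha (by simpa using hr 0) fun m _ => hg m _ (hx _)

/-- The chain rule for odd derivatives under a homomorphism of Grassmann algebras. -/
theorem oddDeriv_grHom (ht : ∀ m, t m ∈ grPart b 1) (k : b) (g : Gr b') :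
    oddDeriv k (grHom t g) = ∑ m, oddDeriv k (t m) * grHom t (oddDeriv m g) := by
  induction g using gr_induction with
  | hr r => simp [oddDeriv_algebraMap, AlgHom.commutes]
  | ha x y hx hy => simp only [map_add, hx, hy, mul_add, Finset.sum_add_distrib]
  | hg j x hx =>
    have h3 : ∀ m, oddDeriv k (t m) ∈ grPart b 0 := fun m => oddDeriv_odd k (ht m)
    have h4 : ∀ m, grHom t (oddDeriv m (gen j * x)) =
      (if m = j then 1 else 0) * grHom t x - t j * grHom t (oddDeriv m x) := fun m => by
      rw [oddDeriv_mul, oddDeriv_gen, grInv_odd (gen_odd j), map_add, map_mul, map_mul, map_neg,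
        grHom_gen' ht, neg_mul, ← sub_eq_add_neg]
      split_ifs <;> simp only [map_one, map_zero]
    simp only [h4, mul_sub, Finset.sum_sub_distrib, ite_mul, one_mul, zero_mul, mul_ite, mul_zero,
      Finset.sum_ite_eq', Finset.mem_univ, if_true]
    rw [map_mul, grHom_gen' ht, oddDeriv_mul, grInv_odd (ht j), hx, sub_eq_add_neg,
      neg_mul, Finset.mul_sum]
    congr 2
    refine Finset.sum_congr rfl fun m _ => ?_
    rw [← mul_assoc, ← mul_assoc, even_mul_comm (h3 m)]

end GrHom

end Grassmann

/-! ### Calculus of superfunctions -/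

section Calculus

variable {a b b' : Type} [Fintype a] [DecidableEq a] [Fintype b] [DecidableEq b]
  [Fintype b'] [DecidableEq b']

/-- Multiplication of Grassmann numbers as a continuous bilinear map. -/
def mulCLM (b : Type) [Fintype b] : Gr b →L[ℝ] Gr b →L[ℝ] Gr b :=
  (LinearMap.mul ℝ (Gr b)).toContinuousBilinearMap

theorem mulCLM_apply (x y : Gr b) : mulCLM b x y = x * y := rfl

theorem contDiffOn_linear (L : Gr b →ₗ[ℝ] Gr b') {n : ℕ∞ω} {U : Set (a → ℝ)} {f : SFun a b}
    (hf : ContDiffOn ℝ n f U) : ContDiffOn ℝ n (fun x => L (f x)) U :=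
  (LinearMap.toContinuousLinearMap L).contDiff.comp_contDiffOn hf

theorem fderiv_linear (L : Gr b →ₗ[ℝ] Gr b') {f : SFun a b} {x : a → ℝ}
    (hf : DifferentiableAt ℝ f x) (v : a → ℝ) :
    fderiv ℝ (fun x => L (f x)) x v = L (fderiv ℝ f x v) := by
  have := ((LinearMap.toContinuousLinearMap L).hasFDerivAt.comp x hf.hasFDerivAt).fderiv
  exact DFunLike.congr_fun this v

theorem contDiffOn_mul {n : ℕ∞ω} {U : Set (a → ℝ)} {f g : SFun a b}
    (hf : ContDiffOn ℝ n f U) (hg : ContDiffOn ℝ n g U) : ContDiffOn ℝ n (f * g) U :=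
  ((mulCLM b).isBoundedBilinearMap.contDiff).comp_contDiffOn (hf.prodMk hg)

theorem contDiffOn_add {n : ℕ∞ω} {U : Set (a → ℝ)} {f g : SFun a b}
    (hf : ContDiffOn ℝ n f U) (hg : ContDiffOn ℝ n g U) : ContDiffOn ℝ n (f + g) U := hf.add hg

theorem contDiffOn_smul {n : ℕ∞ω} {U : Set (a → ℝ)} {f : SFun a b} (r : ℝ)
    (hf : ContDiffOn ℝ n f U) : ContDiffOn ℝ n (r • f) U := hf.const_smul r

theorem contDiffOn_sum {n : ℕ∞ω} {U : Set (a → ℝ)} {ι : Type*} (S : Finset ι) {f : ι → SFun a b}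
    (hf : ∀ i ∈ S, ContDiffOn ℝ n (f i) U) : ContDiffOn ℝ n (∑ i ∈ S, f i) U := by
  rw [show ∑ i ∈ S, f i = fun x => ∑ i ∈ S, f i x from funext fun x => Finset.sum_apply x S f]
  exact ContDiffOn.sum hf

theorem hasFDerivAt_mul {f g : SFun a b} {x : a → ℝ} (hf : DifferentiableAt ℝ f x)
    (hg : DifferentiableAt ℝ g x) : HasFDerivAt (f * g)
      ((mulCLM b).precompR (a → ℝ) (f x) (fderiv ℝ g x) +
        (mulCLM b).precompL (a → ℝ) (fderiv ℝ f x) (g x)) x :=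
  (mulCLM b).hasFDerivAt_of_bilinear hf.hasFDerivAt hg.hasFDerivAt

theorem differentiableAt_mul {f g : SFun a b} {x : a → ℝ} (hf : DifferentiableAt ℝ f x)
    (hg : DifferentiableAt ℝ g x) : DifferentiableAt ℝ (f * g) x :=
  (hasFDerivAt_mul hf hg).differentiableAt

/-- The sign `g ↦ (-1)^(ÃG̃) g` that arises when a coordinate of index `A` passes `g`. -/
def sgn (A : a ⊕ b) : Gr b' →ₐ[ℝ] Gr b' := Sum.elim (fun _ => AlgHom.id ℝ _) (fun _ => grInv) A

theorem sgn_even (A : a ⊕ b) {x : Gr b'} (hx : x ∈ grPart b' 0) : sgn A x = x := by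
  rcases A with s | m
  · rfl
  · exact grInv_even hx

theorem sgn_sgn (A : a ⊕ b) (x : Gr b') : sgn A (sgn A x) = x := by
  rcases A with s | m
  · rfl
  · exact grInv_grInv x

theorem pd_inl (s : a) (f : SFun a b) (x : a → ℝ) :
    pd (Sum.inl s) f x = fderiv ℝ f x (Pi.single s 1) := rfl

theorem pd_inr (m : b) (f : SFun a b) (x : a → ℝ) : pd (Sum.inr m) f x = oddDeriv m (f x) := rfl

theorem pd_mul (A : a ⊕ b) {f g : SFun a b} {x : a → ℝ} (hf : DifferentiableAt ℝ f x)
    (hg : DifferentiableAt ℝ g x) :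
    pd A (f * g) x = pd A f x * g x + sgn A (f x) * pd A g x := by
  rcases A with s | m
  · rw [pd_inl, (hasFDerivAt_mul hf hg).fderiv]
    simp only [add_apply, ContinuousLinearMap.precompR_apply,
      ContinuousLinearMap.precompL_apply, mulCLM_apply]
    rw [add_comm]; rfl
  · exact oddDeriv_mul m _ _

theorem pd_congr (A : a ⊕ b) {f g : SFun a b} {x : a → ℝ} (h : f =ᶠ[nhds x] g) :
    pd A f x = pd A g x := by
  rcases A with s | m
  · rw [pd_inl, pd_inl, h.fderiv_eq]
  · rw [pd_inr, pd_inr, h.eq_of_nhds]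

theorem pd_congr_of_isOpen (A : a ⊕ b) {U : Set (a → ℝ)} (hU : IsOpen U) {f g : SFun a b}
    {x : a → ℝ} (hx : x ∈ U) (h : ∀ y ∈ U, f y = g y) : pd A f x = pd A g x :=
  pd_congr A (Filter.eventuallyEq_of_mem (hU.mem_nhds hx) h)

theorem pd_add (A : a ⊕ b) {f g : SFun a b} {x : a → ℝ} (hf : DifferentiableAt ℝ f x)
    (hg : DifferentiableAt ℝ g x) : pd A (f + g) x = pd A f x + pd A g x := by
  rcases A with s | m
  · rw [pd_inl, fderiv_add hf hg]; rfl
  · exact map_add _ _ _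

theorem pd_sum (A : a ⊕ b) {ι : Type*} (S : Finset ι) {f : ι → SFun a b} {x : a → ℝ}
    (hf : ∀ i ∈ S, DifferentiableAt ℝ (f i) x) :
    pd A (∑ i ∈ S, f i) x = ∑ i ∈ S, pd A (f i) x := by
  rcases A with s | m
  · rw [pd_inl, fderiv_sum hf, sum_apply]; rfl
  · rw [pd_inr, Finset.sum_apply, map_sum]; rfl

theorem pd_const_smul (A : a ⊕ b) (r : ℝ) {f : SFun a b} {x : a → ℝ}
    (hf : DifferentiableAt ℝ f x) : pd A (r • f) x = r • pd A f x := by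
  rcases A with s | m
  · rw [pd_inl, fderiv_const_smul hf]; rfl
  · exact (oddDeriv m).map_smul r (f x)

theorem pd_const (A : a ⊕ b) (r : ℝ) (x : a → ℝ) :
    pd A (fun _ => algebraMap ℝ (Gr b) r) x = 0 := by
  rcases A with s | m
  · rw [pd_inl, fderiv_fun_const]; rfl
  · exact oddDeriv_algebraMap _ _

theorem contDiff_coord (A : a ⊕ b) : ContDiff ℝ ∞ (coord A : SFun a b) := by
  rcases A with s | m
  · have : ContDiff ℝ ∞ (fun x : a → ℝ => x s) := contDiff_apply ℝ ℝ s
    exact (LinearMap.toContinuousLinearMap (Algebra.linearMap ℝ (Gr b))).contDiff.comp this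
  · exact contDiff_const

theorem differentiableAt_coord (A : a ⊕ b) (x : a → ℝ) :
    DifferentiableAt ℝ (coord A : SFun a b) x :=
  (contDiff_coord A).differentiable (by simp) x

theorem coord_mem (A : a ⊕ b) (x : a → ℝ) : (coord A : SFun a b) x ∈ grPart b (par A) := by
  rcases A with s | m
  · exact algebraMap_mem_grPart _
  · exact ι_mem_grPart _

theorem pd_coord (A B : a ⊕ b) (x : a → ℝ) :
    pd A (coord B) x = if A = B then (1 : Gr b) else 0 := by
  rcases A with s | m <;> rcases B with r | k
  · have h : HasFDerivAt (coord (Sum.inl r) : SFun a b)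
        ((LinearMap.toContinuousLinearMap (Algebra.linearMap ℝ (Gr b))).comp
          (ContinuousLinearMap.proj r)) x :=
      (LinearMap.toContinuousLinearMap (Algebra.linearMap ℝ (Gr b))).hasFDerivAt.comp x
        (ContinuousLinearMap.proj (R := ℝ) (φ := fun _ : a => ℝ) r).hasFDerivAt
    rw [pd_inl, h.fderiv]
    change algebraMap ℝ (Gr b) ((Pi.single s (1 : ℝ) : a → ℝ) r) = _
    rw [Pi.single_apply]
    by_cases h : s = r
    · subst h; simp
    · simp [h, Ne.symm h]
  · rw [pd_inl, show (coord (Sum.inr k) : SFun a b) = fun _ => gen k from rfl, fderiv_fun_const]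
    simp
  · rw [pd_inr, if_neg (by simp)]
    exact oddDeriv_algebraMap _ _
  · rw [pd_inr, show (coord (Sum.inr k) : SFun a b) x = gen k from rfl, oddDeriv_gen]
    simp

theorem contDiffOn_pd (A : a ⊕ b) {U : Set (a → ℝ)} (hU : IsOpen U) {f : SFun a b}
    (hf : ContDiffOn ℝ ∞ f U) : ContDiffOn ℝ ∞ (pd A f) U := by
  rcases A with s | m
  · exact (hf.fderiv_of_isOpen hU (m := ∞) (by simp)).clm_apply contDiffOn_const
  · exact contDiffOn_linear _ hf

theorem ContDiffOn.differentiableAt_of_isOpen {U : Set (a → ℝ)} (hU : IsOpen U) {f : SFun a b}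
    (hf : ContDiffOn ℝ ∞ f U) {x : a → ℝ} (hx : x ∈ U) : DifferentiableAt ℝ f x :=
  (hf.contDiffAt (hU.mem_nhds hx)).differentiableAt (by simp)

theorem pd_mem (A : a ⊕ b) {U : Set (a → ℝ)} (hU : IsOpen U) {f : SFun a b}
    (hf : ContDiffOn ℝ ∞ f U) {ε : ZMod 2} (hε : ParityOn U ε f) :
    ParityOn U (ε + par A) (pd A f) := by
  intro x hx
  rcases A with s | m
  · have hd := ContDiffOn.differentiableAt_of_isOpen hU hf hx
    have h1 := fderiv_linear (grInv (b := b)).toLinearMap hd (Pi.single s 1)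
    have hn := hU.mem_nhds hx
    change _ ∈ grPart b (ε + 0)
    rw [add_zero]
    rcases zmod_two_cases ε with rfl | rfl
    · have h2 : (fun y => (grInv (b := b)).toLinearMap (f y)) =ᶠ[nhds x] f :=
        Filter.eventuallyEq_of_mem hn fun y hy => grInv_even (hε y hy)
      rw [h2.fderiv_eq] at h1
      exact mem_even_iff.2 h1.symm
    · have h2 : (fun y => (grInv (b := b)).toLinearMap (f y)) =ᶠ[nhds x] -f :=
        Filter.eventuallyEq_of_mem hn fun y hy => grInv_odd (hε y hy)
      rw [h2.fderiv_eq, fderiv_neg] at h1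
      exact mem_odd_iff.2 h1.symm
  · exact oddDeriv_mem m (hε x hx)

theorem pd_inl_comm (s : a) (A : a ⊕ b) {U : Set (a → ℝ)} (hU : IsOpen U) {f : SFun a b}
    (hf : ContDiffOn ℝ ∞ f U) {x : a → ℝ} (hx : x ∈ U) :
    pd (Sum.inl s) (pd A f) x = pd A (pd (Sum.inl s) f) x := by
  rcases A with r | m
  · have hn := hU.mem_nhds hx
    have hd : DifferentiableAt ℝ (fderiv ℝ f) x :=
      ((hf.contDiffAt hn).fderiv_right (m := 1) (by norm_cast)).differentiableAt (by simp)
    have hs : IsSymmSndFDerivAt ℝ f x := (hf.contDiffAt hn).isSymmSndFDerivAt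
      (by simp only [minSmoothness_of_isRCLikeNormedField]
          exact WithTop.coe_le_coe.2 (le_top : (2 : ℕ∞) ≤ ⊤))
    have key : ∀ v w : a → ℝ, fderiv ℝ (fun y => fderiv ℝ f y w) x v
        = fderiv ℝ (fderiv ℝ f) x v w := fun v w => by
      rw [fderiv_clm_apply hd (differentiableAt_const w)]
      simp
    exact (key _ _).trans ((hs _ _).trans (key _ _).symm)
  · exact fderiv_linear (oddDeriv m) (ContDiffOn.differentiableAt_of_isOpen hU hf hx) _

theorem pd_inr_comm (m k : b) (f : SFun a b) (x : a → ℝ) :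
    pd (Sum.inr m) (pd (Sum.inr k) f) x = - pd (Sum.inr k) (pd (Sum.inr m) f) x :=
  CliffordAlgebra.contractLeft_comm (Q := 0) _ _ _

end Calculus

/-! ### Substitution -/

section Substitution

variable {a b a' b' : Type} [Fintype a] [DecidableEq a] [Fintype b] [DecidableEq b]
  [Fintype a'] [DecidableEq a'] [Fintype b'] [DecidableEq b']

/-- The superfunctions `φ` are the components of a morphism of superdomains `U → V`. -/
structure IsSuperMap (U : Set (a → ℝ)) (V : Set (a' → ℝ)) (φ : a' ⊕ b' → SFun a b) : Prop where
  isOpen_source : IsOpen U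
  isOpen_target : IsOpen V
  smooth : ∀ A, ContDiffOn ℝ ∞ (φ A) U
  parity : ∀ A, ParityOn U (par A) (φ A)
  mapsTo : Set.MapsTo (bodyMap φ) U V

/-- `k!` times the term of order `k` in the souls of the Taylor expansion that defines
`subst φ f`, by recursion on `k`: each step applies the operator `∑ soul(φ_s) ∂_s`. -/
def taylorTerm (φ : a' ⊕ b' → SFun a b) : ℕ → SFun a' b' → SFun a b
  | 0, f => fun x => grHom (fun m => φ (Sum.inr m) x) (f (bodyMap φ x))
  | k + 1, f => fun x => ∑ s : a', soul (φ (Sum.inl s) x) * taylorTerm φ k (pd (Sum.inl s) f) x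

variable {U : Set (a → ℝ)} {V : Set (a' → ℝ)} {φ : a' ⊕ b' → SFun a b} {f g : SFun a' b'}
  {x : a → ℝ}

theorem IsSuperMap.odd (hφ : IsSuperMap U V φ) (hx : x ∈ U) (m : b') :
    φ (Sum.inr m) x ∈ grPart b 1 := hφ.parity (Sum.inr m) x hx

theorem IsSuperMap.even (hφ : IsSuperMap U V φ) (hx : x ∈ U) (s : a') :
    φ (Sum.inl s) x ∈ grPart b 0 := hφ.parity (Sum.inl s) x hx

theorem IsSuperMap.soul_even (hφ : IsSuperMap U V φ) (hx : x ∈ U) (s : a') :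
    soul (φ (Sum.inl s) x) ∈ grPart b 0 := soul_mem (hφ.even hx s)

theorem taylorTerm_zero (φ : a' ⊕ b' → SFun a b) (f : SFun a' b') (x : a → ℝ) :
    taylorTerm φ 0 f x = grHom (fun m => φ (Sum.inr m) x) (f (bodyMap φ x)) := rfl

theorem taylorTerm_succ (φ : a' ⊕ b' → SFun a b) (k : ℕ) (f : SFun a' b') (x : a → ℝ) :
    taylorTerm φ (k + 1) f x =
      ∑ s : a', soul (φ (Sum.inl s) x) * taylorTerm φ k (pd (Sum.inl s) f) x := rfl

theorem iteratedFDeriv_pd (k : ℕ) (s : a') {y : a' → ℝ} (hf : ContDiffAt ℝ ∞ f y)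
    (v : Fin k → a' → ℝ) :
    iteratedFDeriv ℝ k (pd (Sum.inl s) f) y v =
      iteratedFDeriv ℝ (k + 1) f y (Fin.snoc v (Pi.single s 1)) := by
  have h1 : ContDiffAt ℝ k (fderiv ℝ f) y := hf.fderiv_right (by exact_mod_cast le_top)
  rw [iteratedFDeriv_succ_apply_right, Fin.init_snoc, Fin.snoc_last]
  have := (ContinuousLinearMap.apply ℝ (Gr b')
    (Pi.single s (1 : ℝ) : a' → ℝ)).iteratedFDeriv_comp_left
    h1 (i := k) le_rfl
  exact DFunLike.congr_fun this v

/-- The iterated derivatives in the definition of `subst` can be computed by repeated partial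
derivatives; this makes induction on the order of the Taylor term possible. -/
theorem sum_iteratedFDeriv_eq_taylorTerm (hφ : IsSuperMap U V φ) (hx : x ∈ U) (k : ℕ)
    {f : SFun a' b'} (hf : ContDiffOn ℝ ∞ f V) :
    ∑ j : Fin k → a', (List.ofFn fun l => soul (φ (Sum.inl (j l)) x)).prod *
        grHom (fun m => φ (Sum.inr m) x)
          (iteratedFDeriv ℝ k f (bodyMap φ x) (fun l => Pi.single (j l) (1 : ℝ))) =
      taylorTerm φ k f x := by
  induction k generalizing f with
  | zero => simp [taylorTerm_zero]
  | succ k ih =>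
    have hy := hφ.isOpen_target.mem_nhds (hφ.mapsTo hx)
    rw [taylorTerm_succ, ← (Fin.snocEquiv (fun _ : Fin (k + 1) => a')).sum_comp,
      Fintype.sum_prod_type]
    refine Finset.sum_congr rfl fun s _ => ?_
    rw [← ih (contDiffOn_pd (Sum.inl s) hφ.isOpen_target hf), Finset.mul_sum]
    refine Finset.sum_congr rfl fun j _ => ?_
    rw [iteratedFDeriv_pd k s (hf.contDiffAt hy), even_mul_comm (hφ.soul_even hx s)]
    rw [List.ofFn_succ']
    simp only [Fin.snocEquiv, Equiv.coe_fn_mk, Fin.snoc_castSucc, Fin.snoc_last,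
      List.concat_eq_append, List.prod_append, List.prod_singleton]
    rw [mul_assoc, mul_assoc, even_mul_comm (hφ.soul_even hx s)]
    congr 4
    funext l
    refine Fin.lastCases ?_ (fun l => ?_) l
    · simp
    · simp

theorem subst_eq_sum_taylorTerm (hφ : IsSuperMap U V φ) (hx : x ∈ U)
    (hf : ContDiffOn ℝ ∞ f V) : subst φ f x =
      ∑ k ∈ Finset.range (Fintype.card b + 1), ((k.factorial : ℝ)⁻¹) • taylorTerm φ k f x :=
  Finset.sum_congr rfl fun k _ => by rw [← sum_iteratedFDeriv_eq_taylorTerm hφ hx k hf]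

theorem taylorTerm_mem_pow (φ : a' ⊕ b' → SFun a b) (k : ℕ) (f : SFun a' b') (x : a → ℝ) :
    taylorTerm φ k f x ∈ augIdeal b ^ k * ⊤ := by
  induction k generalizing f with
  | zero => rw [pow_zero, one_mul]; exact Submodule.mem_top
  | succ k ih =>
    rw [taylorTerm_succ, pow_succ', mul_assoc]
    have h : ∀ s, soul (φ (Sum.inl s) x) ∈ augIdeal b := fun s => mem_augIdeal.2 (body_soul _)
    refine Submodule.sum_mem (augIdeal b * (augIdeal b ^ k * ⊤)) fun s _ => ?_
    exact Submodule.mul_mem_mul (h s) (ih _)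

theorem taylorTerm_eq_zero {k : ℕ} (hk : Fintype.card b < k) (φ : a' ⊕ b' → SFun a b)
    (f : SFun a' b') (x : a → ℝ) : taylorTerm φ k f x = 0 := by
  have := taylorTerm_mem_pow φ k f x
  rwa [augIdeal_pow_eq_bot hk, Submodule.bot_mul, Submodule.mem_bot] at this

/-- The range of summation in `subst` can be extended, as the additional terms vanish. -/
theorem subst_eq_sum_range (hφ : IsSuperMap U V φ) (hx : x ∈ U) (hf : ContDiffOn ℝ ∞ f V)
    {K : ℕ} (hK : Fintype.card b < K) : subst φ f x =
      ∑ k ∈ Finset.range K, ((k.factorial : ℝ)⁻¹) • taylorTerm φ k f x := by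
  rw [subst_eq_sum_taylorTerm hφ hx hf]
  refine Finset.sum_subset (Finset.range_subset_range.2 (Nat.succ_le_of_lt hK)) fun k _ hk => ?_
  have hk' : Fintype.card b < k := by rw [Finset.mem_range] at hk; omega
  rw [taylorTerm_eq_zero hk', smul_zero]

theorem taylorTerm_congr (hV : IsOpen V) (hx : bodyMap φ x ∈ V) (k : ℕ)
    (h : ∀ y ∈ V, f y = g y) : taylorTerm φ k f x = taylorTerm φ k g x := by
  induction k generalizing f g with
  | zero => rw [taylorTerm_zero, taylorTerm_zero, h _ hx]
  | succ k ih =>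
    rw [taylorTerm_succ, taylorTerm_succ]
    exact Finset.sum_congr rfl fun s _ => congrArg _ (ih fun y hy => pd_congr_of_isOpen _ hV hy h)

theorem subst_congr (hφ : IsSuperMap U V φ) (hx : x ∈ U) (hf : ContDiffOn ℝ ∞ f V)
    (h : ∀ y ∈ V, f y = g y) : subst φ f x = subst φ g x := by
  rw [subst_eq_sum_taylorTerm hφ hx hf,
    subst_eq_sum_taylorTerm hφ hx (hf.congr fun y hy => (h y hy).symm)]
  exact Finset.sum_congr rfl fun k _ =>
    congrArg _ (taylorTerm_congr hφ.isOpen_target (hφ.mapsTo hx) k h)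

theorem subst_congr_left {φ ψ : a' ⊕ b' → SFun a b} (h : ∀ A, φ A x = ψ A x) (f : SFun a' b') :
    subst φ f x = subst ψ f x := by
  have hb : bodyMap φ x = bodyMap ψ x := funext fun s => by rw [bodyMap, bodyMap, h]
  simp only [subst, hb, h]

theorem taylorTerm_add (hV : IsOpen V) (hx : bodyMap φ x ∈ V) (k : ℕ)
    (hf : ContDiffOn ℝ ∞ f V) (hg : ContDiffOn ℝ ∞ g V) :
    taylorTerm φ k (f + g) x = taylorTerm φ k f x + taylorTerm φ k g x := by
  induction k generalizing f g with
  | zero => exact map_add _ _ _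
  | succ k ih =>
    rw [taylorTerm_succ, taylorTerm_succ, taylorTerm_succ, ← Finset.sum_add_distrib]
    refine Finset.sum_congr rfl fun s _ => ?_
    rw [← mul_add, ← ih (contDiffOn_pd _ hV hf) (contDiffOn_pd _ hV hg)]
    exact congrArg _ (taylorTerm_congr hV hx k fun y hy => pd_add _
      (ContDiffOn.differentiableAt_of_isOpen hV hf hy)
      (ContDiffOn.differentiableAt_of_isOpen hV hg hy))

theorem taylorTerm_smul (hV : IsOpen V) (hx : bodyMap φ x ∈ V) (k : ℕ) (r : ℝ)
    (hf : ContDiffOn ℝ ∞ f V) : taylorTerm φ k (r • f) x = r • taylorTerm φ k f x := by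
  induction k generalizing f with
  | zero => exact map_smul (grHom fun m => φ (Sum.inr m) x) _ _
  | succ k ih =>
    rw [taylorTerm_succ, taylorTerm_succ, Finset.smul_sum]
    refine Finset.sum_congr rfl fun s _ => ?_
    rw [← mul_smul_comm, ← ih (contDiffOn_pd _ hV hf)]
    exact congrArg _ (taylorTerm_congr hV hx k fun y hy => pd_const_smul _ _
      (ContDiffOn.differentiableAt_of_isOpen hV hf hy))

theorem subst_add (hφ : IsSuperMap U V φ) (hx : x ∈ U) (hf : ContDiffOn ℝ ∞ f V)
    (hg : ContDiffOn ℝ ∞ g V) : subst φ (f + g) x = subst φ f x + subst φ g x := by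
  rw [subst_eq_sum_taylorTerm hφ hx hf, subst_eq_sum_taylorTerm hφ hx hg,
    subst_eq_sum_taylorTerm hφ hx (contDiffOn_add hf hg), ← Finset.sum_add_distrib]
  refine Finset.sum_congr rfl fun k _ => ?_
  rw [taylorTerm_add hφ.isOpen_target (hφ.mapsTo hx) k hf hg, smul_add]

theorem subst_smul (hφ : IsSuperMap U V φ) (hx : x ∈ U) (hf : ContDiffOn ℝ ∞ f V) (r : ℝ) :
    subst φ (r • f) x = r • subst φ f x := by
  rw [subst_eq_sum_taylorTerm hφ hx hf, subst_eq_sum_taylorTerm hφ hx (contDiffOn_smul r hf),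
    Finset.smul_sum]
  refine Finset.sum_congr rfl fun k _ => ?_
  rw [taylorTerm_smul hφ.isOpen_target (hφ.mapsTo hx) k r hf, smul_comm]

theorem subst_zero (φ : a' ⊕ b' → SFun a b) (x : a → ℝ) : subst φ 0 x = 0 := by
  refine Finset.sum_eq_zero fun k _ => ?_
  rw [Finset.sum_eq_zero, smul_zero]
  intro j _
  rw [show (0 : SFun a' b') = fun _ => 0 from rfl, iteratedFDeriv_fun_zero]
  simp

theorem subst_sum (hφ : IsSuperMap U V φ) (hx : x ∈ U) {ι : Type*} (S : Finset ι)
    {f : ι → SFun a' b'} (hf : ∀ i ∈ S, ContDiffOn ℝ ∞ (f i) V) :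
    subst φ (∑ i ∈ S, f i) x = ∑ i ∈ S, subst φ (f i) x := by
  classical
  induction S using Finset.induction_on with
  | empty => rw [Finset.sum_empty, Finset.sum_empty, subst_zero]
  | insert i S hi ih =>
    have h1 : ∀ j ∈ S, ContDiffOn ℝ ∞ (f j) V := fun j hj => hf j (Finset.mem_insert_of_mem hj)
    have h2 : ContDiffOn ℝ ∞ (∑ j ∈ S, f j) V :=
      contDiffOn_sum S h1
    rw [Finset.sum_insert hi, Finset.sum_insert hi,
      subst_add hφ hx (hf i (Finset.mem_insert_self i S)) h2, ih h1]

/-- Leibniz' rule for Taylor terms, in binomial form. -/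
theorem taylorTerm_mul (hφ : IsSuperMap U V φ) (hx : x ∈ U) (k : ℕ)
    (hf : ContDiffOn ℝ ∞ f V) (hg : ContDiffOn ℝ ∞ g V) :
    taylorTerm φ k (f * g) x = ∑ ij ∈ Finset.HasAntidiagonal.antidiagonal k,
      k.choose ij.1 • (taylorTerm φ ij.1 f x * taylorTerm φ ij.2 g x) := by
  have hV := hφ.isOpen_target
  have hy := hφ.mapsTo hx
  induction k generalizing f g with
  | zero =>
    simp only [Finset.Nat.antidiagonal_zero, Finset.sum_singleton, Nat.choose_self, one_smul]
    exact map_mul _ _ _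
  | succ k ih =>
    have h1 : ∀ s, taylorTerm φ k (pd (Sum.inl s) (f * g)) x =
        taylorTerm φ k (pd (Sum.inl s) f * g) x + taylorTerm φ k (f * pd (Sum.inl s) g) x :=
      fun s => by
        rw [← taylorTerm_add hV hy k (contDiffOn_mul (contDiffOn_pd _ hV hf) hg)
          (contDiffOn_mul hf (contDiffOn_pd _ hV hg))]
        exact taylorTerm_congr hV hy k fun y hy' => pd_mul _
          (ContDiffOn.differentiableAt_of_isOpen hV hf hy')
          (ContDiffOn.differentiableAt_of_isOpen hV hg hy')
    rw [Finset.sum_antidiagonal_choose_succ_nsmul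
      (fun i j => taylorTerm φ i f x * taylorTerm φ j g x), taylorTerm_succ]
    simp only [h1, mul_add, Finset.sum_add_distrib]
    simp only [ih (contDiffOn_pd _ hV hf) hg, ih hf (contDiffOn_pd _ hV hg)]
    rw [add_comm]
    congr 1
    · simp only [taylorTerm_succ, Finset.mul_sum, Finset.smul_sum]
      rw [Finset.sum_comm]
      refine Finset.sum_congr rfl fun p _ => Finset.sum_congr rfl fun s _ => ?_
      rw [mul_smul_comm, ← mul_assoc, ← mul_assoc, even_mul_comm (hφ.soul_even hx s)]
    · simp only [taylorTerm_succ, Finset.sum_mul, Finset.mul_sum, Finset.smul_sum]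
      rw [Finset.sum_comm]
      refine Finset.sum_congr rfl fun p hp => Finset.sum_congr rfl fun s _ => ?_
      rw [mul_smul_comm, ← mul_assoc,
        Nat.choose_symm_of_eq_add (Finset.HasAntidiagonal.mem_antidiagonal.1 hp).symm]

/-- Pullback is multiplicative: the Cauchy product of two Taylor expansions. Terms of order larger
than the number of odd generators vanish, so both expansions may be lengthened at will. -/
theorem subst_mul (hφ : IsSuperMap U V φ) (hx : x ∈ U)
    (hf : ContDiffOn ℝ ∞ f V) (hg : ContDiffOn ℝ ∞ g V) :
    subst φ (f * g) x = subst φ f x * subst φ g x := by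
  set K := Fintype.card b + 1 with hK
  rw [subst_eq_sum_taylorTerm hφ hx hf, subst_eq_sum_taylorTerm hφ hx hg,
    subst_eq_sum_range hφ hx (contDiffOn_mul hf hg) (K := 2 * K) (by omega), ← hK,
    Finset.sum_mul_sum, ← Finset.sum_product',
    ← Finset.sum_fiberwise_of_maps_to (g := fun p : ℕ × ℕ => p.1 + p.2) (t := Finset.range (2 * K))
      (fun p hp => by simp only [Finset.mem_product, Finset.mem_range] at hp ⊢; omega)]
  refine Finset.sum_congr rfl fun k _ => ?_
  rw [taylorTerm_mul hφ hx k hf hg, Finset.smul_sum]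
  symm
  calc _ = ∑ p ∈ Finset.HasAntidiagonal.antidiagonal k,
        ((p.1.factorial : ℝ)⁻¹ • taylorTerm φ p.1 f x) *
          ((p.2.factorial : ℝ)⁻¹ • taylorTerm φ p.2 g x) := by
        refine Finset.sum_subset (fun p hp => ?_) fun p hp hp' => ?_
        · exact Finset.HasAntidiagonal.mem_antidiagonal.2 (Finset.mem_filter.1 hp).2
        · by_cases h1 : p.1 < K
          · have h2 : ¬ p.2 < K := fun h2 => hp' (by
              simp only [Finset.mem_filter, Finset.mem_product, Finset.mem_range]
              exact ⟨⟨h1, h2⟩, Finset.HasAntidiagonal.mem_antidiagonal.1 hp⟩)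
            rw [taylorTerm_eq_zero (k := p.2) (by omega), smul_zero, mul_zero]
          · rw [taylorTerm_eq_zero (k := p.1) (by omega), smul_zero, zero_mul]
    _ = _ := by
        refine Finset.sum_congr rfl fun p hp => ?_
        rw [smul_mul_smul_comm, ← Nat.cast_smul_eq_nsmul ℝ, smul_smul]
        congr 1
        have h := Finset.HasAntidiagonal.mem_antidiagonal.1 hp
        have h1 := Nat.choose_mul_factorial_mul_factorial (n := k) (k := p.1) (by omega)
        rw [show k - p.1 = p.2 by omega] at h1
        have h2 : (k.choose p.1 : ℝ) * p.1.factorial * p.2.factorial = k.factorial := by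
          exact_mod_cast h1
        have := Nat.factorial_ne_zero p.1
        have := Nat.factorial_ne_zero p.2
        have := Nat.factorial_ne_zero k
        field_simp
        rw [← h2]; ring

end Substitution

/-! ### The chain rule -/

section ChainRule

variable {a b a' b' : Type} [Fintype a] [DecidableEq a] [Fintype b] [DecidableEq b]
  [Fintype a'] [DecidableEq a'] [Fintype b'] [DecidableEq b']
  {U : Set (a → ℝ)} {V : Set (a' → ℝ)} {φ : a' ⊕ b' → SFun a b} {f g : SFun a' b'}
  {x : a → ℝ}

theorem contDiffOn_grHom {t : b' → SFun a b} (ht : ∀ m, ContDiffOn ℝ ∞ (t m) U)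
    (ho : ∀ m, ParityOn U 1 (t m)) (g : Gr b') :
    ContDiffOn ℝ ∞ (fun y => grHom (fun m => t m y) g : SFun a b) U := by
  induction g using gr_induction with
  | hr r => simpa only [AlgHom.commutes] using contDiffOn_const
  | ha g h hg hh => simpa only [map_add] using hg.add hh
  | hg m g hg =>
    refine (contDiffOn_mul (ht m) hg).congr fun y hy => ?_
    rw [map_mul, grHom_gen' fun m => ho m y hy]; rfl

/-- The chain rule for the Grassmann algebra part of a substitution. -/
theorem pd_grHom (hU : IsOpen U) (A : a ⊕ b) {t : b' → SFun a b}
    (ht : ∀ m, ContDiffOn ℝ ∞ (t m) U) (ho : ∀ m, ParityOn U 1 (t m)) (hx : x ∈ U) (g : Gr b') :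
    pd A (fun y => grHom (fun m => t m y) g) x =
      ∑ m, pd A (t m) x * grHom (fun m => t m x) (oddDeriv m g) := by
  rcases A with s | k
  · induction g using gr_induction with
    | hr r =>
      simp only [AlgHom.commutes, oddDeriv_algebraMap, map_zero, mul_zero, Finset.sum_const_zero]
      exact pd_const _ _ _
    | ha g h hg hh =>
      have := pd_add (Sum.inl s)
        (ContDiffOn.differentiableAt_of_isOpen hU (contDiffOn_grHom ht ho g) hx)
        (ContDiffOn.differentiableAt_of_isOpen hU (contDiffOn_grHom ht ho h) hx)
      rw [hg, hh] at this
      simp only [map_add, mul_add, Finset.sum_add_distrib]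
      exact this
    | hg j g hg =>
      have h1 : pd (Sum.inl s) (fun y => grHom (fun m => t m y) (gen j * g)) x =
          pd (Sum.inl s) (t j * fun y => grHom (fun m => t m y) g) x :=
        pd_congr_of_isOpen _ hU hx fun y hy => by
          rw [map_mul, grHom_gen' fun m => ho m y hy]; rfl
      have h4 : ∀ m, grHom (fun m => t m x) (oddDeriv m (gen j * g)) =
          (if m = j then 1 else 0) * grHom (fun m => t m x) g
            - t j x * grHom (fun m => t m x) (oddDeriv m g) := fun m => by
        rw [oddDeriv_mul, oddDeriv_gen, grInv_odd (gen_odd j), map_add, map_mul, map_mul, map_neg,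
          grHom_gen' fun m => ho m x hx, neg_mul, ← sub_eq_add_neg]
        split_ifs <;> simp only [map_one, map_zero]
      have h5 : ∀ m, pd (Sum.inl s) (t m) x ∈ grPart b 1 := fun m => by
        have := pd_mem (Sum.inl s) hU (ht m) (ho m) x hx
        rwa [show (1 : ZMod 2) + par (Sum.inl s : a ⊕ b) = 1 from add_zero _] at this
      rw [h1, pd_mul _ (ContDiffOn.differentiableAt_of_isOpen hU (ht j) hx)
        (ContDiffOn.differentiableAt_of_isOpen hU (contDiffOn_grHom ht ho g) hx), hg]
      simp only [h4, mul_sub, Finset.sum_sub_distrib, ite_mul, one_mul, zero_mul, mul_ite, mul_zero,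
        Finset.sum_ite_eq', Finset.mem_univ, if_true]
      rw [sub_eq_add_neg, ← Finset.sum_neg_distrib, Finset.mul_sum]
      congr 1
      refine Finset.sum_congr rfl fun m _ => ?_
      change t j x * _ = _
      rw [← mul_assoc, ← mul_assoc, odd_mul_odd (ho j x hx) (h5 m), neg_mul]
  · exact oddDeriv_grHom (fun m => ho m x hx) k g

/-- The body of an even component of `φ`, as a superfunction. -/
def bodyFun (φ : a' ⊕ b' → SFun a b) (s : a') : SFun a b :=
  fun x => algebraMap ℝ (Gr b) (bodyMap φ x s)

/-- The soul of an even component of `φ`, as a superfunction. -/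
def soulFun (φ : a' ⊕ b' → SFun a b) (s : a') : SFun a b := fun x => soul (φ (Sum.inl s) x)

theorem bodyFun_add_soulFun (φ : a' ⊕ b' → SFun a b) (s : a') :
    bodyFun φ s + soulFun φ s = φ (Sum.inl s) := funext fun _ => body_add_soul _

theorem IsSuperMap.contDiffOn_bodyMap (hφ : IsSuperMap U V φ) : ContDiffOn ℝ ∞ (bodyMap φ) U :=
  contDiffOn_pi.2 fun s =>
    (LinearMap.toContinuousLinearMap (body (b := b)).toLinearMap).contDiff.comp_contDiffOn
      (hφ.smooth (Sum.inl s))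

theorem IsSuperMap.contDiffOn_bodyFun (hφ : IsSuperMap U V φ) (s : a') :
    ContDiffOn ℝ ∞ (bodyFun φ s) U :=
  (LinearMap.toContinuousLinearMap (Algebra.linearMap ℝ (Gr b))).contDiff.comp_contDiffOn
    (contDiffOn_pi.1 hφ.contDiffOn_bodyMap s)

theorem IsSuperMap.contDiffOn_soulFun (hφ : IsSuperMap U V φ) (s : a') :
    ContDiffOn ℝ ∞ (soulFun φ s) U :=
  ((hφ.smooth (Sum.inl s)).sub (hφ.contDiffOn_bodyFun s))

/-- Composition with the body of `φ`, followed by the homomorphism of Grassmann algebras, in terms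
of a basis of the Grassmann algebra. -/
theorem taylorTerm_zero_eq_sum (φ : a' ⊕ b' → SFun a b) (f : SFun a' b') :
    taylorTerm φ 0 f = ∑ i, (fun y => algebraMap ℝ (Gr b) (grCoords b' (f (bodyMap φ y)) i)) *
      (fun y => grHom (fun m => φ (Sum.inr m) y) ((grCoords b').symm (Pi.single i 1))) := by
  funext y
  rw [taylorTerm_zero, Finset.sum_apply]
  have h : f (bodyMap φ y) = ∑ i, grCoords b' (f (bodyMap φ y)) i •
      (grCoords b').symm (Pi.single i 1) := by
    apply (grCoords b').injective
    rw [map_sum]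
    ext j
    simp [Finset.sum_apply, Pi.single_apply]
  conv_lhs => rw [h, map_sum]
  refine Finset.sum_congr rfl fun i _ => ?_
  rw [map_smul, Algebra.smul_def]
  rfl

theorem contDiffOn_taylorTerm (hφ : IsSuperMap U V φ) (k : ℕ) (hf : ContDiffOn ℝ ∞ f V) :
    ContDiffOn ℝ ∞ (taylorTerm φ k f) U := by
  induction k generalizing f with
  | zero =>
    rw [taylorTerm_zero_eq_sum]
    refine contDiffOn_sum _ fun i _ => contDiffOn_mul ?_
      (contDiffOn_grHom (fun m => hφ.smooth (Sum.inr m)) (fun m => hφ.parity (Sum.inr m)) _)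
    have h1 : ContDiffOn ℝ ∞ (fun y => f (bodyMap φ y)) U :=
      hf.comp hφ.contDiffOn_bodyMap hφ.mapsTo
    exact (LinearMap.toContinuousLinearMap ((Algebra.linearMap ℝ (Gr b)).comp
      ((LinearMap.proj i).comp (grCoords b').toLinearMap))).contDiff.comp_contDiffOn h1
  | succ k ih =>
    rw [show taylorTerm φ (k + 1) f = ∑ s, soulFun φ s * taylorTerm φ k (pd (Sum.inl s) f) from
      funext fun y => by rw [Finset.sum_apply]; rfl]
    exact contDiffOn_sum _ fun s _ => contDiffOn_mul (hφ.contDiffOn_soulFun s)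
      (ih (contDiffOn_pd _ hφ.isOpen_target hf))

theorem contDiffOn_subst (hφ : IsSuperMap U V φ) (hf : ContDiffOn ℝ ∞ f V) :
    ContDiffOn ℝ ∞ (subst φ f) U := by
  refine (contDiffOn_sum (Finset.range (Fintype.card b + 1)) fun k _ =>
    contDiffOn_smul ((k.factorial : ℝ)⁻¹) (contDiffOn_taylorTerm hφ k hf)).congr fun x hx => ?_
  rw [subst_eq_sum_taylorTerm hφ hx hf, Finset.sum_apply]
  rfl

theorem pd_bodyFun (hφ : IsSuperMap U V φ) (hx : x ∈ U) (s : a) (r : a') :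
    pd (Sum.inl s) (bodyFun φ r) x =
      algebraMap ℝ (Gr b) (fderiv ℝ (bodyMap φ) x (Pi.single s 1) r) := by
  have hd : DifferentiableAt ℝ (bodyMap φ) x :=
    (hφ.contDiffOn_bodyMap.contDiffAt (hφ.isOpen_source.mem_nhds hx)).differentiableAt (by simp)
  have h := ((LinearMap.toContinuousLinearMap (Algebra.linearMap ℝ (Gr b))).comp
      (ContinuousLinearMap.proj (R := ℝ) (φ := fun _ : a' => ℝ) r)).hasFDerivAt.comp x
    hd.hasFDerivAt
  exact DFunLike.congr_fun h.fderiv _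

/-- The chain rule for the Taylor term of order zero, in which only the body map and the images of
the odd coordinates are differentiated. -/
theorem pd_taylorTerm_zero (hφ : IsSuperMap U V φ) (hx : x ∈ U) (A : a ⊕ b)
    (hf : ContDiffOn ℝ ∞ f V) :
    pd A (taylorTerm φ 0 f) x =
      ∑ s, pd A (bodyFun φ s) x * taylorTerm φ 0 (pd (Sum.inl s) f) x +
      ∑ m, pd A (φ (Sum.inr m)) x * taylorTerm φ 0 (pd (Sum.inr m) f) x := by
  have hU := hφ.isOpen_source
  rcases A with r | k
  · set t : b' → SFun a b := fun m => φ (Sum.inr m) with ht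
    have ho : ∀ m, ParityOn U 1 (t m) := fun m => hφ.parity (Sum.inr m)
    have hts : ∀ m, ContDiffOn ℝ ∞ (t m) U := fun m => hφ.smooth (Sum.inr m)
    set e : Fin (Module.finrank ℝ (Gr b')) → Gr b' := fun i => (grCoords b').symm (Pi.single i 1)
    have hexp : ∀ g : Gr b', g = ∑ i, grCoords b' g i • e i := fun g => by
      apply (grCoords b').injective
      rw [map_sum]
      ext j
      simp [e, Finset.sum_apply, Pi.single_apply]
    have hb : DifferentiableAt ℝ (bodyMap φ) x :=
      (hφ.contDiffOn_bodyMap.contDiffAt (hU.mem_nhds hx)).differentiableAt (by simp)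
    have hf' := ContDiffOn.differentiableAt_of_isOpen hφ.isOpen_target hf (hφ.mapsTo hx)
    have hL : ∀ i, HasFDerivAt
        (fun y => algebraMap ℝ (Gr b) (grCoords b' (f (bodyMap φ y)) i))
        ((LinearMap.toContinuousLinearMap ((Algebra.linearMap ℝ (Gr b)).comp
          ((LinearMap.proj i).comp (grCoords b').toLinearMap))).comp
            ((fderiv ℝ f (bodyMap φ x)).comp (fderiv ℝ (bodyMap φ) x))) x := fun i =>
      (LinearMap.toContinuousLinearMap ((Algebra.linearMap ℝ (Gr b)).comp
        ((LinearMap.proj i).comp (grCoords b').toLinearMap))).hasFDerivAt.comp x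
        (hf'.hasFDerivAt.comp x hb.hasFDerivAt)
    have hG : ∀ i, DifferentiableAt ℝ (fun y => grHom (fun m => t m y) (e i) : SFun a b) x :=
      fun i => ContDiffOn.differentiableAt_of_isOpen hU (contDiffOn_grHom hts ho _) hx
    rw [taylorTerm_zero_eq_sum, pd_sum _ _ fun i _ =>
      differentiableAt_mul (hL i).differentiableAt (hG i)]
    have h1 : ∀ i, pd (Sum.inl r)
        ((fun y => algebraMap ℝ (Gr b) (grCoords b' (f (bodyMap φ y)) i)) *
          (fun y => grHom (fun m => t m y) (e i))) x =
        grHom (fun m => t m x) (grCoords b' (fderiv ℝ f (bodyMap φ x)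
          (fderiv ℝ (bodyMap φ) x (Pi.single r 1))) i • e i) +
        ∑ m, pd (Sum.inl r) (t m) x *
          grHom (fun m => t m x) (oddDeriv m (grCoords b' (f (bodyMap φ x)) i • e i)) := fun i => by
      rw [pd_mul _ (hL i).differentiableAt (hG i), pd_grHom hU _ hts ho hx, pd_inl, (hL i).fderiv,
        map_smul, Algebra.smul_def, Finset.mul_sum]
      congr 1
      refine Finset.sum_congr rfl fun m _ => ?_
      rw [map_smul, map_smul, mul_smul_comm, Algebra.smul_def]
      rfl
    have h1' := Finset.sum_congr (rfl : (Finset.univ : Finset (Fin (Module.finrank ℝ (Gr b')))) = _)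
      fun i _ => h1 i
    refine h1'.trans ?_
    rw [Finset.sum_add_distrib, ← map_sum, ← hexp, Finset.sum_comm]
    congr 1
    · have h2 : fderiv ℝ (bodyMap φ) x (Pi.single r 1) =
          ∑ s, (fderiv ℝ (bodyMap φ) x (Pi.single r 1) s) • (Pi.single s (1 : ℝ) : a' → ℝ) := by
        ext k; simp [Finset.sum_apply, Pi.single_apply]
      rw [h2, map_sum, map_sum]
      refine Finset.sum_congr rfl fun s _ => ?_
      rw [pd_bodyFun hφ hx, map_smul, map_smul, Algebra.smul_def]
      rfl
    · refine Finset.sum_congr rfl fun m _ => ?_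
      rw [← Finset.mul_sum, ← map_sum, ← map_sum, ← hexp]
      rfl
  · have h0 : ∀ s, pd (Sum.inr k) (bodyFun φ s) x = 0 := fun s => oddDeriv_algebraMap _ _
    simp only [h0, zero_mul, Finset.sum_const_zero, zero_add]
    exact oddDeriv_grHom (fun m => hφ.odd hx m) k _

/-- The derivative of a Taylor term: it hits either one of the `k` soul factors, which lowers the
order, or the derivative of `f` along the body map and the odd coordinates. Summed over `k`, the two
kinds of terms combine to the chain rule `pd_subst`. -/
theorem pd_taylorTerm (hφ : IsSuperMap U V φ) (hx : x ∈ U) (A : a ⊕ b) (k : ℕ)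
    (hf : ContDiffOn ℝ ∞ f V) :
    pd A (taylorTerm φ k f) x =
      (k : ℝ) • ∑ s, pd A (soulFun φ s) x * taylorTerm φ (k - 1) (pd (Sum.inl s) f) x +
      (∑ s, pd A (bodyFun φ s) x * taylorTerm φ k (pd (Sum.inl s) f) x +
      ∑ m, pd A (φ (Sum.inr m)) x * taylorTerm φ k (pd (Sum.inr m) f) x) := by
  induction k generalizing f with
  | zero => rw [Nat.cast_zero, zero_smul, zero_add, pd_taylorTerm_zero hφ hx A hf]
  | succ k ih =>
    have hU := hφ.isOpen_source
    have hV := hφ.isOpen_target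
    have hy := hφ.mapsTo hx
    have hd := fun B => contDiffOn_pd B hV hf
    have hcomm : ∀ n s B, taylorTerm φ n (pd B (pd (Sum.inl s) f)) x =
        taylorTerm φ n (pd (Sum.inl s) (pd B f)) x := fun n s B =>
      taylorTerm_congr hV hy n fun y hy => (pd_inl_comm s B hV hf hy).symm
    -- An even soul may be moved past a derivative of a component of `φ`.
    have hswap : ∀ (s : a') (n : ℕ) (B : a' ⊕ b') (z : Gr b),
        soulFun φ s x * (z * taylorTerm φ n (pd B (pd (Sum.inl s) f)) x) =
          z * (soul (φ (Sum.inl s) x) * taylorTerm φ n (pd (Sum.inl s) (pd B f)) x) :=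
      fun s n B z => by
        rw [hcomm, ← mul_assoc, ← mul_assoc, ← even_mul_comm (hφ.soul_even hx s)]; rfl
    rw [show taylorTerm φ (k + 1) f = ∑ s, soulFun φ s * taylorTerm φ k (pd (Sum.inl s) f) from
      funext fun y => by rw [Finset.sum_apply]; rfl]
    rw [pd_sum _ _ fun s _ => differentiableAt_mul
      (ContDiffOn.differentiableAt_of_isOpen hU (hφ.contDiffOn_soulFun s) hx)
      (ContDiffOn.differentiableAt_of_isOpen hU (contDiffOn_taylorTerm hφ k (hd _)) hx)]
    have h1 : ∀ s, pd A (soulFun φ s * taylorTerm φ k (pd (Sum.inl s) f)) x =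
        pd A (soulFun φ s) x * taylorTerm φ k (pd (Sum.inl s) f) x +
          ((k : ℝ) • ∑ r, pd A (soulFun φ r) x * (soul (φ (Sum.inl s) x) *
            taylorTerm φ (k - 1) (pd (Sum.inl s) (pd (Sum.inl r) f)) x) +
          (∑ r, pd A (bodyFun φ r) x * (soul (φ (Sum.inl s) x) *
            taylorTerm φ k (pd (Sum.inl s) (pd (Sum.inl r) f)) x) +
          ∑ m, pd A (φ (Sum.inr m)) x * (soul (φ (Sum.inl s) x) *
            taylorTerm φ k (pd (Sum.inl s) (pd (Sum.inr m) f)) x))) := fun s => by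
      rw [pd_mul _ (ContDiffOn.differentiableAt_of_isOpen hU (hφ.contDiffOn_soulFun s) hx)
        (ContDiffOn.differentiableAt_of_isOpen hU (contDiffOn_taylorTerm hφ k (hd _)) hx),
        sgn_even A (x := soulFun φ s x) (hφ.soul_even hx s), ih (hd _)]
      simp only [mul_add, mul_smul_comm, Finset.mul_sum, hswap]
    simp only [h1, Finset.sum_add_distrib]
    rw [← add_assoc]
    congr 1
    · rw [Nat.cast_succ, add_smul, one_smul, add_comm, Nat.add_sub_cancel]
      congr 1
      rw [← Finset.smul_sum, Finset.sum_comm]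
      rcases k with _ | k
      · simp
      · congr 1
        refine Finset.sum_congr rfl fun r _ => ?_
        rw [← Finset.mul_sum]; rfl
    · congr 1
      · rw [Finset.sum_comm]
        refine Finset.sum_congr rfl fun r _ => ?_
        rw [← Finset.mul_sum]; rfl
      · rw [Finset.sum_comm]
        refine Finset.sum_congr rfl fun r _ => ?_
        rw [← Finset.mul_sum]; rfl

/-- The chain rule `∂_A (φ^* f) = ∑ ∂_A φ^B φ^*(∂_B f)`. -/
theorem pd_subst (hφ : IsSuperMap U V φ) (hx : x ∈ U) (A : a ⊕ b) (hf : ContDiffOn ℝ ∞ f V) :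
    pd A (subst φ f) x = ∑ B, pd A (φ B) x * subst φ (pd B f) x := by
  have hU := hφ.isOpen_source
  have hV := hφ.isOpen_target
  set n := Fintype.card b + 1 with hn
  have h1 : pd A (subst φ f) x =
      pd A (∑ k ∈ Finset.range (n + 1), ((k.factorial : ℝ)⁻¹) • taylorTerm φ k f) x :=
    pd_congr_of_isOpen A hU hx fun y hy => by
      rw [subst_eq_sum_range hφ hy hf (K := n + 1) (by omega), Finset.sum_apply]; rfl
  have hT := fun k => ContDiffOn.differentiableAt_of_isOpen hU (contDiffOn_taylorTerm hφ k hf) hx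
  have hs : ∀ B, ∑ k ∈ Finset.range (n + 1), ((k.factorial : ℝ)⁻¹) • taylorTerm φ k (pd B f) x =
      subst φ (pd B f) x := fun B =>
    (subst_eq_sum_range hφ hx (contDiffOn_pd B hV hf) (by omega)).symm
  have hs' : ∀ B, ∑ k ∈ Finset.range n, ((k.factorial : ℝ)⁻¹) • taylorTerm φ k (pd B f) x =
      subst φ (pd B f) x := fun B =>
    (subst_eq_sum_range hφ hx (contDiffOn_pd B hV hf) (by omega)).symm
  rw [h1, pd_sum _ _ fun k _ => (hT k).const_smul _]
  have h2 : ∀ k, pd A (((k.factorial : ℝ)⁻¹) • taylorTerm φ k f) x =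
      ∑ s, pd A (soulFun φ s) x * (((k.factorial : ℝ)⁻¹ * k) •
        taylorTerm φ (k - 1) (pd (Sum.inl s) f) x) +
      (∑ s, pd A (bodyFun φ s) x * (((k.factorial : ℝ)⁻¹) • taylorTerm φ k (pd (Sum.inl s) f) x) +
      ∑ m, pd A (φ (Sum.inr m)) x *
        (((k.factorial : ℝ)⁻¹) • taylorTerm φ k (pd (Sum.inr m) f) x)) := fun k => by
    rw [pd_const_smul _ _ (hT k), pd_taylorTerm hφ hx A k hf]
    simp only [smul_add, smul_smul, Finset.smul_sum, mul_smul_comm]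
  simp only [h2, Finset.sum_add_distrib]
  rw [Fintype.sum_sum_type, Finset.sum_comm, ← add_assoc]
  congr 1
  · rw [Finset.sum_comm (s := Finset.range (n + 1)) (f := fun k s => pd A (bodyFun φ s) x * _),
      ← Finset.sum_add_distrib]
    refine Finset.sum_congr rfl fun s _ => ?_
    rw [← Finset.mul_sum, ← Finset.mul_sum, hs, ← bodyFun_add_soulFun φ s,
      pd_add _ (ContDiffOn.differentiableAt_of_isOpen hU (hφ.contDiffOn_bodyFun s) hx)
        (ContDiffOn.differentiableAt_of_isOpen hU (hφ.contDiffOn_soulFun s) hx), add_mul, add_comm]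
    congr 2
    rw [Finset.sum_range_succ', Nat.cast_zero, mul_zero, zero_smul, add_zero, ← hs']
    refine Finset.sum_congr rfl fun k _ => ?_
    rw [Nat.add_sub_cancel]
    congr 1
    rw [Nat.factorial_succ, Nat.cast_mul]
    have := Nat.factorial_ne_zero k
    field_simp
  · rw [Finset.sum_comm]
    refine Finset.sum_congr rfl fun m _ => ?_
    rw [← Finset.mul_sum, hs]

end ChainRule

/-! ### Functoriality of substitution -/

section Functoriality

variable {a b a' b' a'' b'' : Type} [Fintype a] [DecidableEq a] [Fintype b] [DecidableEq b]
  [Fintype a'] [DecidableEq a'] [Fintype b'] [DecidableEq b']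
  [Fintype a''] [DecidableEq a''] [Fintype b''] [DecidableEq b'']
  {U : Set (a → ℝ)} {V : Set (a' → ℝ)} {W : Set (a'' → ℝ)} {φ : a' ⊕ b' → SFun a b}
  {ψ : a'' ⊕ b'' → SFun a' b'} {f g : SFun a' b'} {x : a → ℝ}

theorem taylorTerm_const (φ : a' ⊕ b' → SFun a b) (k : ℕ) (r : ℝ) (x : a → ℝ) :
    taylorTerm φ k (fun _ => algebraMap ℝ (Gr b') r) x =
      if k = 0 then algebraMap ℝ (Gr b) r else 0 := by
  have h0 : ∀ k, taylorTerm φ k (0 : SFun a' b') x = 0 := fun k => by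
    induction k with
    | zero => exact map_zero _
    | succ k ih =>
      rw [taylorTerm_succ]
      refine Finset.sum_eq_zero fun s _ => ?_
      rw [show pd (Sum.inl s) (0 : SFun a' b') = 0 from funext fun y => by
        rw [pd_inl, show (0 : SFun a' b') = fun _ => 0 from rfl, fderiv_fun_const]
        rfl, ih, mul_zero]
  rcases k with _ | k
  · exact AlgHom.commutes _ _
  · rw [taylorTerm_succ, if_neg (Nat.succ_ne_zero k)]
    refine Finset.sum_eq_zero fun s _ => ?_
    rw [show pd (Sum.inl s) (fun _ : a' → ℝ => algebraMap ℝ (Gr b') r) = 0 from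
      funext fun y => pd_const _ _ _, h0, mul_zero]

theorem subst_const (hφ : IsSuperMap U V φ) (hx : x ∈ U) (r : ℝ) :
    subst φ (fun _ => algebraMap ℝ (Gr b') r) x = algebraMap ℝ (Gr b) r := by
  rw [subst_eq_sum_taylorTerm hφ hx contDiffOn_const, Finset.sum_eq_single_of_mem 0 (by simp)]
  · rw [taylorTerm_const]; simp
  · intro k _ hk
    rw [taylorTerm_const, if_neg hk, smul_zero]

theorem subst_coord (hφ : IsSuperMap U V φ) (hx : x ∈ U) (A : a' ⊕ b') :
    subst φ (coord A) x = φ A x := by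
  rw [subst_eq_sum_range hφ hx (contDiff_coord A).contDiffOn
    (K := Fintype.card b + 1 + 1) (by omega), Finset.sum_range_succ', Finset.sum_range_succ']
  have h : ∀ (k : ℕ) s, taylorTerm φ k (pd (Sum.inl s) (coord A)) x =
      if k = 0 then (if Sum.inl s = A then 1 else 0) else 0 := fun k s => by
    have := taylorTerm_const φ k (if Sum.inl s = A then 1 else 0) x
    rw [show (algebraMap ℝ (Gr b)) (if Sum.inl s = A then 1 else 0) = if Sum.inl s = A then 1 else 0
      from by split_ifs <;> simp] at this
    rw [← this]
    congr 1
    funext y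
    rw [pd_coord]
    split_ifs <;> simp
  have h2 : ∑ k ∈ Finset.range (Fintype.card b),
      (((k + 1 + 1).factorial : ℝ)⁻¹) • taylorTerm φ (k + 1 + 1) (coord A) x = 0 :=
    Finset.sum_eq_zero fun k _ => by
      rw [taylorTerm_succ, Finset.sum_eq_zero, smul_zero]
      intro s _
      rw [h, if_neg (Nat.succ_ne_zero k), mul_zero]
  rw [h2, zero_add, taylorTerm_succ]
  simp only [h, if_true, zero_add, Nat.factorial_one, Nat.factorial_zero, Nat.cast_one, inv_one,
    one_smul]
  rw [taylorTerm_zero]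
  rcases A with s | m
  · rw [show (coord (Sum.inl s) : SFun a' b') (bodyMap φ x) =
      algebraMap ℝ (Gr b') (bodyMap φ x s) from rfl, AlgHom.commutes,
      Finset.sum_eq_single_of_mem s (Finset.mem_univ _)]
    · rw [if_pos rfl, mul_one, add_comm]
      exact body_add_soul _
    · intro r _ hr
      rw [if_neg (by simpa using hr), mul_zero]
  · rw [Finset.sum_eq_zero, zero_add]
    · exact grHom_gen (fun m => hφ.odd hx m) m
    · intro r _
      rw [if_neg (by simp), mul_zero]

theorem taylorTerm_mem (hφ : IsSuperMap U V φ) {ε : ZMod 2} (k : ℕ) (hf : ContDiffOn ℝ ∞ f V)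
    (hε : ParityOn V ε f) : ParityOn U ε (taylorTerm φ k f) := by
  intro x hx
  induction k generalizing f with
  | zero => exact grHom_mem (fun m => hφ.odd hx m) (hε _ (hφ.mapsTo hx))
  | succ k ih =>
    rw [taylorTerm_succ]
    refine Submodule.sum_mem _ fun s _ => ?_
    have h := pd_mem (Sum.inl s) hφ.isOpen_target hf hε
    rw [show ε + par (Sum.inl s : a' ⊕ b') = ε from add_zero ε] at h
    have := mul_mem_grPart (hφ.soul_even hx s) (ih (contDiffOn_pd _ hφ.isOpen_target hf) h)
    rwa [zero_add] at this

theorem parityOn_subst (hφ : IsSuperMap U V φ) {ε : ZMod 2} (hf : ContDiffOn ℝ ∞ f V)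
    (hε : ParityOn V ε f) : ParityOn U ε (subst φ f) := by
  intro x hx
  rw [subst_eq_sum_taylorTerm hφ hx hf]
  exact Submodule.sum_mem _ fun k _ => Submodule.smul_mem _ _ (taylorTerm_mem hφ k hf hε x hx)

theorem body_subst (hφ : IsSuperMap U V φ) (hx : x ∈ U) (hf : ContDiffOn ℝ ∞ f V) :
    body (subst φ f x) = body (f (bodyMap φ x)) := by
  rw [subst_eq_sum_taylorTerm hφ hx hf, Finset.sum_range_succ', map_add,
    taylorTerm_zero, map_sum, Finset.sum_eq_zero]
  · rw [zero_add]
    simp only [Nat.factorial_zero, Nat.cast_one, inv_one, one_smul]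
    exact body_grHom (fun m => hφ.odd hx m) _
  · intro k _
    rw [map_smul, taylorTerm_succ, map_sum, Finset.sum_eq_zero, smul_zero]
    intro s _
    rw [map_mul, body_soul, zero_mul]

/-- Substitution of superfunctions whose even members have no soul involves no derivatives. -/
theorem subst_of_soul_eq_zero (hφ : ∀ s, soul (φ (Sum.inl s) x) = 0) (f : SFun a' b') :
    subst φ f x = grHom (fun m => φ (Sum.inr m) x) (f (bodyMap φ x)) := by
  rw [subst, Finset.sum_eq_single_of_mem 0 (by simp)]
  · simp
  · intro k _ hk
    obtain ⟨k, rfl⟩ := Nat.exists_eq_succ_of_ne_zero hk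
    rw [Finset.sum_eq_zero, smul_zero]
    intro j _
    rw [List.ofFn_succ, List.prod_cons, hφ, zero_mul, zero_mul]

theorem subst_coord_self (f : SFun a b) : subst coord f = f := by
  funext x
  have hs : ∀ s, soul ((coord (Sum.inl s) : SFun a b) x) = 0 := fun s => by
    rw [soul, show (coord (Sum.inl s) : SFun a b) x = algebraMap ℝ (Gr b) (x s) from rfl,
      body_algebraMap, sub_self]
  rw [subst_of_soul_eq_zero hs]
  have : bodyMap (coord : a ⊕ b → SFun a b) x = x := funext fun s => body_algebraMap _
  rw [this]
  exact grHom_gen_self _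

/-- Composition of substitutions, the outer one being without souls. -/
theorem subst_subst_of_soul_eq_zero (hφ : IsSuperMap U V φ)
    (hφ0 : ∀ y ∈ U, ∀ s, soul (φ (Sum.inl s) y) = 0) (hψ : IsSuperMap V W ψ) (hx : x ∈ U)
    {f : SFun a'' b''} (hf : ContDiffOn ℝ ∞ f W) :
    subst φ (subst ψ f) x = subst (fun B => subst φ (ψ B)) f x := by
  have hy := hφ.mapsTo hx
  have hbody : ∀ y ∈ U, bodyMap (fun B => subst φ (ψ B)) y = bodyMap ψ (bodyMap φ y) :=
    fun y hy => funext fun s => body_subst hφ hy (hψ.smooth _)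
  have hχ : IsSuperMap U W (fun B => subst φ (ψ B)) :=
    ⟨hφ.isOpen_source, hψ.isOpen_target, fun A => contDiffOn_subst hφ (hψ.smooth A),
      fun A => parityOn_subst hφ (hψ.smooth A) (hψ.parity A), fun y hy => by
        rw [hbody y hy]; exact hψ.mapsTo (hφ.mapsTo hy)⟩
  have key : ∀ (k : ℕ) (f : SFun a'' b''), ContDiffOn ℝ ∞ f W →
      grHom (fun m => φ (Sum.inr m) x) (taylorTerm ψ k f (bodyMap φ x)) =
        taylorTerm (fun B => subst φ (ψ B)) k f x := by
    intro k
    induction k with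
    | zero =>
      intro f _
      rw [taylorTerm_zero, taylorTerm_zero, grHom_grHom (fun m => hφ.odd hx m) fun m => hψ.odd hy m,
        hbody x hx]
      congr 2
      funext m
      rw [subst_of_soul_eq_zero (hφ0 x hx)]
    | succ k ih =>
      intro f hf
      rw [taylorTerm_succ, taylorTerm_succ, map_sum]
      refine Finset.sum_congr rfl fun s _ => ?_
      rw [map_mul, ih _ (contDiffOn_pd _ hψ.isOpen_target hf)]
      congr 1
      rw [soul, soul, map_sub, AlgHom.commutes, subst_of_soul_eq_zero (hφ0 x hx),
        body_grHom fun m => hφ.odd hx m]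
  rw [subst_of_soul_eq_zero (hφ0 x hx),
    subst_eq_sum_range hψ hy hf (K := Fintype.card b + Fintype.card b' + 1) (by omega),
    subst_eq_sum_range hχ hx hf (K := Fintype.card b + Fintype.card b' + 1) (by omega), map_sum]
  refine Finset.sum_congr rfl fun k _ => ?_
  rw [map_smul, key k f hf]

/-- The substitution of coordinates, up to constant factors, for coordinates. -/
def relabel (ε : a' ⊕ b' → ℝ) (σ : a' → a) (τ : b' → b) : a' ⊕ b' → SFun a b :=
  fun B => ε B • coord (Sum.map σ τ B)

theorem soul_smul_coord (r : ℝ) (s : a) (x : a → ℝ) :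
    soul ((r • (coord (Sum.inl s) : SFun a b)) x) = 0 := by
  rw [soul, show (r • (coord (Sum.inl s) : SFun a b)) x = algebraMap ℝ (Gr b) (r * x s) from by
    rw [map_mul, ← Algebra.smul_def]; rfl, body_algebraMap, sub_self]

theorem soul_relabel (ε : a' ⊕ b' → ℝ) (σ : a' → a) (τ : b' → b) (x : a → ℝ) (s : a') :
    soul (relabel ε σ τ (Sum.inl s) x) = 0 := soul_smul_coord _ _ _

theorem par_map (σ : a' → a) (τ : b' → b) (B : a' ⊕ b') : par (Sum.map σ τ B) = par B := by
  rcases B with s | m <;> rfl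

theorem bodyMap_relabel (ε : a' ⊕ b' → ℝ) (σ : a' → a) (τ : b' → b) (x : a → ℝ) (s : a') :
    bodyMap (relabel ε σ τ : a' ⊕ b' → SFun a b) x s = ε (Sum.inl s) * x (σ s) := by
  rw [bodyMap, show relabel ε σ τ (Sum.inl s) x = algebraMap ℝ (Gr b) (ε (Sum.inl s) * x (σ s)) from
    by rw [map_mul, ← Algebra.smul_def]; rfl, body_algebraMap]

theorem isSuperMap_relabel (ε : a' ⊕ b' → ℝ) (σ : a' → a) (τ : b' → b) (hU : IsOpen U)
    (hV : IsOpen V) (h : ∀ x ∈ U, (fun s => ε (Sum.inl s) * x (σ s)) ∈ V) :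
    IsSuperMap U V (relabel ε σ τ : a' ⊕ b' → SFun a b) :=
  ⟨hU, hV, fun A => contDiffOn_smul _ (contDiff_coord _).contDiffOn,
    fun A x _ => by
      have := coord_mem (Sum.map σ τ A) x
      rw [par_map] at this
      exact Submodule.smul_mem _ _ this,
    fun x hx => by
      rw [show bodyMap _ x = _ from funext (bodyMap_relabel ε σ τ x)]
      exact h x hx⟩

/-- Composition of substitutions, the inner one being a relabelling. -/
theorem subst_subst_relabel (hφ : IsSuperMap U V φ) {ε : a'' ⊕ b'' → ℝ} {σ : a'' → a'}
    {τ : b'' → b'} (hψ : IsSuperMap V W (relabel ε σ τ : a'' ⊕ b'' → SFun a' b')) (hx : x ∈ U)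
    {f : SFun a'' b''} (hf : ContDiffOn ℝ ∞ f W) :
    subst φ (subst (relabel ε σ τ) f) x =
      subst (fun B => ε B • φ (Sum.map σ τ B)) f x := by
  have hV := hφ.isOpen_target
  have hy := hφ.mapsTo hx
  have hbody : ∀ y ∈ U, bodyMap (fun B => ε B • φ (Sum.map σ τ B)) y =
      bodyMap (relabel ε σ τ : a'' ⊕ b'' → SFun a' b') (bodyMap φ y) := fun y hy =>
    funext fun s => by
      rw [bodyMap_relabel]
      exact map_smul (body (b := b)) _ _
  have hχ : IsSuperMap U W (fun B => ε B • φ (Sum.map σ τ B)) :=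
    ⟨hφ.isOpen_source, hψ.isOpen_target, fun A => contDiffOn_smul _ (hφ.smooth _),
      fun A y hy => by
        have := hφ.parity (Sum.map σ τ A) y hy
        rw [par_map] at this
        exact Submodule.smul_mem _ _ this, fun y hy => by
        rw [hbody y hy]; exact hψ.mapsTo (hφ.mapsTo hy)⟩
  have key : ∀ (k : ℕ) (f : SFun a'' b''), ContDiffOn ℝ ∞ f W →
      taylorTerm φ k (subst (relabel ε σ τ) f) x =
        taylorTerm (fun B => ε B • φ (Sum.map σ τ B)) k f x := by
    intro k
    induction k with
    | zero =>
      intro f _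
      rw [taylorTerm_zero, taylorTerm_zero, subst_of_soul_eq_zero (soul_relabel ε σ τ _),
        grHom_grHom (fun m => hφ.odd hx m) fun m => hψ.odd hy m, hbody x hx]
      congr 2
      funext m
      refine (map_smul (grHom fun m => φ (Sum.inr m) x) _ _).trans ?_
      exact congrArg _ (grHom_gen (fun m => hφ.odd hx m) _)
    | succ k ih =>
      intro f hf
      have hd := fun r => contDiffOn_pd (Sum.inl r) hψ.isOpen_target hf
      have h1 : ∀ s, taylorTerm φ k (pd (Sum.inl s) (subst (relabel ε σ τ) f)) x =
          ∑ r, if s = σ r then ε (Sum.inl r) •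
            taylorTerm (fun B => ε B • φ (Sum.map σ τ B)) k (pd (Sum.inl r) f) x else 0 := by
        intro s
        have h2 : ∀ y ∈ V, pd (Sum.inl s) (subst (relabel ε σ τ) f) y =
            (∑ r, (if s = σ r then ε (Sum.inl r) else 0) •
              subst (relabel ε σ τ) (pd (Sum.inl r) f)) y := fun y hy => by
          have h3 : ∀ B, pd (Sum.inl s) (relabel ε σ τ B : SFun a' b') y =
              ε B • if Sum.inl s = Sum.map σ τ B then 1 else 0 := fun B => by
            rw [relabel, pd_const_smul _ _ (differentiableAt_coord _ _), pd_coord]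
          rw [pd_subst hψ hy _ hf, Fintype.sum_sum_type, Finset.sum_apply]
          simp only [h3]
          rw [Finset.sum_eq_zero (s := (Finset.univ : Finset b'')), add_zero]
          · refine Finset.sum_congr rfl fun r _ => ?_
            by_cases h : s = σ r
            · simp [h]
            · simp [h]
          · intro m _
            simp
        rw [taylorTerm_congr hV hy k h2]
        have h4 : ∀ S : Finset a'',
            taylorTerm φ k (∑ r ∈ S, (if s = σ r then ε (Sum.inl r) else 0) •
            subst (relabel ε σ τ) (pd (Sum.inl r) f)) x =
            ∑ r ∈ S, if s = σ r then ε (Sum.inl r) •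
              taylorTerm (fun B => ε B • φ (Sum.map σ τ B)) k (pd (Sum.inl r) f) x else 0 := by
          intro S
          induction S using Finset.induction_on with
          | empty =>
            have := taylorTerm_smul hV hy k 0 (f := (0 : SFun a' b')) contDiffOn_const
            rw [zero_smul, zero_smul] at this
            exact this
          | insert r S hr ihS =>
            rw [Finset.sum_insert hr, Finset.sum_insert hr, taylorTerm_add hV hy k
              (contDiffOn_smul _ (contDiffOn_subst hψ (hd r)))
              (contDiffOn_sum _ fun r _ => contDiffOn_smul _ (contDiffOn_subst hψ (hd r))), ihS,
              taylorTerm_smul hV hy k _ (contDiffOn_subst hψ (hd r)), ih _ (hd r)]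
            split_ifs <;> simp
        exact h4 Finset.univ
      rw [taylorTerm_succ, taylorTerm_succ]
      simp only [h1, Finset.mul_sum]
      rw [Finset.sum_comm]
      refine Finset.sum_congr rfl fun r _ => ?_
      rw [Finset.sum_eq_single_of_mem (σ r) (Finset.mem_univ _) fun s _ hs => by
        rw [if_neg hs, mul_zero], if_pos rfl, mul_smul_comm, ← smul_mul_assoc]
      congr 1
      rw [soul, soul, smul_sub]
      congr 1
      change _ = algebraMap ℝ (Gr b) (body (ε (Sum.inl r) • φ (Sum.inl (σ r)) x))
      rw [map_smul, Algebra.smul_def, smul_eq_mul, map_mul]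
  rw [subst_eq_sum_taylorTerm hφ hx (contDiffOn_subst hψ hf), subst_eq_sum_taylorTerm hχ hx hf]
  exact Finset.sum_congr rfl fun k _ => by rw [key k f hf]

end Functoriality

/-! ### Pullback along coordinate projections -/

section CoordMap

variable {a b a' b' : Type} [Fintype a] [DecidableEq a] [Fintype b] [DecidableEq b]
  [Fintype a'] [DecidableEq a'] [Fintype b'] [DecidableEq b']

theorem relabel_one (σ : a' → a) (τ : b' → b) :
    (relabel (fun _ => 1) σ τ : a' ⊕ b' → SFun a b) = fun B => coord (Sum.map σ τ B) :=
  funext fun _ => one_smul _ _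

theorem isSuperMap_coord_map {U : Set (a → ℝ)} {V : Set (a' → ℝ)} (σ : a' → a) (τ : b' → b)
    (hU : IsOpen U) (hV : IsOpen V) (h : ∀ x ∈ U, x ∘ σ ∈ V) :
    IsSuperMap U V (fun B : a' ⊕ b' => (coord (Sum.map σ τ B) : SFun a b)) := by
  rw [← relabel_one]
  refine isSuperMap_relabel _ σ τ hU hV fun x hx => ?_
  simp only [one_mul]
  exact h x hx

theorem soul_coord_map (σ : a' → a) (τ : b' → b) (x : a → ℝ) (s : a') :
    soul ((coord (Sum.map σ τ (Sum.inl s : a' ⊕ b')) : SFun a b) x) = 0 := by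
  have := soul_smul_coord (b := b) 1 (σ s) x
  rwa [one_smul] at this

theorem subst_coord_map_apply (σ : a' → a) (τ : b' → b) (f : SFun a' b') (x : a → ℝ) :
    subst (fun B : a' ⊕ b' => (coord (Sum.map σ τ B) : SFun a b)) f x =
      grHom (fun m => gen (τ m)) (f (x ∘ σ)) := by
  rw [subst_of_soul_eq_zero (φ := fun B : a' ⊕ b' => (coord (Sum.map σ τ B) : SFun a b))
    (soul_coord_map σ τ x)]
  congr 2
  funext s
  exact body_algebraMap _

theorem subst_subst_coord_map {a'' b'' : Type} [Fintype a''] [DecidableEq a''] [Fintype b'']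
    [DecidableEq b''] {U : Set (a → ℝ)} {V : Set (a' → ℝ)} {W : Set (a'' → ℝ)}
    {φ : a' ⊕ b' → SFun a b} (hφ : IsSuperMap U V φ) {σ : a'' → a'} {τ : b'' → b'}
    (hV : IsOpen W) (h : ∀ x ∈ V, x ∘ σ ∈ W) {x : a → ℝ} (hx : x ∈ U) {f : SFun a'' b''}
    (hf : ContDiffOn ℝ ∞ f W) :
    subst φ (subst (fun B : a'' ⊕ b'' => (coord (Sum.map σ τ B) : SFun a' b')) f) x =
      subst (fun B => φ (Sum.map σ τ B)) f x := by
  have := isSuperMap_coord_map σ τ hφ.isOpen_target hV h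
  rw [← relabel_one] at this ⊢
  rw [subst_subst_relabel hφ this hx hf]
  exact subst_congr_left (fun A => by rw [one_smul]) f

end CoordMap

/-! ### Functions on the cotangent bundle -/

section Cotangent

variable {a b : Type} [Fintype a] [DecidableEq a] [Fintype b] [DecidableEq b]

/-- The cylinder over a domain: the part of the total space of a trivial bundle over it. -/
def cyl {a d : Type} (U : Set (a → ℝ)) : Set (a ⊕ d → ℝ) := {z | z ∘ Sum.inl ∈ U}

theorem isOpen_cyl {d : Type} {U : Set (a → ℝ)} (hU : IsOpen U) : IsOpen (cyl (d := d) U) :=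
  hU.preimage (continuous_pi fun _ => continuous_apply _)

variable {U : Set (a → ℝ)} {f g : SFun a b} {z : a ⊕ a → ℝ}

theorem isSuperMap_qIdx (hU : IsOpen U) :
    IsSuperMap (cyl U) U (fun A : a ⊕ b => (coord (qIdx A) : SFun (a ⊕ a) (b ⊕ b))) :=
  isSuperMap_coord_map _ _ (isOpen_cyl hU) hU fun _ hx => hx

theorem liftCot_apply (f : SFun a b) (z : a ⊕ a → ℝ) :
    liftCot f z = grHom (fun m => gen (Sum.inl m)) (f (z ∘ Sum.inl)) :=
  subst_coord_map_apply _ _ f z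

theorem gen_map_odd {b b' : Type} [DecidableEq b'] [Fintype b'] (τ : b → b') (m : b) :
    gen (τ m) ∈ grPart b' 1 := gen_odd _

theorem liftCot_mem {ε : ZMod 2} (h : f (z ∘ Sum.inl) ∈ grPart b ε) :
    liftCot f z ∈ grPart (b ⊕ b) ε := by
  rw [liftCot_apply]
  exact grHom_mem (gen_map_odd _) h

theorem liftCot_congr (h : f (z ∘ Sum.inl) = g (z ∘ Sum.inl)) : liftCot f z = liftCot g z := by
  rw [liftCot_apply, liftCot_apply, h]

theorem liftCot_add (f g : SFun a b) : liftCot (f + g) = liftCot f + liftCot g := funext fun z => by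
  rw [liftCot_apply, Pi.add_apply, map_add, Pi.add_apply, liftCot_apply, liftCot_apply]

theorem liftCot_sum {ι : Type*} (S : Finset ι) (f : ι → SFun a b) :
    liftCot (∑ i ∈ S, f i) = ∑ i ∈ S, liftCot (f i) := funext fun z => by
  rw [liftCot_apply, Finset.sum_apply, map_sum, Finset.sum_apply]
  simp only [liftCot_apply]

theorem liftCot_mul (f g : SFun a b) : liftCot (f * g) = liftCot f * liftCot g := funext fun z => by
  rw [liftCot_apply, Pi.mul_apply, map_mul, Pi.mul_apply, liftCot_apply, liftCot_apply]

theorem liftCot_smul (r : ℝ) (f : SFun a b) : liftCot (r • f) = r • liftCot f := funext fun z => by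
  rw [liftCot_apply, Pi.smul_apply, map_smul, Pi.smul_apply, liftCot_apply]

theorem liftCot_coord (A : a ⊕ b) : liftCot (coord A) = coord (qIdx A) := by
  funext z
  exact subst_coord (isSuperMap_qIdx isOpen_univ) (Set.mem_univ _) A

theorem contDiffOn_liftCot (hU : IsOpen U) (hf : ContDiffOn ℝ ∞ f U) :
    ContDiffOn ℝ ∞ (liftCot f) (cyl U) := contDiffOn_subst (isSuperMap_qIdx hU) hf

theorem qIdx_injective : Function.Injective (qIdx : a ⊕ b → _) := by
  rintro (s | m) (s' | m') h <;> simp_all [qIdx]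

theorem pIdx_injective : Function.Injective (pIdx : a ⊕ b → _) := by
  rintro (s | m) (s' | m') h <;> simp_all [pIdx]

theorem qIdx_ne_pIdx (A B : a ⊕ b) : qIdx A ≠ pIdx B := by
  rcases A with s | m <;> rcases B with s' | m' <;> simp [qIdx, pIdx]

theorem pd_qIdx_liftCot (hU : IsOpen U) (hf : ContDiffOn ℝ ∞ f U) (hz : z ∈ cyl U) (A : a ⊕ b) :
    pd (qIdx A) (liftCot f) z = liftCot (pd A f) z := by
  rw [liftCot, pd_subst (isSuperMap_qIdx hU) hz _ hf, Finset.sum_eq_single A]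
  · rw [pd_coord, if_pos rfl, one_mul]; rfl
  · intro B _ hB
    rw [pd_coord, if_neg fun h => hB (qIdx_injective h).symm, zero_mul]
  · simp

theorem pd_pIdx_liftCot (hU : IsOpen U) (hf : ContDiffOn ℝ ∞ f U) (hz : z ∈ cyl U) (A : a ⊕ b) :
    pd (pIdx A) (liftCot f) z = 0 := by
  rw [liftCot, pd_subst (isSuperMap_qIdx hU) hz _ hf]
  refine Finset.sum_eq_zero fun B _ => ?_
  rw [pd_coord, if_neg (qIdx_ne_pIdx B A).symm, zero_mul]

/-- The zero section of the cotangent bundle. -/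
def zeroSec : (a ⊕ a) ⊕ (b ⊕ b) → SFun a b :=
  Sum.elim (Sum.elim (fun s => coord (Sum.inl s)) 0) (Sum.elim (fun m => coord (Sum.inr m)) 0)

theorem soul_zeroSec (x : a → ℝ) (s : a ⊕ a) :
    soul ((zeroSec (Sum.inl s) : SFun a b) x) = 0 := by
  rcases s with s | s
  · have := soul_smul_coord (b := b) 1 s x
    rwa [one_smul] at this
  · change soul (0 : Gr b) = 0
    simp [soul]

theorem bodyMap_zeroSec (x : a → ℝ) :
    bodyMap (zeroSec : (a ⊕ a) ⊕ (b ⊕ b) → SFun a b) x = Sum.elim x 0 := by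
  funext s
  rcases s with s | s
  · exact body_algebraMap _
  · exact map_zero _

theorem isSuperMap_zeroSec (hU : IsOpen U) :
    IsSuperMap U (cyl U) (zeroSec : (a ⊕ a) ⊕ (b ⊕ b) → SFun a b) := by
  refine ⟨hU, isOpen_cyl hU, ?_, ?_, ?_⟩
  · rintro ((s | s) | (m | m))
    · exact (contDiff_coord (Sum.inl s)).contDiffOn
    · exact contDiffOn_const
    · exact (contDiff_coord (Sum.inr m)).contDiffOn
    · exact contDiffOn_const
  · rintro ((s | s) | (m | m)) x _
    · exact coord_mem (Sum.inl s) x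
    · exact Submodule.zero_mem _
    · exact coord_mem (Sum.inr m) x
    · exact Submodule.zero_mem _
  · intro x hx
    rw [bodyMap_zeroSec]
    exact hx

theorem zeroSec_odd (x : a → ℝ) (m : b ⊕ b) :
    (zeroSec (Sum.inr m) : SFun a b) x ∈ grPart b 1 :=
  (isSuperMap_zeroSec isOpen_univ).odd (Set.mem_univ x) m

theorem subst_zeroSec_apply (F : SFun (a ⊕ a) (b ⊕ b)) (x : a → ℝ) :
    subst zeroSec F x = grHom (fun m => (zeroSec (Sum.inr m) : SFun a b) x) (F (Sum.elim x 0)) := by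
  rw [subst_of_soul_eq_zero (soul_zeroSec x), bodyMap_zeroSec]

theorem subst_zeroSec_liftCot (f : SFun a b) : subst zeroSec (liftCot f) = f := by
  funext x
  rw [subst_zeroSec_apply, liftCot_apply, grHom_grHom (zeroSec_odd x) (gen_map_odd _)]
  refine Eq.trans ?_ (grHom_gen_self (f x))
  congr 2
  funext m
  exact grHom_gen (zeroSec_odd x) (Sum.inl m)

theorem liftCot_injOn {x : a → ℝ}
    (h : ∀ z : a ⊕ a → ℝ, z ∘ Sum.inl = x → liftCot f z = liftCot g z) :
    f x = g x := by
  have := congrArg (grHom (fun m => (zeroSec (Sum.inr m) : SFun a b) x)) (h (Sum.elim x 0) rfl)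
  rwa [← subst_zeroSec_apply, ← subst_zeroSec_apply, subst_zeroSec_liftCot,
    subst_zeroSec_liftCot] at this

/-- The symbol `X^A p_A` of the vector field with components `X^A`. -/
def sym (X : a ⊕ b → SFun a b) : SFun (a ⊕ a) (b ⊕ b) := ∑ A, liftCot (X A) * coord (pIdx A)

theorem sym_apply (X : a ⊕ b → SFun a b) (z : a ⊕ a → ℝ) :
    sym X z = ∑ A, liftCot (X A) z * (coord (pIdx A) : SFun (a ⊕ a) (b ⊕ b)) z := by
  rw [sym, Finset.sum_apply]; rfl

theorem sym_congr {X Y : a ⊕ b → SFun a b} (h : ∀ A, X A (z ∘ Sum.inl) = Y A (z ∘ Sum.inl)) :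
    sym X z = sym Y z := by
  rw [sym_apply, sym_apply]
  exact Finset.sum_congr rfl fun A _ => by rw [liftCot_congr (h A)]

variable {X Y : a ⊕ b → SFun a b}

theorem contDiffOn_sym (hU : IsOpen U) (hX : ∀ A, ContDiffOn ℝ ∞ (X A) U) :
    ContDiffOn ℝ ∞ (sym X) (cyl U) :=
  contDiffOn_sum _ fun A _ => contDiffOn_mul (contDiffOn_liftCot hU (hX A))
    (contDiff_coord _).contDiffOn

theorem pd_sym_aux (hU : IsOpen U) (hX : ∀ A, ContDiffOn ℝ ∞ (X A) U) (hz : z ∈ cyl U)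
    (C : (a ⊕ a) ⊕ (b ⊕ b)) :
    pd C (sym X) z = ∑ A, (pd C (liftCot (X A)) z * (coord (pIdx A) : SFun (a ⊕ a) (b ⊕ b)) z +
      sgn C (liftCot (X A) z) * if C = pIdx A then 1 else 0) := by
  have hd := fun A => ContDiffOn.differentiableAt_of_isOpen (isOpen_cyl (d := a) hU)
    (contDiffOn_liftCot hU (hX A)) hz
  rw [sym, pd_sum _ _ fun A _ => differentiableAt_mul (hd A) (differentiableAt_coord _ _)]
  refine Finset.sum_congr rfl fun A _ => ?_
  rw [pd_mul _ (hd A) (differentiableAt_coord _ _), pd_coord]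

theorem sgn_pIdx {b' : Type} (A : a ⊕ b) (x : Gr b') : sgn (pIdx A) x = sgn A x := by
  rcases A with s | m <;> rfl

theorem pd_pIdx_sym (hU : IsOpen U) (hX : ∀ A, ContDiffOn ℝ ∞ (X A) U) (hz : z ∈ cyl U)
    (A : a ⊕ b) : pd (pIdx A) (sym X) z = sgn A (liftCot (X A) z) := by
  rw [pd_sym_aux hU hX hz, Finset.sum_eq_single A]
  · rw [pd_pIdx_liftCot hU (hX A) hz, zero_mul, zero_add, if_pos rfl, mul_one, sgn_pIdx]
  · intro B _ hB
    rw [pd_pIdx_liftCot hU (hX B) hz, zero_mul, zero_add,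
      if_neg fun h => hB (pIdx_injective h).symm, mul_zero]
  · simp

theorem pd_qIdx_sym (hU : IsOpen U) (hX : ∀ A, ContDiffOn ℝ ∞ (X A) U) (hz : z ∈ cyl U)
    (A : a ⊕ b) : pd (qIdx A) (sym X) z = sym (fun B => pd A (X B)) z := by
  rw [pd_sym_aux hU hX hz, sym_apply]
  refine Finset.sum_congr rfl fun B _ => ?_
  rw [pd_qIdx_liftCot hU (hX B) hz, if_neg (qIdx_ne_pIdx A B), mul_zero, add_zero]

theorem sym_injOn (hU : IsOpen U) (hX : ∀ A, ContDiffOn ℝ ∞ (X A) U)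
    (hY : ∀ A, ContDiffOn ℝ ∞ (Y A) U) (h : ∀ z ∈ cyl U, sym X z = sym Y z) (A : a ⊕ b)
    {x : a → ℝ} (hx : x ∈ U) : X A x = Y A x := by
  refine liftCot_injOn fun z hz => ?_
  have hz' : z ∈ cyl U := show z ∘ Sum.inl ∈ U from hz ▸ hx
  have := pd_congr_of_isOpen (pIdx A) (isOpen_cyl (d := a) hU) hz' h
  rw [pd_pIdx_sym hU hX hz', pd_pIdx_sym hU hY hz'] at this
  rw [← sgn_sgn A (liftCot (X A) z), this, sgn_sgn]

theorem par_pIdx (A : a ⊕ b) : par (pIdx A) = par A := by rcases A with s | m <;> rfl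

theorem par_qIdx (A : a ⊕ b) : par (qIdx A) = par A := by rcases A with s | m <;> rfl

theorem zmod_two_add_cancel (ε δ : ZMod 2) : ε + δ + ε = δ := by
  rw [add_comm ε δ, add_assoc, CharTwo.add_self_eq_zero, add_zero]

theorem parityOn_sym {ε : ZMod 2} (hX : ∀ A, ParityOn U (par A + ε) (X A)) :
    ParityOn (cyl U) ε (sym X) := by
  intro z hz
  rw [sym_apply]
  refine Submodule.sum_mem _ fun A _ => ?_
  have := mul_mem_grPart (liftCot_mem (hX A _ hz)) (coord_mem (pIdx A) z)
  rwa [par_pIdx, zmod_two_add_cancel] at this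

end Cotangent

/-! ### Coordinate changes on the cotangent bundle -/

section Glued

variable {a b : Type} [Fintype a] [DecidableEq a] [Fintype b] [DecidableEq b]

/-- The part of the axioms of a supermanifold that concerns pairs of charts: coordinate changes
are morphisms of superdomains, and those in opposite directions are inverse to each other. -/
structure SuperAtlas.IsGlued (N : SuperAtlas.{u} a b) : Prop where
  isOpen_dom : ∀ i, IsOpen (N.dom i)
  ovl_subset : ∀ i j, N.ovl i j ⊆ N.dom i
  isSuperMap : ∀ i j, IsSuperMap (N.ovl i j) (N.ovl j i) (N.tr i j)
  inv : ∀ i j A, ∀ x ∈ N.ovl i j, subst (N.tr i j) (N.tr j i A) x = coord A x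

theorem matrix_mul_comm {ι : Type*} [Fintype ι] [DecidableEq ι] {J K : ι → ι → Gr b}
    (h : ∀ A C, ∑ B, J A B * K B C = if A = C then 1 else 0) (A C : ι) :
    ∑ B, K A B * J B C = if A = C then 1 else 0 := by
  have : IsNoetherianRing (Gr b) := isNoetherian_of_tower ℝ inferInstance
  have h1 : Matrix.of J * Matrix.of K = 1 := by
    ext A C
    rw [Matrix.mul_apply, Matrix.one_apply]
    exact h A C
  have h3 : Matrix.of K * Matrix.of J = 1 := mul_eq_one_comm.1 h1
  have h2 := congrFun (congrFun h3 A) C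
  rw [Matrix.mul_apply, Matrix.one_apply] at h2
  exact h2

variable {N : SuperAtlas.{u} a b} {i j : N.Idx} {x : a → ℝ}

/-- The inverse Jacobian matrix `∂x^B/∂x̄^A` as a function of the old coordinates. -/
def SuperAtlas.invJac (N : SuperAtlas.{u} a b) (i j : N.Idx) (A B : a ⊕ b) : SFun a b :=
  subst (N.tr i j) (pd A (N.tr j i B))

theorem SuperAtlas.IsGlued.contDiffOn_pd_tr (hN : N.IsGlued) (A B : a ⊕ b) :
    ContDiffOn ℝ ∞ (pd A (N.tr i j B)) (N.ovl i j) :=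
  contDiffOn_pd A (hN.isSuperMap i j).isOpen_source ((hN.isSuperMap i j).smooth B)

theorem SuperAtlas.IsGlued.contDiffOn_invJac (hN : N.IsGlued) (A B : a ⊕ b) :
    ContDiffOn ℝ ∞ (N.invJac i j A B) (N.ovl i j) :=
  contDiffOn_subst (hN.isSuperMap i j) (hN.contDiffOn_pd_tr A B)

theorem SuperAtlas.IsGlued.parityOn_invJac (hN : N.IsGlued) (A B : a ⊕ b) :
    ParityOn (N.ovl i j) (par B + par A) (N.invJac i j A B) :=
  parityOn_subst (hN.isSuperMap i j) (hN.contDiffOn_pd_tr A B)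
    (pd_mem A (hN.isSuperMap j i).isOpen_source ((hN.isSuperMap j i).smooth B)
      ((hN.isSuperMap j i).parity B))

theorem SuperAtlas.IsGlued.jac_mul_invJac (hN : N.IsGlued) (hx : x ∈ N.ovl i j) (A C : a ⊕ b) :
    ∑ B, pd A (N.tr i j B) x * N.invJac i j B C x = if A = C then 1 else 0 := by
  have h := pd_subst (hN.isSuperMap i j) hx A ((hN.isSuperMap j i).smooth C)
  rw [pd_congr_of_isOpen A (hN.isSuperMap i j).isOpen_source hx (hN.inv i j C), pd_coord] at h
  exact h.symm

theorem SuperAtlas.IsGlued.invJac_mul_jac (hN : N.IsGlued) (hx : x ∈ N.ovl i j) (A C : a ⊕ b) :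
    ∑ B, N.invJac i j A B x * pd B (N.tr i j C) x = if A = C then 1 else 0 :=
  matrix_mul_comm (hN.jac_mul_invJac hx) A C

theorem sum_mul_delta {ι : Type*} [Fintype ι] [DecidableEq ι] (f : ι → Gr b) (C : ι) :
    ∑ A, f A * (if A = C then 1 else 0) = f C := by simp

/-- The transformation law of vector fields, solved for the components in the old chart. -/
theorem SuperAtlas.IsGlued.act_tr_iff (hN : N.IsGlued) (hx : x ∈ N.ovl i j)
    (X : a ⊕ b → SFun a b) (Y : a ⊕ b → Gr b) :
    (∀ C, act X (N.tr i j C) x = Y C) ↔ ∀ A, X A x = ∑ B, Y B * N.invJac i j B A x := by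
  have hact : ∀ C, act X (N.tr i j C) x = ∑ A, X A x * pd A (N.tr i j C) x := fun C => by
    rw [act, Finset.sum_apply]; rfl
  simp only [hact]
  constructor
  · intro h A
    simp only [← h, Finset.sum_mul, mul_assoc]
    rw [Finset.sum_comm]
    simp only [← Finset.mul_sum, hN.jac_mul_invJac hx]
    rw [sum_mul_delta]
  · intro h C
    simp only [h, Finset.sum_mul, mul_assoc]
    rw [Finset.sum_comm]
    simp only [← Finset.mul_sum, hN.invJac_mul_jac hx]
    rw [sum_mul_delta]

theorem cot_tr_qIdx (N : SuperAtlas.{u} a b) (i j : N.Idx) (A : a ⊕ b) :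
    (cot N).tr i j (qIdx A) = liftCot (N.tr i j A) := by rcases A with s | m <;> rfl

theorem cot_tr_pIdx (N : SuperAtlas.{u} a b) (i j : N.Idx) (A : a ⊕ b) :
    (cot N).tr i j (pIdx A) = sym (N.invJac i j A) := by rcases A with s | m <;> rfl

theorem forall_cotIdx {P : (a ⊕ a) ⊕ (b ⊕ b) → Prop} (hq : ∀ A, P (qIdx A))
    (hp : ∀ A, P (pIdx A)) (C : (a ⊕ a) ⊕ (b ⊕ b)) : P C := by
  rcases C with (s | s) | (m | m)
  · exact hq (Sum.inl s)
  · exact hp (Sum.inl s)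
  · exact hq (Sum.inr m)
  · exact hp (Sum.inr m)

theorem sum_cotIdx {M : Type*} [AddCommMonoid M] (h : (a ⊕ a) ⊕ (b ⊕ b) → M) :
    ∑ C, h C = ∑ A, h (qIdx A) + ∑ A, h (pIdx A) := by
  simp only [Fintype.sum_sum_type, qIdx, pIdx, Sum.map_inl, Sum.map_inr]
  abel

theorem isOpen_cot_ovl (hN : N.IsGlued) (i j : N.Idx) : IsOpen ((cot N).ovl i j) :=
  isOpen_cyl (hN.isSuperMap i j).isOpen_source

theorem body_liftCot (f : SFun a b) (z : a ⊕ a → ℝ) :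
    body (liftCot f z) = body (f (z ∘ Sum.inl)) := by
  rw [liftCot_apply, body_grHom (gen_map_odd _)]

theorem isSuperMap_cot_tr (hN : N.IsGlued) (i j : N.Idx) :
    IsSuperMap ((cot N).ovl i j) ((cot N).ovl j i) ((cot N).tr i j) := by
  have h := hN.isSuperMap i j
  refine ⟨isOpen_cot_ovl hN i j, isOpen_cot_ovl hN j i, ?_, ?_, ?_⟩
  · refine forall_cotIdx (fun A => ?_) fun A => ?_
    · rw [cot_tr_qIdx]; exact contDiffOn_liftCot h.isOpen_source (h.smooth A)
    · rw [cot_tr_pIdx]; exact contDiffOn_sym h.isOpen_source fun B => hN.contDiffOn_invJac A B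
  · refine forall_cotIdx (fun A => ?_) fun A => ?_
    · rw [cot_tr_qIdx, par_qIdx]
      exact fun z hz => liftCot_mem (h.parity A _ hz)
    · rw [cot_tr_pIdx, par_pIdx]
      exact parityOn_sym fun B => hN.parityOn_invJac A B
  · intro z hz
    change (bodyMap ((cot N).tr i j) z) ∘ Sum.inl ∈ N.ovl j i
    have : (bodyMap ((cot N).tr i j) z) ∘ Sum.inl = bodyMap (N.tr i j) (z ∘ Sum.inl) :=
      funext fun s => body_liftCot _ _
    rw [this]
    exact h.mapsTo hz

theorem subst_cot_tr_liftCot (hN : N.IsGlued) {z : a ⊕ a → ℝ} (hz : z ∈ (cot N).ovl i j)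
    {f : SFun a b} (hf : ContDiffOn ℝ ∞ f (N.ovl j i)) :
    subst ((cot N).tr i j) (liftCot f) z = liftCot (subst (N.tr i j) f) z := by
  have h := hN.isSuperMap i j
  have h1 := subst_subst_coord_map (isSuperMap_cot_tr hN i j) (σ := Sum.inl) (τ := Sum.inl)
    h.isOpen_target (fun z hz => hz) hz hf
  have h2 := subst_subst_of_soul_eq_zero (isSuperMap_qIdx h.isOpen_source)
    (fun z _ => soul_coord_map Sum.inl Sum.inl z) h hz hf
  exact (h1.trans (subst_congr_left (fun A => congrFun (cot_tr_qIdx N i j A) z) f)).trans h2.symm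

/-- The symbol of a vector field in the new chart, in terms of the coordinates of the old one. -/
theorem subst_cot_tr_sym (hN : N.IsGlued) {z : a ⊕ a → ℝ} (hz : z ∈ (cot N).ovl i j)
    {X : a ⊕ b → SFun a b} (hX : ∀ A, ContDiffOn ℝ ∞ (X A) (N.ovl j i)) :
    subst ((cot N).tr i j) (sym X) z =
      sym (fun A => ∑ B, subst (N.tr i j) (X B) * N.invJac i j B A) z := by
  have h := isSuperMap_cot_tr hN i j
  have hX' := fun A => contDiffOn_liftCot (hN.isSuperMap i j).isOpen_target (hX A)
  rw [sym, subst_sum h hz _ fun A _ => contDiffOn_mul (hX' A) (contDiff_coord _).contDiffOn,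
    sym_apply]
  simp only [subst_mul h hz (hX' _) (contDiff_coord _).contDiffOn, subst_coord h hz, cot_tr_pIdx,
    subst_cot_tr_liftCot hN hz (hX _), sym_apply, Finset.mul_sum, liftCot_sum, liftCot_mul,
    Finset.sum_apply, Pi.mul_apply, Finset.sum_mul, mul_assoc]
  exact Finset.sum_comm

/-- A family of local vector fields is compatible with the coordinate changes if and only if the
family of their symbols is. -/
theorem sym_compat_iff (hN : N.IsGlued) {X Y : a ⊕ b → SFun a b}
    (hX : ∀ A, ContDiffOn ℝ ∞ (X A) (N.ovl i j)) (hY : ∀ A, ContDiffOn ℝ ∞ (Y A) (N.ovl j i)) :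
    (∀ z ∈ (cot N).ovl i j, sym X z = subst ((cot N).tr i j) (sym Y) z) ↔
      ∀ C, ∀ x ∈ N.ovl i j, act X (N.tr i j C) x = subst (N.tr i j) (Y C) x := by
  have h := hN.isSuperMap i j
  have hZ : ∀ A, ContDiffOn ℝ ∞ (∑ B, subst (N.tr i j) (Y B) * N.invJac i j B A) (N.ovl i j) :=
    fun A => contDiffOn_sum _ fun B _ => contDiffOn_mul (contDiffOn_subst h (hY B))
      (hN.contDiffOn_invJac B A)
  have hsum : ∀ A x, (∑ B, subst (N.tr i j) (Y B) * N.invJac i j B A) x =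
      ∑ B, subst (N.tr i j) (Y B) x * N.invJac i j B A x := fun A x => by
    rw [Finset.sum_apply]; rfl
  constructor
  · intro hs C x hx
    refine (hN.act_tr_iff hx X fun C => subst (N.tr i j) (Y C) x).2 (fun A => ?_) C
    rw [← hsum]
    exact sym_injOn h.isOpen_source hX hZ
      (fun z hz => (hs z hz).trans (subst_cot_tr_sym hN hz hY)) A hx
  · intro hc z hz
    rw [subst_cot_tr_sym hN hz hY]
    refine sym_congr fun A => ?_
    rw [hsum]
    exact (hN.act_tr_iff hz X fun C => subst (N.tr i j) (Y C) _).1 (fun C => hc C _ hz) A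

theorem liftCot_compat_iff (hN : N.IsGlued) {f g : SFun a b}
    (hg : ContDiffOn ℝ ∞ g (N.ovl j i)) :
    (∀ z ∈ (cot N).ovl i j, liftCot f z = subst ((cot N).tr i j) (liftCot g) z) ↔
      ∀ x ∈ N.ovl i j, f x = subst (N.tr i j) g x := by
  constructor
  · intro h x hx
    refine liftCot_injOn fun z hz => ?_
    have hz' : z ∈ (cot N).ovl i j := show z ∘ Sum.inl ∈ N.ovl i j from hz ▸ hx
    rw [h z hz', subst_cot_tr_liftCot hN hz' hg]
  · intro h z hz
    rw [subst_cot_tr_liftCot hN hz hg]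
    exact liftCot_congr (h _ hz)

end Glued

/-! ### Functions of degree zero and one in the momenta -/

section MomentumDegree

variable {a b : Type} [Fintype a] [DecidableEq a] [Fintype b] [DecidableEq b]
  {U : Set (a → ℝ)} {F : SFun (a ⊕ a) (b ⊕ b)} {z : a ⊕ a → ℝ}

theorem act_euler (w : a ⊕ b → ℤ) (f : SFun a b) (x : a → ℝ) :
    act (euler w) f x = ∑ A, (w A : ℝ) • (coord A x * pd A f x) := by
  rw [act, Finset.sum_apply]
  exact Finset.sum_congr rfl fun A _ => smul_mul_assoc (w A : ℝ) ((coord A : SFun a b) x) (pd A f x)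

theorem act_euler_momDeg (F : SFun (a ⊕ a) (b ⊕ b)) (z : a ⊕ a → ℝ) :
    act (euler momDeg) F z =
      ∑ A : a ⊕ b, (coord (pIdx A) : SFun (a ⊕ a) (b ⊕ b)) z * pd (pIdx A) F z := by
  have h0 : ∀ A : a ⊕ b, momDeg (qIdx A) = 0 := by rintro (s | m) <;> rfl
  have h1 : ∀ A : a ⊕ b, momDeg (pIdx A) = 1 := by rintro (s | m) <;> rfl
  rw [act_euler, sum_cotIdx]
  simp [h0, h1]

/-- The fibrewise scaling `p ↦ t p` of the cotangent bundle at the point `z`, as a family of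
superfunctions of the parameter `t`. -/
def scaleMap (z : a ⊕ a → ℝ) : (a ⊕ a) ⊕ (b ⊕ b) → SFun Unit (b ⊕ b) := fun C t =>
  (if momDeg C = 0 then 1 else t ()) • (coord C : SFun (a ⊕ a) (b ⊕ b)) z

theorem contDiff_scale (n : ℤ) : ContDiff ℝ ∞ (fun t : Unit → ℝ => if n = 0 then 1 else t ()) := by
  split_ifs
  · exact contDiff_const
  · exact contDiff_apply ℝ ℝ ()

theorem bodyMap_scaleMap (z : a ⊕ a → ℝ) (t : Unit → ℝ) :
    bodyMap (scaleMap z : (a ⊕ a) ⊕ (b ⊕ b) → _) t =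
      Sum.elim (z ∘ Sum.inl) (t () • (z ∘ Sum.inr)) := by
  have key : ∀ (s : a ⊕ a) (r : ℝ), body (r • (coord (Sum.inl s) : SFun (a ⊕ a) (b ⊕ b)) z) =
      r * z s := fun s r => by
    rw [map_smul, smul_eq_mul]; exact congrArg _ (body_algebraMap _)
  funext s
  rcases s with s | s
  · exact (key _ _).trans (one_mul _)
  · exact key _ _

theorem soul_scaleMap (z : a ⊕ a → ℝ) (t : Unit → ℝ) (s : a ⊕ a) :
    soul ((scaleMap z (Sum.inl s) : SFun Unit (b ⊕ b)) t) = 0 := soul_smul_coord _ s z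

theorem isSuperMap_scaleMap (hU : IsOpen U) (hz : z ∈ cyl U) :
    IsSuperMap Set.univ (cyl U) (scaleMap z : (a ⊕ a) ⊕ (b ⊕ b) → SFun Unit (b ⊕ b)) := by
  refine ⟨isOpen_univ, isOpen_cyl hU, fun C => ?_, fun C t _ => ?_, fun t _ => ?_⟩
  · exact ((contDiff_scale _).smul contDiff_const).contDiffOn
  · exact Submodule.smul_mem _ _ (coord_mem C z)
  · rw [bodyMap_scaleMap]
    exact hz

theorem subst_scaleMap_one (F : SFun (a ⊕ a) (b ⊕ b)) (z : a ⊕ a → ℝ) :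
    subst (scaleMap z) F (fun _ => 1) = F z := by
  rw [subst_of_soul_eq_zero (soul_scaleMap z _), bodyMap_scaleMap, one_smul]
  refine Eq.trans ?_ (grHom_gen_self (F z))
  congr 2
  · funext m
    change (if _ then (1 : ℝ) else 1) • _ = _
    rw [ite_self, one_smul]; rfl
  · funext s; rcases s with s | s <;> rfl

theorem subst_scaleMap_zero (F : SFun (a ⊕ a) (b ⊕ b)) (z : a ⊕ a → ℝ) :
    subst (scaleMap z) F (fun _ => 0) = liftCot (subst zeroSec F) z := by
  rw [subst_of_soul_eq_zero (soul_scaleMap z _), bodyMap_scaleMap, zero_smul, liftCot_apply,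
    subst_zeroSec_apply, grHom_grHom (gen_map_odd _) (zeroSec_odd _)]
  congr 2
  funext m
  rcases m with m | m
  · refine Eq.trans ?_ (grHom_gen (gen_map_odd _) m).symm
    exact one_smul _ _
  · exact (zero_smul _ _).trans (map_zero _).symm

theorem pd_scaleMap (z : a ⊕ a → ℝ) (C : (a ⊕ a) ⊕ (b ⊕ b)) (t : Unit → ℝ) :
    pd (Sum.inl ()) (scaleMap z C) t =
      (if momDeg C = 0 then (0 : ℝ) else 1) • (coord C : SFun (a ⊕ a) (b ⊕ b)) z := by
  by_cases h : momDeg C = 0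
  · rw [if_pos h, zero_smul, show (scaleMap z C : SFun Unit (b ⊕ b)) =
      fun _ => (1 : ℝ) • (coord C : SFun (a ⊕ a) (b ⊕ b)) z from funext fun t => by
        rw [scaleMap, if_pos h], pd_inl, fderiv_fun_const]
    rfl
  · have h1 : HasFDerivAt (scaleMap z C : SFun Unit (b ⊕ b))
        ((ContinuousLinearMap.proj (R := ℝ) (φ := fun _ : Unit => ℝ) ()).smulRight
          ((coord C : SFun (a ⊕ a) (b ⊕ b)) z)) t := by
      have h2 : (scaleMap z C : SFun Unit (b ⊕ b)) =
          ((ContinuousLinearMap.proj (R := ℝ) (φ := fun _ : Unit => ℝ) ()).smulRight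
            ((coord C : SFun (a ⊕ a) (b ⊕ b)) z)) := funext fun t => by
        rw [scaleMap, if_neg h]; rfl
      rw [h2]
      exact ContinuousLinearMap.hasFDerivAt _
    rw [pd_inl, h1.fderiv, if_neg h]
    change (Pi.single () (1 : ℝ) : Unit → ℝ) () • (coord C : SFun (a ⊕ a) (b ⊕ b)) z = _
    rw [Pi.single_eq_same]

/-- A function of degree zero in the momenta does not depend on them: the derivative of the
function along the scaling of the momenta vanishes, so that it agrees with its limit at zero. -/
theorem eq_liftCot_of_momDeg_zero (hU : IsOpen U) (hF : ContDiffOn ℝ ∞ F (cyl U))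
    (h0 : FunWeightOn (cyl U) momDeg 0 F) (hz : z ∈ cyl U) :
    F z = liftCot (subst zeroSec F) z := by
  have hφ := isSuperMap_scaleMap (b := b) hU hz
  set H : SFun Unit (b ⊕ b) := subst (scaleMap z) F with hH
  have hHs : ContDiff ℝ ∞ H := contDiffOn_univ.1 (contDiffOn_subst hφ hF)
  have hc : ∀ C, ContDiffOn ℝ ∞ (euler momDeg C * pd C F) (cyl U) := fun C =>
    contDiffOn_mul (contDiffOn_smul _ (contDiff_coord C).contDiffOn)
      (contDiffOn_pd C (isOpen_cyl hU) hF)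
  have hE : ∀ t : Unit → ℝ, t () • pd (Sum.inl ()) H t = 0 := fun t => by
    have h1 := subst_congr hφ (Set.mem_univ t) (f := act (euler momDeg) F) (g := 0) (by
      rw [act]
      exact contDiffOn_sum _ fun C _ => hc C)
      fun y hy => by rw [h0 y hy, Int.cast_zero, zero_smul]; rfl
    rw [subst_zero, act, subst_sum hφ (Set.mem_univ t) _ fun C _ => hc C] at h1
    rw [hH, pd_subst hφ (Set.mem_univ t) _ hF, Finset.smul_sum, ← h1]
    refine Finset.sum_congr rfl fun C _ => ?_
    rw [subst_mul hφ (Set.mem_univ t) (f := euler momDeg C)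
      (contDiffOn_smul _ (contDiff_coord C).contDiffOn) (contDiffOn_pd C (isOpen_cyl hU) hF),
      pd_scaleMap, euler,
      subst_smul hφ (Set.mem_univ t) (contDiff_coord _).contDiffOn, subst_coord hφ (Set.mem_univ t),
      scaleMap, ← smul_mul_assoc, smul_smul, smul_smul]
    congr 2
    rcases C with (s | s) | (m | m) <;> simp [momDeg]
  set G : ℝ → Gr (b ⊕ b) := fun t => H fun _ => t with hG
  have hl : ContDiff ℝ ∞ (fun t : ℝ => fun _ : Unit => t) := contDiff_pi.2 fun _ => contDiff_id
  have hGs : ContDiff ℝ ∞ G := hHs.comp hl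
  have hGd : ∀ t, deriv G t = pd (Sum.inl ()) H (fun _ => t) := fun t => by
    have h2 : HasDerivAt (fun t : ℝ => fun _ : Unit => t) (Pi.single () 1) t := by
      refine hasDerivAt_pi.2 fun u => ?_
      rw [Pi.single_eq_same]
      exact hasDerivAt_id t
    exact ((hHs.differentiable (by simp) _).hasFDerivAt.comp_hasDerivAt t h2).deriv
  have hG0 : deriv G = 0 := by
    refine Continuous.ext_on (dense_compl_singleton (0 : ℝ)) (hGs.continuous_deriv (by simp))
      continuous_const fun t ht => ?_
    rw [hGd]
    exact (smul_eq_zero.1 (hE fun _ => t)).resolve_left ht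
  have := is_const_of_deriv_eq_zero (hGs.differentiable (by simp)) (congrFun hG0) 1 0
  rw [← subst_scaleMap_one F z, ← subst_scaleMap_zero F z]
  exact this

theorem momDeg_liftCot {f : SFun a b} (hU : IsOpen U) (hf : ContDiffOn ℝ ∞ f U) :
    FunWeightOn (cyl U) momDeg 0 (liftCot f) := fun z hz => by
  rw [act_euler_momDeg, Int.cast_zero, zero_smul]
  exact Finset.sum_eq_zero fun A _ => by rw [pd_pIdx_liftCot hU hf hz, mul_zero]

/-- Coordinates and partial derivatives commute up to sign. -/
theorem sgn_coord_mul_pd_pd {V : Set (a → ℝ)} (hV : IsOpen V) {f : SFun a b}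
    (hf : ContDiffOn ℝ ∞ f V) {x : a → ℝ} (hx : x ∈ V) (A B : a ⊕ b) :
    sgn A ((coord B : SFun a b) x) * pd A (pd B f) x = coord B x * pd B (pd A f) x := by
  rcases B with s | m
  · rw [sgn_even A (coord_mem (Sum.inl s) x), pd_inl_comm s A hV hf hx]
  · rcases A with r | k
    · rw [pd_inl_comm r _ hV hf hx]; rfl
    · rw [pd_inr_comm, mul_neg]
      change -(grInv (gen m) * _) = gen m * _
      rw [grInv_odd (gen_odd m), neg_mul, neg_neg]

/-- A derivative along a momentum lowers the degree in the momenta, here from one to zero. -/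
theorem momDeg_pd_pIdx (hU : IsOpen U) (hF : ContDiffOn ℝ ∞ F (cyl U))
    (h1 : FunWeightOn (cyl U) momDeg 1 F) (A : a ⊕ b) :
    FunWeightOn (cyl U) momDeg 0 (pd (pIdx A) F) := by
  have hV := isOpen_cyl (d := a) hU
  intro z hz
  have hd : ∀ C, DifferentiableAt ℝ (pd C F) z := fun C =>
    ContDiffOn.differentiableAt_of_isOpen hV (contDiffOn_pd C hV hF) hz
  have h2 : pd (pIdx A) (∑ B : a ⊕ b, coord (pIdx B) * pd (pIdx B) F) z = pd (pIdx A) F z :=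
    pd_congr_of_isOpen _ hV hz fun y hy => by
      have := h1 y hy
      rw [act_euler_momDeg, Int.cast_one, one_smul] at this
      rw [← this, Finset.sum_apply]; rfl
  rw [pd_sum _ _ fun B _ => differentiableAt_mul (differentiableAt_coord _ _) (hd _)] at h2
  simp only [pd_mul _ (differentiableAt_coord _ _) (hd _), Finset.sum_add_distrib, pd_coord,
    sgn_coord_mul_pd_pd hV hF hz, ite_mul, one_mul, zero_mul] at h2
  have h3 : ∑ B : a ⊕ b, (if pIdx A = pIdx B then pd (pIdx B) F z else 0) = pd (pIdx A) F z := by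
    rw [Finset.sum_eq_single A (fun B _ hB => if_neg fun h => hB (pIdx_injective h).symm) (by simp),
      if_pos rfl]
  rw [h3, add_eq_left] at h2
  rw [act_euler_momDeg, h2, Int.cast_zero, zero_smul]

/-- The components of the vector field whose symbol is `F`. -/
def symComp (F : SFun (a ⊕ a) (b ⊕ b)) (A : a ⊕ b) : SFun a b := subst zeroSec (pd (pIdx A) F)

theorem contDiffOn_symComp (hU : IsOpen U) (hF : ContDiffOn ℝ ∞ F (cyl U)) (A : a ⊕ b) :
    ContDiffOn ℝ ∞ (symComp F A) U :=
  contDiffOn_subst (isSuperMap_zeroSec hU) (contDiffOn_pd _ (isOpen_cyl hU) hF)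

theorem parityOn_symComp (hU : IsOpen U) (hF : ContDiffOn ℝ ∞ F (cyl U))
    (ho : ParityOn (cyl U) 1 F) (A : a ⊕ b) : ParityOn U (par A + 1) (symComp F A) := by
  have := parityOn_subst (isSuperMap_zeroSec hU) (contDiffOn_pd (pIdx A) (isOpen_cyl hU) hF)
    (pd_mem _ (isOpen_cyl hU) hF ho)
  rwa [par_pIdx, add_comm] at this

/-- An element whose parity is opposite to that of a coordinate commutes with it. -/
theorem coord_mul_comm {x : a → ℝ} {A : a ⊕ b} {g : Gr b} (hg : g ∈ grPart b (par A + 1)) :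
    coord A x * g = g * coord A x := by
  rcases A with s | m
  · exact even_mul_comm (coord_mem (Sum.inl s) x) g
  · refine (even_mul_comm ?_ _).symm
    rwa [show par (Sum.inr m : a ⊕ b) + 1 = 0 from rfl] at hg

/-- An odd function of degree one in the momenta is the symbol of a vector field. -/
theorem eq_sym_of_momDeg_one (hU : IsOpen U) (hF : ContDiffOn ℝ ∞ F (cyl U))
    (ho : ParityOn (cyl U) 1 F) (h1 : FunWeightOn (cyl U) momDeg 1 F) (hz : z ∈ cyl U) :
    F z = sym (symComp F) z := by
  have hV := isOpen_cyl (d := a) hU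
  have := h1 z hz
  rw [act_euler_momDeg, Int.cast_one, one_smul] at this
  rw [← this, sym_apply]
  refine Finset.sum_congr rfl fun A _ => ?_
  have h2 := eq_liftCot_of_momDeg_zero hU (contDiffOn_pd (pIdx A) hV hF)
    (momDeg_pd_pIdx hU hF h1 A) hz
  rw [symComp, ← h2]
  refine coord_mul_comm ?_
  have := pd_mem (pIdx A) hV hF ho z hz
  rwa [add_comm] at this

end MomentumDegree

/-! ### Signs -/

section Signs

/-- The sign `(-1)^ε`. -/
def sg (ε : ZMod 2) : ℝ := if ε = 1 then -1 else 1

theorem sg_zero : sg 0 = 1 := if_neg (by decide)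

theorem sg_one : sg 1 = -1 := if_pos rfl

theorem sg_add (ε δ : ZMod 2) : sg (ε + δ) = sg ε * sg δ := by
  rcases zmod_two_cases ε with rfl | rfl <;> rcases zmod_two_cases δ with rfl | rfl
  · rw [zero_add, sg_zero, one_mul]
  · rw [zero_add, sg_zero, one_mul]
  · rw [add_zero, sg_zero, mul_one]
  · rw [show (1 : ZMod 2) + 1 = 0 from rfl, sg_zero, sg_one]; norm_num

variable {b : Type} [Fintype b] [DecidableEq b]

theorem grInv_eq_sg {ε : ZMod 2} {x : Gr b} (hx : x ∈ grPart b ε) : grInv x = sg ε • x := by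
  rcases zmod_two_cases ε with rfl | rfl
  · rw [grInv_even hx, sg_zero, one_smul]
  · rw [grInv_odd hx, sg_one, neg_one_smul]

theorem mul_comm_sg {ε δ : ZMod 2} {x y : Gr b} (hx : x ∈ grPart b ε) (hy : y ∈ grPart b δ) :
    x * y = sg (ε * δ) • (y * x) := by
  rcases zmod_two_cases ε with rfl | rfl
  · rw [zero_mul, sg_zero, one_smul, even_mul_comm hx]
  · rw [one_mul, odd_mul_eq hx]
    rw [show CliffordAlgebra.involute y = sg δ • y from grInv_eq_sg hy, smul_mul_assoc]

theorem sgn_eq_sg {a b' : Type} (A : a ⊕ b') {ε : ZMod 2} {x : Gr b} (hx : x ∈ grPart b ε) :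
    sgn A x = sg (par A * ε) • x := by
  rcases A with s | m
  · rw [show par (Sum.inl s : a ⊕ b') = 0 from rfl, zero_mul, sg_zero, one_smul]; rfl
  · rw [show par (Sum.inr m : a ⊕ b') = 1 from rfl, one_mul]
    exact grInv_eq_sg hx

end Signs

/-! ### The total spaces of vector bundles -/

section TotalSpace

variable {a b c d : Type} [Fintype a] [DecidableEq a] [Fintype b] [DecidableEq b]
  [Fintype c] [DecidableEq c] [Fintype d] [DecidableEq d]
  {U : Set (a → ℝ)} {f g : SFun a b} {z : a ⊕ d → ℝ}

theorem isSuperMap_baseIdx (hU : IsOpen U) :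
    IsSuperMap (cyl U) U
      (fun A : a ⊕ b => (coord (baseIdx (c := c) (d := d) A) : SFun (a ⊕ d) (b ⊕ c))) :=
  isSuperMap_coord_map _ _ (isOpen_cyl hU) hU fun _ hx => hx

theorem liftTot_apply (f : SFun a b) (z : a ⊕ d → ℝ) :
    (liftTot f : SFun (a ⊕ d) (b ⊕ c)) z = grHom (fun m => gen (Sum.inl m)) (f (z ∘ Sum.inl)) :=
  subst_coord_map_apply _ _ f z

theorem liftTot_mem {ε : ZMod 2} (h : f (z ∘ Sum.inl) ∈ grPart b ε) :
    (liftTot f : SFun (a ⊕ d) (b ⊕ c)) z ∈ grPart (b ⊕ c) ε := by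
  rw [liftTot_apply]
  exact grHom_mem (gen_map_odd _) h

theorem liftTot_congr (h : f (z ∘ Sum.inl) = g (z ∘ Sum.inl)) :
    (liftTot f : SFun (a ⊕ d) (b ⊕ c)) z = liftTot g z := by
  rw [liftTot_apply, liftTot_apply, h]

theorem liftTot_sum {ι : Type*} (S : Finset ι) (f : ι → SFun a b) :
    (liftTot (∑ i ∈ S, f i) : SFun (a ⊕ d) (b ⊕ c)) = ∑ i ∈ S, liftTot (f i) := funext fun z => by
  rw [liftTot_apply, Finset.sum_apply, map_sum, Finset.sum_apply]
  simp only [liftTot_apply]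

theorem liftTot_mul (f g : SFun a b) :
    (liftTot (f * g) : SFun (a ⊕ d) (b ⊕ c)) = liftTot f * liftTot g := funext fun z => by
  rw [liftTot_apply, Pi.mul_apply, map_mul, Pi.mul_apply, liftTot_apply, liftTot_apply]

theorem liftTot_coord (A : a ⊕ b) :
    (liftTot (coord A) : SFun (a ⊕ d) (b ⊕ c)) = coord (baseIdx A) := by
  funext z
  exact subst_coord (isSuperMap_baseIdx isOpen_univ) (Set.mem_univ _) A

theorem contDiffOn_liftTot (hU : IsOpen U) (hf : ContDiffOn ℝ ∞ f U) :
    ContDiffOn ℝ ∞ (liftTot f : SFun (a ⊕ d) (b ⊕ c)) (cyl U) :=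
  contDiffOn_subst (isSuperMap_baseIdx hU) hf

theorem baseIdx_injective :
    Function.Injective (baseIdx : a ⊕ b → (a ⊕ d) ⊕ (b ⊕ c)) := by
  rintro (s | m) (s' | m') h <;> simp_all [baseIdx]

theorem fibIdx_injective :
    Function.Injective (fibIdx : c ⊕ d → (a ⊕ d) ⊕ (b ⊕ c)) := by
  rintro (s | m) (s' | m') h <;> simp_all [fibIdx]

theorem baseIdx_ne_fibIdx (A : a ⊕ b) (α : c ⊕ d) :
    (baseIdx A : (a ⊕ d) ⊕ (b ⊕ c)) ≠ fibIdx α := by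
  rcases A with s | m <;> rcases α with s' | m' <;> simp [baseIdx, fibIdx]

theorem par_baseIdx (A : a ⊕ b) : par (baseIdx A : (a ⊕ d) ⊕ (b ⊕ c)) = par A := by
  rcases A with s | m <;> rfl

theorem par_fibIdx (α : c ⊕ d) : par (fibIdx α : (a ⊕ d) ⊕ (b ⊕ c)) = par α + 1 := by
  rcases α with s | m <;> rfl

theorem forall_totIdx {P : (a ⊕ d) ⊕ (b ⊕ c) → Prop} (hb : ∀ A, P (baseIdx A))
    (hf : ∀ α, P (fibIdx α)) (C : (a ⊕ d) ⊕ (b ⊕ c)) : P C := by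
  rcases C with (s | s) | (m | m)
  · exact hb (Sum.inl s)
  · exact hf (Sum.inr s)
  · exact hb (Sum.inr m)
  · exact hf (Sum.inl m)

theorem sum_totIdx {M : Type*} [AddCommMonoid M] (h : (a ⊕ d) ⊕ (b ⊕ c) → M) :
    ∑ C, h C = ∑ A, h (baseIdx A) + ∑ α, h (fibIdx α) := by
  simp only [Fintype.sum_sum_type, baseIdx, fibIdx, Sum.map_inl, Sum.map_inr]
  abel

theorem pd_baseIdx_liftTot (hU : IsOpen U) (hf : ContDiffOn ℝ ∞ f U) (hz : z ∈ cyl U) (A : a ⊕ b) :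
    pd (baseIdx A) (liftTot f : SFun (a ⊕ d) (b ⊕ c)) z = liftTot (pd A f) z := by
  rw [liftTot, pd_subst (isSuperMap_baseIdx hU) hz _ hf, Finset.sum_eq_single A]
  · rw [pd_coord, if_pos rfl, one_mul]; rfl
  · intro B _ hB
    rw [pd_coord, if_neg fun h => hB (baseIdx_injective h).symm, zero_mul]
  · simp

theorem pd_fibIdx_liftTot (hU : IsOpen U) (hf : ContDiffOn ℝ ∞ f U) (hz : z ∈ cyl U) (α : c ⊕ d) :
    pd (fibIdx α) (liftTot f : SFun (a ⊕ d) (b ⊕ c)) z = 0 := by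
  rw [liftTot, pd_subst (isSuperMap_baseIdx hU) hz _ hf]
  refine Finset.sum_eq_zero fun B _ => ?_
  rw [pd_coord, if_neg (baseIdx_ne_fibIdx B α).symm, zero_mul]

theorem body_liftTot (f : SFun a b) (z : a ⊕ d → ℝ) :
    body ((liftTot f : SFun (a ⊕ d) (b ⊕ c)) z) = body (f (z ∘ Sum.inl)) := by
  rw [liftTot_apply, body_grHom (gen_map_odd _)]

theorem SuperAtlas.IsSupermanifold.isGlued {M : SuperAtlas.{u} a b} (hM : M.IsSupermanifold) :
    M.IsGlued where
  isOpen_dom := hM.isOpen_dom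
  ovl_subset := hM.ovl_subset
  isSuperMap i j := ⟨hM.isOpen_ovl i j, hM.isOpen_ovl j i, hM.smooth i j, hM.parity i j,
    hM.mapsTo i j⟩
  inv i j A x hx := by
    rw [← (hM.cocycle i j i x hx (hM.mapsTo i j hx)).2 A]
    exact hM.tr_self i A x (hM.ovl_subset i j hx)

variable {M : SuperAtlas.{u} a b} {E : SuperBundle M c d} {i j : M.Idx}

/-- The inverse of the transition matrix of a vector bundle, as the transition matrix in the
opposite direction written in the coordinates of the old chart. -/
def SuperBundle.invT (E : SuperBundle M c d) (i j : M.Idx) (β α : c ⊕ d) : SFun a b :=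
  subst (M.tr i j) (E.T j i β α)

section

variable (hM : M.IsSupermanifold) (hE : E.IsVectorBundle)
include hM hE

theorem SuperBundle.IsVectorBundle.contDiffOn_invT (β α : c ⊕ d) :
    ContDiffOn ℝ ∞ (E.invT i j β α) (M.ovl i j) :=
  contDiffOn_subst (hM.isGlued.isSuperMap i j) (hE.smooth j i β α)

theorem SuperBundle.IsVectorBundle.parityOn_invT (β α : c ⊕ d) :
    ParityOn (M.ovl i j) (par β + par α) (E.invT i j β α) :=
  parityOn_subst (hM.isGlued.isSuperMap i j) (hE.smooth j i β α) (hE.parity j i β α)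

theorem SuperBundle.IsVectorBundle.T_mul_invT {x : a → ℝ} (hx : x ∈ M.ovl i j) (β α : c ⊕ d) :
    ∑ γ, E.T i j β γ x * E.invT i j γ α x = if β = α then 1 else 0 := by
  rw [← hE.T_self i β α x (hM.ovl_subset i j hx)]
  exact (hE.cocycle i j i β α x hx (hM.mapsTo i j hx)).symm

/-- The inverse transition matrix, written in the new coordinates and pulled back to the old ones,
is the transition matrix: both are inverse to the same matrix. -/
theorem SuperBundle.IsVectorBundle.subst_invT {x : a → ℝ} (hx : x ∈ M.ovl i j) (β α : c ⊕ d) :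
    subst (M.tr i j) (E.invT j i β α) x = E.T i j β α x := by
  have h := hM.isGlued.isSuperMap i j
  have h1 : ∀ β α, ∑ γ, E.invT i j β γ x * subst (M.tr i j) (E.invT j i γ α) x =
      if β = α then 1 else 0 := fun β α => by
    have h2 := subst_congr h hx (f := ∑ γ, E.T j i β γ * E.invT j i γ α)
      (g := fun _ => algebraMap ℝ (Gr b) (if β = α then 1 else 0))
      (contDiffOn_sum _ fun γ _ => contDiffOn_mul (hE.smooth j i β γ) (hE.contDiffOn_invT hM γ α))
      fun y hy => by
        rw [Finset.sum_apply]
        refine (hE.T_mul_invT hM hy β α).trans ?_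
        split_ifs <;> simp
    rw [subst_const h hx, subst_sum h hx _ fun γ _ =>
      contDiffOn_mul (hE.smooth j i β γ) (hE.contDiffOn_invT hM γ α)] at h2
    simp only [subst_mul h hx (hE.smooth j i β _) (hE.contDiffOn_invT hM _ α)] at h2
    refine h2.trans ?_
    split_ifs <;> simp
  have h3 : subst (M.tr i j) (E.invT j i β α) x = ∑ δ, (∑ γ, E.T i j β γ x * E.invT i j γ δ x) *
      subst (M.tr i j) (E.invT j i δ α) x := by
    simp only [hE.T_mul_invT hM hx, ite_mul, one_mul, zero_mul]
    rw [Finset.sum_ite_eq]; simp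
  rw [h3]
  simp only [Finset.sum_mul, mul_assoc]
  rw [Finset.sum_comm]
  simp only [← Finset.mul_sum, h1]
  exact sum_mul_delta _ _

end

theorem piTot_tr_baseIdx (E : SuperBundle M c d) (i j : M.Idx) (A : a ⊕ b) :
    E.PiTot.tr i j (baseIdx A) = liftTot (M.tr i j A) := by rcases A with s | m <;> rfl

theorem piTot_tr_fibIdx (E : SuperBundle M c d) (i j : M.Idx) (α : c ⊕ d) :
    E.PiTot.tr i j (fibIdx α) = ∑ β, coord (fibIdx β) * liftTot (E.T i j β α) := by
  rcases α with s | m <;> rfl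

theorem piDualTot_tr_baseIdx (E : SuperBundle M c d) (i j : M.Idx) (A : a ⊕ b) :
    E.PiDualTot.tr i j (baseIdx A) = liftTot (M.tr i j A) := by rcases A with s | m <;> rfl

theorem piDualTot_tr_fibIdx (E : SuperBundle M c d) (i j : M.Idx) (α : c ⊕ d) :
    E.PiDualTot.tr i j (fibIdx α) = ∑ β, liftTot (E.invT i j α β) * coord (fibIdx β) := by
  rcases α with s | m <;> rfl

theorem parityOn_sum {V : Set (a → ℝ)} {ι : Type*} (S : Finset ι) {f : ι → SFun a b} {ε : ZMod 2}
    (h : ∀ i ∈ S, ParityOn V ε (f i)) : ParityOn V ε (∑ i ∈ S, f i) := fun x hx => by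
  rw [Finset.sum_apply]
  exact Submodule.sum_mem _ fun i hi => h i hi x hx

section

variable (hM : M.IsSupermanifold) (hE : E.IsVectorBundle)
include hM hE

theorem isSuperMap_piTot_tr (i j : M.Idx) :
    IsSuperMap (E.PiTot.ovl i j) (E.PiTot.ovl j i) (E.PiTot.tr i j) := by
  have h := hM.isGlued.isSuperMap i j
  refine ⟨isOpen_cyl h.isOpen_source, isOpen_cyl h.isOpen_target, ?_, ?_, ?_⟩
  · refine forall_totIdx (fun A => ?_) fun α => ?_
    · rw [piTot_tr_baseIdx]; exact contDiffOn_liftTot h.isOpen_source (h.smooth A)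
    · rw [piTot_tr_fibIdx]
      exact contDiffOn_sum _ fun β _ => contDiffOn_mul (contDiff_coord _).contDiffOn
        (contDiffOn_liftTot h.isOpen_source (hE.smooth i j β α))
  · refine forall_totIdx (fun A => ?_) fun α => ?_
    · rw [piTot_tr_baseIdx, par_baseIdx]
      exact fun z hz => liftTot_mem (h.parity A _ hz)
    · rw [piTot_tr_fibIdx, par_fibIdx]
      refine parityOn_sum _ fun β _ z hz => ?_
      have := mul_mem_grPart (coord_mem (fibIdx β : (a ⊕ d) ⊕ (b ⊕ c)) z)
        (liftTot_mem (c := c) (hE.parity i j β α _ hz))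
      rwa [par_fibIdx, show ∀ β α : ZMod 2, β + 1 + (β + α) = α + 1 by decide] at this
  · intro z hz
    change (bodyMap (E.PiTot.tr i j) z) ∘ Sum.inl ∈ M.ovl j i
    rw [show (bodyMap (E.PiTot.tr i j) z) ∘ Sum.inl = bodyMap (M.tr i j) (z ∘ Sum.inl) from
      funext fun s => body_liftTot _ _]
    exact h.mapsTo hz

theorem isSuperMap_piDualTot_tr (i j : M.Idx) :
    IsSuperMap (E.PiDualTot.ovl i j) (E.PiDualTot.ovl j i) (E.PiDualTot.tr i j) := by
  have h := hM.isGlued.isSuperMap i j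
  refine ⟨isOpen_cyl h.isOpen_source, isOpen_cyl h.isOpen_target, ?_, ?_, ?_⟩
  · refine forall_totIdx (fun A => ?_) fun α => ?_
    · rw [piDualTot_tr_baseIdx]; exact contDiffOn_liftTot h.isOpen_source (h.smooth A)
    · rw [piDualTot_tr_fibIdx]
      exact contDiffOn_sum _ fun β _ => contDiffOn_mul
        (contDiffOn_liftTot h.isOpen_source (hE.contDiffOn_invT hM α β))
        (contDiff_coord _).contDiffOn
  · refine forall_totIdx (fun A => ?_) fun α => ?_
    · rw [piDualTot_tr_baseIdx, par_baseIdx]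
      exact fun z hz => liftTot_mem (h.parity A _ hz)
    · rw [piDualTot_tr_fibIdx, par_fibIdx]
      refine parityOn_sum _ fun β _ z hz => ?_
      have := mul_mem_grPart (liftTot_mem (c := c) (hE.parityOn_invT hM α β _ hz))
        (coord_mem (fibIdx β : (a ⊕ d) ⊕ (b ⊕ c)) z)
      rwa [par_fibIdx, show ∀ β α : ZMod 2, α + β + (β + 1) = α + 1 by decide] at this
  · intro z hz
    change (bodyMap (E.PiDualTot.tr i j) z) ∘ Sum.inl ∈ M.ovl j i
    rw [show (bodyMap (E.PiDualTot.tr i j) z) ∘ Sum.inl = bodyMap (M.tr i j) (z ∘ Sum.inl) from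
      funext fun s => body_liftTot _ _]
    exact h.mapsTo hz

omit hE in
/-- Functions on the base are pulled back along a bundle map as on the base. -/
theorem subst_liftTot {φ : (a ⊕ d) ⊕ (b ⊕ c) → SFun (a ⊕ d) (b ⊕ c)}
    (hφ : IsSuperMap (cyl (M.ovl i j)) (cyl (M.ovl j i)) φ)
    (hb : ∀ A, φ (baseIdx A) = liftTot (M.tr i j A)) (hz : z ∈ cyl (M.ovl i j))
    (hf : ContDiffOn ℝ ∞ f (M.ovl j i)) :
    subst φ (liftTot f) z = liftTot (subst (M.tr i j) f) z := by
  have h := hM.isGlued.isSuperMap i j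
  have h1 := subst_subst_coord_map hφ (σ := Sum.inl) (τ := Sum.inl)
    h.isOpen_target (fun z hz => hz) hz hf
  have h2 := subst_subst_of_soul_eq_zero (isSuperMap_baseIdx (c := c) h.isOpen_source)
    (fun z _ => soul_coord_map Sum.inl Sum.inl z) h hz hf
  exact (h1.trans (subst_congr_left (fun A => congrFun (hb A) z) f)).trans h2.symm

theorem subst_piTot_tr_liftTot (hz : z ∈ E.PiTot.ovl i j) (hf : ContDiffOn ℝ ∞ f (M.ovl j i)) :
    subst (E.PiTot.tr i j) (liftTot f) z = liftTot (subst (M.tr i j) f) z :=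
  subst_liftTot hM (isSuperMap_piTot_tr hM hE i j) (piTot_tr_baseIdx E i j) hz hf

theorem subst_piDualTot_tr_liftTot (hz : z ∈ E.PiDualTot.ovl i j)
    (hf : ContDiffOn ℝ ∞ f (M.ovl j i)) :
    subst (E.PiDualTot.tr i j) (liftTot f) z = liftTot (subst (M.tr i j) f) z :=
  subst_liftTot hM (isSuperMap_piDualTot_tr hM hE i j) (piDualTot_tr_baseIdx E i j) hz hf

omit hM hE in
theorem liftTot_delta (α β : c ⊕ d) (h : f (z ∘ Sum.inl) = if α = β then 1 else 0) :
    (liftTot f : SFun (a ⊕ d) (b ⊕ c)) z = if α = β then 1 else 0 := by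
  rw [liftTot_apply, h]
  split_ifs <;> simp only [map_one, map_zero]

theorem isGlued_piTot : E.PiTot.IsGlued where
  isOpen_dom i := isOpen_cyl (hM.isOpen_dom i)
  ovl_subset i j _ hz := hM.ovl_subset i j hz
  isSuperMap := isSuperMap_piTot_tr hM hE
  inv := fun (i j : M.Idx) => by
    have h := isSuperMap_piTot_tr hM hE i j
    refine forall_totIdx (fun A z hz => ?_) fun α z hz => ?_
    · rw [piTot_tr_baseIdx, subst_piTot_tr_liftTot hM hE hz
        ((hM.isGlued.isSuperMap j i).smooth A), ← liftTot_coord]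
      exact liftTot_congr (hM.isGlued.inv i j A _ hz)
    · have hs : ∀ β, ContDiffOn ℝ ∞ (liftTot (E.T j i β α) : SFun (a ⊕ d) (b ⊕ c))
          (E.PiTot.ovl j i) := fun β => contDiffOn_liftTot (hM.isOpen_ovl j i) (hE.smooth j i β α)
      rw [piTot_tr_fibIdx, subst_sum h hz _ fun β _ =>
        contDiffOn_mul (contDiff_coord _).contDiffOn (hs β)]
      simp only [subst_mul h hz (contDiff_coord _).contDiffOn (hs _), subst_coord h hz,
        subst_piTot_tr_liftTot hM hE hz (hE.smooth j i _ α), piTot_tr_fibIdx, Finset.sum_apply,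
        Finset.sum_mul, Pi.mul_apply, mul_assoc]
      rw [Finset.sum_comm]
      have h1 : ∀ γ, ∑ β, (liftTot (E.T i j γ β) : SFun (a ⊕ d) (b ⊕ c)) z *
          liftTot (subst (M.tr i j) (E.T j i β α)) z = if γ = α then 1 else 0 := fun γ => by
        have := liftTot_delta (c := c) (z := z) (f := ∑ β, E.T i j γ β * E.invT i j β α) γ α (by
          rw [Finset.sum_apply]; exact hE.T_mul_invT hM hz γ α)
        rw [liftTot_sum, Finset.sum_apply] at this
        simp only [liftTot_mul, Pi.mul_apply] at this
        exact this
      simp only [← Finset.mul_sum, h1]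
      exact sum_mul_delta (fun γ => (coord (fibIdx γ) : SFun (a ⊕ d) (b ⊕ c)) z) α

theorem isGlued_piDualTot : E.PiDualTot.IsGlued where
  isOpen_dom i := isOpen_cyl (hM.isOpen_dom i)
  ovl_subset i j _ hz := hM.ovl_subset i j hz
  isSuperMap := isSuperMap_piDualTot_tr hM hE
  inv := fun (i j : M.Idx) => by
    have h := isSuperMap_piDualTot_tr hM hE i j
    refine forall_totIdx (fun A z hz => ?_) fun α z hz => ?_
    · rw [piDualTot_tr_baseIdx, subst_piDualTot_tr_liftTot hM hE hz
        ((hM.isGlued.isSuperMap j i).smooth A), ← liftTot_coord]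
      exact liftTot_congr (hM.isGlued.inv i j A _ hz)
    · have hi : ∀ β, ContDiffOn ℝ ∞ (E.invT j i α β) (M.ovl j i) := hE.contDiffOn_invT hM α
      have hs : ∀ β, ContDiffOn ℝ ∞ (liftTot (E.invT j i α β) : SFun (a ⊕ d) (b ⊕ c))
          (E.PiDualTot.ovl j i) := fun β => contDiffOn_liftTot (hM.isOpen_ovl j i) (hi β)
      rw [piDualTot_tr_fibIdx, subst_sum h hz _ fun β _ =>
        contDiffOn_mul (hs β) (contDiff_coord _).contDiffOn]
      have h2 : ∀ β, (liftTot (subst (M.tr i j) (E.invT j i α β)) : SFun (a ⊕ d) (b ⊕ c)) z =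
          liftTot (E.T i j α β) z := fun β => liftTot_congr (hE.subst_invT hM hz α β)
      simp only [subst_mul h hz (hs _) (contDiff_coord _).contDiffOn, subst_coord h hz,
        subst_piDualTot_tr_liftTot hM hE hz (hi _), h2, piDualTot_tr_fibIdx, Finset.sum_apply,
        Finset.mul_sum, Pi.mul_apply, ← mul_assoc]
      rw [Finset.sum_comm]
      have h1 : ∀ γ, ∑ β, (liftTot (E.T i j α β) : SFun (a ⊕ d) (b ⊕ c)) z *
          liftTot (E.invT i j β γ) z = if α = γ then 1 else 0 := fun γ => by
        have := liftTot_delta (c := c) (z := z) (f := ∑ β, E.T i j α β * E.invT i j β γ) α γ (by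
          rw [Finset.sum_apply]; exact hE.T_mul_invT hM hz α γ)
        rw [liftTot_sum, Finset.sum_apply] at this
        simp only [liftTot_mul, Pi.mul_apply] at this
        exact this
      simp only [← Finset.sum_mul, h1, ite_mul, one_mul, zero_mul]
      rw [Finset.sum_ite_eq]; simp

end

end TotalSpace

/-! ### Weights of functions, vector fields and symbols -/

section Weights

variable {a b : Type} [Fintype a] [DecidableEq a] [Fintype b] [DecidableEq b]
  {U : Set (a → ℝ)} {f : SFun a b} {X : a ⊕ b → SFun a b} {z : a ⊕ a → ℝ}

theorem act_apply (X : a ⊕ b → SFun a b) (f : SFun a b) (x : a → ℝ) :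
    act X f x = ∑ A, X A x * pd A f x := by
  rw [act, Finset.sum_apply]; rfl

theorem contDiffOn_act (hU : IsOpen U) (hX : ∀ A, ContDiffOn ℝ ∞ (X A) U)
    (hf : ContDiffOn ℝ ∞ f U) : ContDiffOn ℝ ∞ (act X f) U :=
  contDiffOn_sum _ fun A _ => contDiffOn_mul (hX A) (contDiffOn_pd A hU hf)

theorem contDiffOn_euler (w : a ⊕ b → ℤ) (A : a ⊕ b) : ContDiffOn ℝ ∞ (euler w A) U :=
  contDiffOn_smul _ (contDiff_coord A).contDiffOn

theorem contDiffOn_lieBr {Y : a ⊕ b → SFun a b} (hU : IsOpen U) (hX : ∀ A, ContDiffOn ℝ ∞ (X A) U)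
    (hY : ∀ A, ContDiffOn ℝ ∞ (Y A) U) (ε δ : ZMod 2) (A : a ⊕ b) :
    ContDiffOn ℝ ∞ (lieBr ε δ X Y A) U :=
  (contDiffOn_act hU hX (hY A)).sub (contDiffOn_smul _ (contDiffOn_act hU hY (hX A)))

theorem act_euler_cotWt (w : a ⊕ b → ℤ) (F : SFun (a ⊕ a) (b ⊕ b)) (z : a ⊕ a → ℝ) :
    act (euler (cotWt w)) F z =
      ∑ A, (w A : ℝ) • ((coord (qIdx A) : SFun (a ⊕ a) (b ⊕ b)) z * pd (qIdx A) F z) -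
      ∑ A, (w A : ℝ) • ((coord (pIdx A) : SFun (a ⊕ a) (b ⊕ b)) z * pd (pIdx A) F z) := by
  have h0 : ∀ A : a ⊕ b, cotWt w (qIdx A) = w A := by rintro (s | m) <;> rfl
  have h1 : ∀ A : a ⊕ b, cotWt w (pIdx A) = - w A := by rintro (s | m) <;> rfl
  rw [act_euler, sum_cotIdx, sub_eq_add_neg, ← Finset.sum_neg_distrib]
  simp only [h0, h1, Int.cast_neg, neg_smul]

theorem act_cotWt_liftCot (hU : IsOpen U) (hf : ContDiffOn ℝ ∞ f U) (hz : z ∈ cyl U)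
    (w : a ⊕ b → ℤ) : act (euler (cotWt w)) (liftCot f) z = liftCot (act (euler w) f) z := by
  rw [act_euler_cotWt, act, liftCot_sum, Finset.sum_apply,
    Finset.sum_eq_zero (f := fun A => (w A : ℝ) • (_ * pd (pIdx A) (liftCot f) z)) fun A _ => by
      rw [pd_pIdx_liftCot hU hf hz, mul_zero, smul_zero], sub_zero]
  refine Finset.sum_congr rfl fun A _ => ?_
  rw [liftCot_mul, Pi.mul_apply, euler, liftCot_smul, liftCot_coord, pd_qIdx_liftCot hU hf hz,
    Pi.smul_apply, smul_mul_assoc]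

theorem coord_mul_pd_pIdx_sym (hU : IsOpen U) (hX : ∀ A, ContDiffOn ℝ ∞ (X A) U)
    (ho : ∀ A, ParityOn U (par A + 1) (X A)) (hz : z ∈ cyl U) (A : a ⊕ b) :
    (coord (pIdx A) : SFun (a ⊕ a) (b ⊕ b)) z * pd (pIdx A) (sym X) z =
      liftCot (X A) z * (coord (pIdx A) : SFun (a ⊕ a) (b ⊕ b)) z := by
  have h := liftCot_mem (ho A _ hz)
  rw [pd_pIdx_sym hU hX hz]
  rcases A with s | m
  · exact coord_mul_comm h
  · rw [show par (Sum.inr m : a ⊕ b) + 1 = 0 from rfl] at h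
    rw [sgn_even _ h, even_mul_comm h]

theorem momDeg_sym (hU : IsOpen U) (hX : ∀ A, ContDiffOn ℝ ∞ (X A) U)
    (ho : ∀ A, ParityOn U (par A + 1) (X A)) : FunWeightOn (cyl U) momDeg 1 (sym X) := by
  intro z hz
  rw [act_euler_momDeg, Int.cast_one, one_smul, sym_apply]
  exact Finset.sum_congr rfl fun A _ => coord_mul_pd_pIdx_sym hU hX ho hz A

theorem lieBr_euler (w : a ⊕ b → ℤ) (A : a ⊕ b) (x : a → ℝ) :
    lieBr 0 1 (euler w) X A x = act (euler w) (X A) x - (w A : ℝ) • X A x := by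
  have h : act X (euler w A) x = (w A : ℝ) • X A x := by
    rw [act_apply, Finset.sum_eq_single A]
    · rw [euler, pd_const_smul _ _ (differentiableAt_coord _ _), pd_coord, if_pos rfl,
        mul_smul_comm, mul_one]
    · intro B _ hB
      rw [euler, pd_const_smul _ _ (differentiableAt_coord _ _), pd_coord, if_neg hB, smul_zero,
        mul_zero]
    · simp
  rw [lieBr, if_neg (by decide), one_smul, Pi.sub_apply, h]

/-- The Euler field of the cotangent bundle acts on symbols as the commutator with the Euler field
of the base acts on vector fields. -/
theorem act_cotWt_sym (hU : IsOpen U) (hX : ∀ A, ContDiffOn ℝ ∞ (X A) U)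
    (ho : ∀ A, ParityOn U (par A + 1) (X A)) (hz : z ∈ cyl U) (w : a ⊕ b → ℤ) :
    act (euler (cotWt w)) (sym X) z = sym (lieBr 0 1 (euler w) X) z := by
  rw [act_euler_cotWt, sym_apply]
  simp only [coord_mul_pd_pIdx_sym hU hX ho hz, pd_qIdx_sym hU hX hz]
  have h : ∀ A, liftCot (lieBr 0 1 (euler w) X A) z =
      ∑ B, (w B : ℝ) • ((coord (qIdx B) : SFun (a ⊕ a) (b ⊕ b)) z * liftCot (pd B (X A)) z) -
        (w A : ℝ) • liftCot (X A) z := fun A => by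
    rw [show lieBr 0 1 (euler w) X A = act (euler w) (X A) + (-(w A : ℝ)) • X A from
      funext fun x => by
        rw [lieBr_euler, Pi.add_apply, Pi.smul_apply, neg_smul, sub_eq_add_neg],
      liftCot_add, liftCot_smul, Pi.add_apply, Pi.smul_apply, neg_smul, ← sub_eq_add_neg, act,
      liftCot_sum, Finset.sum_apply]
    congr 1
    refine Finset.sum_congr rfl fun B _ => ?_
    rw [liftCot_mul, Pi.mul_apply, euler, liftCot_smul, liftCot_coord, Pi.smul_apply,
      smul_mul_assoc]
  simp only [h, sub_mul, Finset.sum_sub_distrib, smul_mul_assoc, sym_apply, Finset.sum_mul,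
    Finset.mul_sum, Finset.smul_sum, mul_assoc]
  rw [Finset.sum_comm]

theorem vectWeightOn_iff (hU : IsOpen U) (hX : ∀ A, ContDiffOn ℝ ∞ (X A) U)
    (ho : ∀ A, ParityOn U (par A + 1) (X A)) (w : a ⊕ b → ℤ) (r : ℤ) :
    VectWeightOn U w r 1 X ↔ FunWeightOn (cyl U) (cotWt w) r (sym X) := by
  have hs : ∀ z, sym (fun A => (r : ℝ) • X A) z = (r : ℝ) • sym X z := fun z => by
    rw [sym_apply, sym_apply, Finset.smul_sum]
    exact Finset.sum_congr rfl fun A _ => by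
      rw [liftCot_smul, Pi.smul_apply, smul_mul_assoc]
  constructor
  · intro h z hz
    rw [act_cotWt_sym hU hX ho hz, ← hs]
    exact sym_congr fun A => h A _ hz
  · intro h A x hx
    refine sym_injOn hU (contDiffOn_lieBr hU (contDiffOn_euler w) hX 0 1)
      (fun A => contDiffOn_smul (r : ℝ) (hX A)) (fun z hz => ?_) A hx
    rw [hs, ← h z hz, act_cotWt_sym hU hX ho hz]

theorem funWeightOn_iff (hU : IsOpen U) (hf : ContDiffOn ℝ ∞ f U) (w : a ⊕ b → ℤ) (r : ℤ) :
    FunWeightOn U w r f ↔ FunWeightOn (cyl U) (cotWt w) r (liftCot f) := by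
  constructor
  · intro h z hz
    rw [act_cotWt_liftCot hU hf hz, ← Pi.smul_apply, ← liftCot_smul]
    exact liftCot_congr (h _ hz)
  · intro h x hx
    refine liftCot_injOn (g := (r : ℝ) • f) fun z hz => ?_
    have hz' : z ∈ cyl U := show z ∘ Sum.inl ∈ U from hz ▸ hx
    rw [← act_cotWt_liftCot hU hf hz', h z hz', liftCot_smul, Pi.smul_apply]

end Weights

/-! ### Poisson brackets of symbols -/

section Poisson

variable {a b : Type} [Fintype a] [DecidableEq a] [Fintype b] [DecidableEq b]

/-- The Poisson bracket with an odd function. -/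
theorem poisson_of_odd {V : Set (a ⊕ a → ℝ)} (hV : IsOpen V) {F G : SFun (a ⊕ a) (b ⊕ b)}
    (ho : ParityOn V 1 F) {z : a ⊕ a → ℝ} (hz : z ∈ V) (hF : ContDiffOn ℝ ∞ F V) :
    poisson F G z = ∑ A : a ⊕ b, (pd (pIdx A) F z * pd (qIdx A) G z -
      sg (par A) • (pd (qIdx A) F z * pd (pIdx A) G z)) := by
  have hi : ∀ C, pd C (invol F) z = - pd C F z := fun C => by
    rw [pd_congr_of_isOpen C hV hz (g := (-1 : ℝ) • F) fun y hy => by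
      rw [Pi.smul_apply, neg_one_smul]; exact grInv_odd (ho y hy),
      pd_const_smul _ _ (ContDiffOn.differentiableAt_of_isOpen hV hF hz), neg_one_smul]
  rw [Fintype.sum_sum_type, poisson, Pi.add_apply, Finset.sum_apply, Finset.sum_apply]
  congr 1
  · refine Finset.sum_congr rfl fun s _ => ?_
    rw [show par (Sum.inl s : a ⊕ b) = 0 from rfl, sg_zero, one_smul]; rfl
  · refine Finset.sum_congr rfl fun m _ => ?_
    rw [show par (Sum.inr m : a ⊕ b) = 1 from rfl, sg_one]
    change -(pd _ (invol F) z * _) - pd _ (invol F) z * _ = _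
    rw [hi, hi, neg_one_smul, neg_mul, neg_mul, neg_neg]

variable {U : Set (a → ℝ)} {f : SFun a b} {X : a ⊕ b → SFun a b} {z : a ⊕ a → ℝ}

/-- An anticommuting pair in which the parities of the factors are both opposite to that of a
coordinate. -/
theorem neg_sg_smul_mul {ε : ZMod 2} {x y : Gr b} (hx : x ∈ grPart b (ε + 1))
    (hy : y ∈ grPart b (ε + 1)) : - (sg ε • (x * y)) = y * x := by
  rw [mul_comm_sg hx hy, smul_smul, ← sg_add, ← neg_smul]
  rcases zmod_two_cases ε with rfl | rfl
  · rw [show (0 : ZMod 2) + (0 + 1) * (0 + 1) = 1 from rfl, sg_one, neg_neg, one_smul]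
  · rw [show (1 : ZMod 2) + (1 + 1) * (1 + 1) = 1 from rfl, sg_one, neg_neg, one_smul]

/-- The Poisson bracket of the symbols of odd vector fields is the symbol of their commutator. -/
theorem poisson_sym_sym (hU : IsOpen U) (hX : ∀ A, ContDiffOn ℝ ∞ (X A) U)
    (ho : ∀ A, ParityOn U (par A + 1) (X A)) (hz : z ∈ cyl U) :
    poisson (sym X) (sym X) z = sym (lieBr 1 1 X X) z := by
  rw [poisson_of_odd (isOpen_cyl hU) (parityOn_sym ho) hz (contDiffOn_sym hU hX)]
  have h : ∀ A, pd (pIdx A) (sym X) z * pd (qIdx A) (sym X) z -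
      sg (par A) • (pd (qIdx A) (sym X) z * pd (pIdx A) (sym X) z) =
      (2 : ℝ) • ∑ B, liftCot (X A) z * liftCot (pd A (X B)) z *
        (coord (pIdx B) : SFun (a ⊕ a) (b ⊕ b)) z := fun A => by
    have h1 := liftCot_mem (ho A _ hz)
    have h2 : pd (qIdx A) (sym X) z ∈ grPart (b ⊕ b) (par A + 1) := by
      have := pd_mem (qIdx A) (isOpen_cyl hU) (contDiffOn_sym hU hX) (parityOn_sym ho) z hz
      rwa [par_qIdx, add_comm] at this
    have h3 : pd (pIdx A) (sym X) z = liftCot (X A) z := by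
      rw [pd_pIdx_sym hU hX hz, sgn_eq_sg A h1,
        show ∀ ε : ZMod 2, ε * (ε + 1) = 0 by decide, sg_zero, one_smul]
    rw [h3, sub_eq_add_neg, neg_sg_smul_mul h2 h1, ← two_smul ℝ, pd_qIdx_sym hU hX hz, sym_apply,
      Finset.mul_sum]
    simp only [mul_assoc]
  simp only [h]
  rw [← Finset.smul_sum, Finset.sum_comm, sym_apply, Finset.smul_sum]
  refine Finset.sum_congr rfl fun B _ => ?_
  rw [show lieBr 1 1 X X B = (2 : ℝ) • act X (X B) by
    rw [lieBr, if_pos (by decide), neg_one_smul, sub_neg_eq_add, two_smul],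
    liftCot_smul, Pi.smul_apply, smul_mul_assoc, act, liftCot_sum, Finset.sum_apply, Finset.sum_mul]
  simp only [liftCot_mul, Pi.mul_apply]

/-- The Poisson bracket of an odd function with the symbol of an odd vector field `X` is the
derivative of the function along `X`. -/
theorem poisson_liftCot_sym (hU : IsOpen U) (hX : ∀ A, ContDiffOn ℝ ∞ (X A) U)
    (ho : ∀ A, ParityOn U (par A + 1) (X A)) (hf : ContDiffOn ℝ ∞ f U) (hfo : ParityOn U 1 f)
    (hz : z ∈ cyl U) : poisson (liftCot f) (sym X) z = liftCot (act X f) z := by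
  rw [poisson_of_odd (isOpen_cyl hU) (fun y hy => liftCot_mem (hfo _ hy)) hz
    (contDiffOn_liftCot hU hf), act, liftCot_sum, Finset.sum_apply]
  refine Finset.sum_congr rfl fun A _ => ?_
  have h1 := liftCot_mem (ho A _ hz)
  have h2 : liftCot (pd A f) z ∈ grPart (b ⊕ b) (par A + 1) := by
    have := liftCot_mem (pd_mem A hU hf hfo _ hz)
    rwa [add_comm] at this
  rw [pd_pIdx_liftCot hU hf hz, zero_mul, zero_sub, pd_qIdx_liftCot hU hf hz, pd_pIdx_sym hU hX hz,
    sgn_eq_sg A h1, show ∀ ε : ZMod 2, ε * (ε + 1) = 0 by decide, sg_zero, one_smul,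
    neg_sg_smul_mul h2 h1, liftCot_mul, Pi.mul_apply]

theorem poisson_liftCot_liftCot (hU : IsOpen U) (hf : ContDiffOn ℝ ∞ f U) (hfo : ParityOn U 1 f)
    (hz : z ∈ cyl U) : poisson (liftCot f) (liftCot f) z = 0 := by
  rw [poisson_of_odd (isOpen_cyl hU) (fun y hy => liftCot_mem (hfo _ hy)) hz
    (contDiffOn_liftCot hU hf)]
  refine Finset.sum_eq_zero fun A _ => ?_
  rw [pd_pIdx_liftCot hU hf hz, zero_mul, mul_zero, smul_zero, sub_zero]

end Poisson

/-! ### The canonical map between the cotangent bundles -/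

section Swap

variable {a d b c : Type}

/-- The exchange of the fibre coordinates and their momenta. -/
def swapFib : (a ⊕ d) ⊕ (a ⊕ d) → (a ⊕ d) ⊕ (a ⊕ d)
  | Sum.inl (Sum.inl s) => Sum.inl (Sum.inl s)
  | Sum.inl (Sum.inr t) => Sum.inr (Sum.inr t)
  | Sum.inr (Sum.inl s) => Sum.inr (Sum.inl s)
  | Sum.inr (Sum.inr t) => Sum.inl (Sum.inr t)

theorem swapFib_swapFib (s : (a ⊕ d) ⊕ (a ⊕ d)) : swapFib (swapFib s) = s := by
  rcases s with (s | s) | (s | s) <;> rfl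

/-- The exchange of the fibre coordinates and their momenta, for even and odd coordinates. -/
def swapIdx : ((a ⊕ d) ⊕ (a ⊕ d)) ⊕ ((b ⊕ c) ⊕ (b ⊕ c)) →
    ((a ⊕ d) ⊕ (a ⊕ d)) ⊕ ((b ⊕ c) ⊕ (b ⊕ c)) := Sum.map swapFib swapFib

theorem swapIdx_swapIdx (B : ((a ⊕ d) ⊕ (a ⊕ d)) ⊕ ((b ⊕ c) ⊕ (b ⊕ c))) :
    swapIdx (swapIdx B) = B := by
  rcases B with s | s <;> simp [swapIdx, swapFib_swapFib]

theorem swapIdx_injective :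
    Function.Injective (swapIdx : ((a ⊕ d) ⊕ (a ⊕ d)) ⊕ ((b ⊕ c) ⊕ (b ⊕ c)) → _) :=
  Function.Involutive.injective swapIdx_swapIdx

/-- The sign in `R^*ξ^α = (-1)^α̃ π^α`. -/
def swapSign : ((a ⊕ d) ⊕ (a ⊕ d)) ⊕ ((b ⊕ c) ⊕ (b ⊕ c)) → ℝ
  | Sum.inl (Sum.inl (Sum.inr _)) => -1
  | _ => 1

theorem swapSign_mul_self (B : ((a ⊕ d) ⊕ (a ⊕ d)) ⊕ ((b ⊕ c) ⊕ (b ⊕ c))) :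
    swapSign B * swapSign B = 1 := by
  rcases B with ((s | s) | (s | s)) | ((s | s) | (s | s)) <;> simp [swapSign]

theorem swapIdx_qIdx_baseIdx (A : a ⊕ b) : swapIdx (qIdx (baseIdx (c := c) (d := d) A)) =
    qIdx (baseIdx A) := by rcases A with s | m <;> rfl

theorem swapIdx_pIdx_baseIdx (A : a ⊕ b) : swapIdx (pIdx (baseIdx (c := c) (d := d) A)) =
    pIdx (baseIdx A) := by rcases A with s | m <;> rfl

theorem swapIdx_qIdx_fibIdx (α : c ⊕ d) : swapIdx (qIdx (fibIdx (a := a) (b := b) α)) =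
    pIdx (fibIdx α) := by rcases α with s | m <;> rfl

theorem swapIdx_pIdx_fibIdx (α : c ⊕ d) : swapIdx (pIdx (fibIdx (a := a) (b := b) α)) =
    qIdx (fibIdx α) := by rcases α with s | m <;> rfl

theorem swapSign_qIdx_baseIdx (A : a ⊕ b) :
    swapSign (qIdx (baseIdx (c := c) (d := d) A)) = 1 := by rcases A with s | m <;> rfl

theorem swapSign_pIdx_baseIdx (A : a ⊕ b) :
    swapSign (pIdx (baseIdx (c := c) (d := d) A)) = 1 := by rcases A with s | m <;> rfl

theorem swapSign_qIdx_fibIdx (α : c ⊕ d) :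
    swapSign (qIdx (fibIdx (a := a) (b := b) α)) = sg (par α) := by
  rcases α with s | m
  · exact sg_zero.symm
  · exact sg_one.symm

theorem swapSign_pIdx_fibIdx (α : c ⊕ d) :
    swapSign (pIdx (fibIdx (a := a) (b := b) α)) = 1 := by rcases α with s | m <;> rfl

end Swap

section CanonicalMap

variable {a b c d : Type} [Fintype a] [DecidableEq a] [Fintype b] [DecidableEq b]
  [Fintype c] [DecidableEq c] [Fintype d] [DecidableEq d]
  {U : Set (a → ℝ)} {F G : SFun ((a ⊕ d) ⊕ (a ⊕ d)) ((b ⊕ c) ⊕ (b ⊕ c))}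
  {z : (a ⊕ d) ⊕ (a ⊕ d) → ℝ}

/-- The inverse of the canonical map `R`. -/
def Rinv : ((a ⊕ d) ⊕ (a ⊕ d)) ⊕ ((b ⊕ c) ⊕ (b ⊕ c)) →
    SFun ((a ⊕ d) ⊕ (a ⊕ d)) ((b ⊕ c) ⊕ (b ⊕ c)) :=
  relabel (fun B => swapSign (swapIdx B)) swapFib swapFib

theorem Rmap_eq_relabel : (Rmap : ((a ⊕ d) ⊕ (a ⊕ d)) ⊕ ((b ⊕ c) ⊕ (b ⊕ c)) → _) =
    relabel swapSign swapFib swapFib := by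
  funext B
  rcases B with ((s | s) | (s | s)) | ((s | s) | (s | s))
  case inl.inl.inr => exact (neg_one_smul ℝ _).symm
  all_goals exact (one_smul ℝ _).symm

theorem Rmap_apply (B : ((a ⊕ d) ⊕ (a ⊕ d)) ⊕ ((b ⊕ c) ⊕ (b ⊕ c))) :
    Rmap B = swapSign B • coord (swapIdx B) := by rw [Rmap_eq_relabel]; rfl

/-- Relabellings that exchange the fibre coordinates and their momenta, up to constant factors. -/
theorem isSuperMap_relabel_swapFib (hU : IsOpen U)
    {ε : ((a ⊕ d) ⊕ (a ⊕ d)) ⊕ ((b ⊕ c) ⊕ (b ⊕ c)) → ℝ}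
    (hε : ∀ s, ε (Sum.inl (Sum.inl (Sum.inl s))) = 1) :
    IsSuperMap (cyl (cyl U)) (cyl (cyl U)) (relabel ε swapFib swapFib :
      ((a ⊕ d) ⊕ (a ⊕ d)) ⊕ ((b ⊕ c) ⊕ (b ⊕ c)) → SFun ((a ⊕ d) ⊕ (a ⊕ d)) _) := by
  refine isSuperMap_relabel _ _ _ (isOpen_cyl (isOpen_cyl hU)) (isOpen_cyl (isOpen_cyl hU))
    fun z hz => ?_
  change (fun s : a => ε (Sum.inl (Sum.inl (Sum.inl s))) * z (Sum.inl (Sum.inl s))) ∈ U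
  simp only [hε, one_mul]
  exact hz

theorem isSuperMap_Rmap (hU : IsOpen U) : IsSuperMap (cyl (cyl U)) (cyl (cyl U))
    (Rmap : ((a ⊕ d) ⊕ (a ⊕ d)) ⊕ ((b ⊕ c) ⊕ (b ⊕ c)) → _) := by
  rw [Rmap_eq_relabel]
  exact isSuperMap_relabel_swapFib hU fun _ => rfl

theorem isSuperMap_Rinv (hU : IsOpen U) : IsSuperMap (cyl (cyl U)) (cyl (cyl U))
    (Rinv : ((a ⊕ d) ⊕ (a ⊕ d)) ⊕ ((b ⊕ c) ⊕ (b ⊕ c)) → _) :=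
  isSuperMap_relabel_swapFib hU fun _ => rfl

theorem soul_Rmap (z : (a ⊕ d) ⊕ (a ⊕ d) → ℝ) (s : (a ⊕ d) ⊕ (a ⊕ d)) :
    soul ((Rmap (Sum.inl s) : SFun _ ((b ⊕ c) ⊕ (b ⊕ c))) z) = 0 := by
  rw [Rmap_eq_relabel]
  exact soul_relabel _ _ _ _ _

theorem subst_Rmap_Rinv (hU : IsOpen U) (hF : ContDiffOn ℝ ∞ F (cyl (cyl U)))
    (hz : z ∈ cyl (cyl U)) : subst Rmap (subst Rinv F) z = F z := by
  refine (subst_subst_relabel (isSuperMap_Rmap hU) (isSuperMap_Rinv hU) hz hF).trans ?_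
  refine Eq.trans (subst_congr_left (fun B => ?_) F) (congrFun (subst_coord_self F) z)
  change swapSign (swapIdx B) • Rmap (swapIdx B) z = _
  rw [Rmap_apply, Pi.smul_apply, smul_smul, swapSign_mul_self, one_smul, swapIdx_swapIdx]

theorem subst_Rinv_Rmap (hU : IsOpen U) (hF : ContDiffOn ℝ ∞ F (cyl (cyl U)))
    (hz : z ∈ cyl (cyl U)) : subst Rinv (subst Rmap F) z = F z := by
  have h := isSuperMap_Rmap (b := b) (c := c) (d := d) hU
  rw [Rmap_eq_relabel] at h ⊢
  refine (subst_subst_relabel (isSuperMap_Rinv hU) h hz hF).trans ?_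
  refine Eq.trans (subst_congr_left (fun B => ?_) F) (congrFun (subst_coord_self F) z)
  change swapSign B • swapSign (swapIdx (swapIdx B)) •
    (coord (swapIdx (swapIdx B)) : SFun _ ((b ⊕ c) ⊕ (b ⊕ c))) z = _
  rw [smul_smul, swapIdx_swapIdx, swapSign_mul_self, one_smul]

theorem subst_Rmap_injOn (hU : IsOpen U) (hF : ContDiffOn ℝ ∞ F (cyl (cyl U)))
    (hG : ContDiffOn ℝ ∞ G (cyl (cyl U)))
    (h : ∀ z ∈ cyl (cyl U), subst Rmap F z = subst Rmap G z) (hz : z ∈ cyl (cyl U)) :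
    F z = G z := by
  rw [← subst_Rinv_Rmap hU hF hz, ← subst_Rinv_Rmap hU hG hz]
  exact subst_congr (isSuperMap_Rinv hU) hz (contDiffOn_subst (isSuperMap_Rmap hU) hF) h

theorem pd_swapIdx_relabel (ε : ((a ⊕ d) ⊕ (a ⊕ d)) ⊕ ((b ⊕ c) ⊕ (b ⊕ c)) → ℝ)
    {V : Set ((a ⊕ d) ⊕ (a ⊕ d) → ℝ)} (h : IsSuperMap V V
      (relabel ε swapFib swapFib : _ → SFun _ ((b ⊕ c) ⊕ (b ⊕ c))))
    (hF : ContDiffOn ℝ ∞ F V) (hz : z ∈ V) (B : ((a ⊕ d) ⊕ (a ⊕ d)) ⊕ ((b ⊕ c) ⊕ (b ⊕ c))) :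
    pd (swapIdx B) (subst (relabel ε swapFib swapFib) F) z =
      ε B • subst (relabel ε swapFib swapFib) (pd B F) z := by
  have hp : ∀ C, pd (swapIdx B) (relabel ε swapFib swapFib C : SFun _ ((b ⊕ c) ⊕ (b ⊕ c))) z =
      ε C • if B = C then 1 else 0 := fun C => by
    rw [relabel, pd_const_smul _ _ (differentiableAt_coord _ _), pd_coord]
    congr 1
    exact if_congr swapIdx_injective.eq_iff rfl rfl
  rw [pd_subst h hz _ hF, Finset.sum_eq_single B]
  · rw [hp, if_pos rfl, smul_mul_assoc, one_mul]
  · intro C _ hC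
    rw [hp, if_neg hC.symm, smul_zero, zero_mul]
  · simp

/-- The canonical map exchanges the weights of the fibre coordinates and their momenta. -/
theorem funWeightOn_relabel_swapFib {ε : ((a ⊕ d) ⊕ (a ⊕ d)) ⊕ ((b ⊕ c) ⊕ (b ⊕ c)) → ℝ}
    {V : Set ((a ⊕ d) ⊕ (a ⊕ d) → ℝ)} (h : IsSuperMap V V
      (relabel ε swapFib swapFib : _ → SFun _ ((b ⊕ c) ⊕ (b ⊕ c))))
    (hF : ContDiffOn ℝ ∞ F V) {w : ((a ⊕ d) ⊕ (a ⊕ d)) ⊕ ((b ⊕ c) ⊕ (b ⊕ c)) → ℤ} {r : ℤ}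
    (hw : FunWeightOn V (fun B => w (swapIdx B)) r F) :
    FunWeightOn V w r (subst (relabel ε swapFib swapFib) F) := by
  intro z hz
  have hV := h.isOpen_source
  have h1 := subst_congr h hz (g := (r : ℝ) • F) (contDiffOn_act hV (contDiffOn_euler _) hF) hw
  rw [subst_smul h hz hF, act, subst_sum h hz _ fun B _ => contDiffOn_mul (contDiffOn_euler _ _)
    (contDiffOn_pd B hV hF)] at h1
  rw [act_euler, ← h1, ← Equiv.sum_comp (Function.Involutive.toPerm _ swapIdx_swapIdx)]
  refine Finset.sum_congr rfl fun B _ => ?_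
  rw [subst_mul h hz (contDiffOn_euler _ _) (contDiffOn_pd B hV hF), euler,
    subst_smul h hz (contDiff_coord _).contDiffOn, subst_coord h hz, smul_mul_assoc]
  congr 1
  change (coord (swapIdx B) : SFun _ ((b ⊕ c) ⊕ (b ⊕ c))) z * pd (swapIdx B) _ z =
    (ε B • (coord (swapIdx B) : SFun _ ((b ⊕ c) ⊕ (b ⊕ c))) z) * _
  rw [pd_swapIdx_relabel ε h hF hz, mul_smul_comm, smul_mul_assoc]

theorem momDeg_swapIdx (B : ((a ⊕ d) ⊕ (a ⊕ d)) ⊕ ((b ⊕ c) ⊕ (b ⊕ c))) :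
    momDeg (swapIdx B) = momDeg B + cotWt fibWt B := by
  rcases B with ((s | s) | (s | s)) | ((s | s) | (s | s)) <;> rfl

theorem cotWt_fibWt_swapIdx (B : ((a ⊕ d) ⊕ (a ⊕ d)) ⊕ ((b ⊕ c) ⊕ (b ⊕ c))) :
    cotWt fibWt (swapIdx B) = - cotWt fibWt B := by
  rcases B with ((s | s) | (s | s)) | ((s | s) | (s | s)) <;> rfl

/-- A function with given degree in the momenta and given weight keeps the sum of both as its
degree in the momenta under an exchange of the fibre coordinates and their momenta. -/
theorem momDeg_relabel_swapFib {ε : ((a ⊕ d) ⊕ (a ⊕ d)) ⊕ ((b ⊕ c) ⊕ (b ⊕ c)) → ℝ}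
    {V : Set ((a ⊕ d) ⊕ (a ⊕ d) → ℝ)} (h : IsSuperMap V V
      (relabel ε swapFib swapFib : _ → SFun _ ((b ⊕ c) ⊕ (b ⊕ c))))
    (hF : ContDiffOn ℝ ∞ F V) {m r : ℤ} (hm : FunWeightOn V momDeg m F)
    (hr : FunWeightOn V (cotWt fibWt) r F) :
    FunWeightOn V momDeg (m + r) (subst (relabel ε swapFib swapFib) F) := by
  refine funWeightOn_relabel_swapFib h hF fun z hz => ?_
  rw [Int.cast_add, add_smul, ← hm z hz, ← hr z hz, act_euler, act_euler, act_euler,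
    ← Finset.sum_add_distrib]
  exact Finset.sum_congr rfl fun B _ => by rw [momDeg_swapIdx, Int.cast_add, add_smul]

theorem cotWt_relabel_swapFib {ε : ((a ⊕ d) ⊕ (a ⊕ d)) ⊕ ((b ⊕ c) ⊕ (b ⊕ c)) → ℝ}
    {V : Set ((a ⊕ d) ⊕ (a ⊕ d) → ℝ)} (h : IsSuperMap V V
      (relabel ε swapFib swapFib : _ → SFun _ ((b ⊕ c) ⊕ (b ⊕ c))))
    (hF : ContDiffOn ℝ ∞ F V) {r : ℤ} (hr : FunWeightOn V (cotWt fibWt) r F) :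
    FunWeightOn V (cotWt fibWt) (-r) (subst (relabel ε swapFib swapFib) F) := by
  refine funWeightOn_relabel_swapFib h hF fun z hz => ?_
  rw [Int.cast_neg, neg_smul, ← hr z hz, act_euler, act_euler, ← Finset.sum_neg_distrib]
  exact Finset.sum_congr rfl fun B _ => by rw [cotWt_fibWt_swapIdx, Int.cast_neg, neg_smul]

/-- The canonical map is a symplectomorphism. -/
theorem poisson_subst_Rmap (hU : IsOpen U) (hF : ContDiffOn ℝ ∞ F (cyl (cyl U)))
    (ho : ParityOn (cyl (cyl U)) 1 F) (hG : ContDiffOn ℝ ∞ G (cyl (cyl U)))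
    (hz : z ∈ cyl (cyl U)) :
    poisson (subst Rmap F) (subst Rmap G) z = subst Rmap (poisson F G) z := by
  have h := isSuperMap_Rmap (b := b) (c := c) (d := d) hU
  have hV := h.isOpen_source
  have hd : ∀ {H : SFun ((a ⊕ d) ⊕ (a ⊕ d)) ((b ⊕ c) ⊕ (b ⊕ c))}, ContDiffOn ℝ ∞ H (cyl (cyl U)) →
      ∀ C, ContDiffOn ℝ ∞ (pd C H) (cyl (cyl U)) := fun hH C => contDiffOn_pd C hV hH
  have hp : ∀ {H : SFun ((a ⊕ d) ⊕ (a ⊕ d)) ((b ⊕ c) ⊕ (b ⊕ c))}, ContDiffOn ℝ ∞ H (cyl (cyl U)) →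
      ∀ B, pd (swapIdx B) (subst Rmap H) z = swapSign B • subst Rmap (pd B H) z := fun hH B => by
    rw [Rmap_eq_relabel] at h ⊢
    exact pd_swapIdx_relabel _ h hH hz B
  have hqb : ∀ {H : SFun ((a ⊕ d) ⊕ (a ⊕ d)) ((b ⊕ c) ⊕ (b ⊕ c))},
      ContDiffOn ℝ ∞ H (cyl (cyl U)) → ∀ A, pd (qIdx (baseIdx A)) (subst Rmap H) z =
        subst Rmap (pd (qIdx (baseIdx A)) H) z := fun hH A => by
    have := hp hH (qIdx (baseIdx A))
    rwa [swapIdx_qIdx_baseIdx, swapSign_qIdx_baseIdx, one_smul] at this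
  have hpb : ∀ {H : SFun ((a ⊕ d) ⊕ (a ⊕ d)) ((b ⊕ c) ⊕ (b ⊕ c))},
      ContDiffOn ℝ ∞ H (cyl (cyl U)) → ∀ A, pd (pIdx (baseIdx A)) (subst Rmap H) z =
        subst Rmap (pd (pIdx (baseIdx A)) H) z := fun hH A => by
    have := hp hH (pIdx (baseIdx A))
    rwa [swapIdx_pIdx_baseIdx, swapSign_pIdx_baseIdx, one_smul] at this
  have hqf : ∀ {H : SFun ((a ⊕ d) ⊕ (a ⊕ d)) ((b ⊕ c) ⊕ (b ⊕ c))},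
      ContDiffOn ℝ ∞ H (cyl (cyl U)) → ∀ α, pd (qIdx (fibIdx α)) (subst Rmap H) z =
        subst Rmap (pd (pIdx (fibIdx α)) H) z := fun hH α => by
    have := hp hH (pIdx (fibIdx α))
    rwa [swapIdx_pIdx_fibIdx, swapSign_pIdx_fibIdx, one_smul] at this
  have hpf : ∀ {H : SFun ((a ⊕ d) ⊕ (a ⊕ d)) ((b ⊕ c) ⊕ (b ⊕ c))},
      ContDiffOn ℝ ∞ H (cyl (cyl U)) → ∀ α, pd (pIdx (fibIdx α)) (subst Rmap H) z =
        sg (par α) • subst Rmap (pd (qIdx (fibIdx α)) H) z := fun hH α => by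
    have := hp hH (qIdx (fibIdx α))
    rwa [swapIdx_qIdx_fibIdx, swapSign_qIdx_fibIdx] at this
  have hm : ∀ C D, ContDiffOn ℝ ∞ (pd C F * pd D G) (cyl (cyl U)) := fun C D =>
    contDiffOn_mul (hd hF C) (hd hG D)
  have hs : ∀ A, ContDiffOn ℝ ∞ (pd (pIdx A) F * pd (qIdx A) G +
      (-sg (par A)) • (pd (qIdx A) F * pd (pIdx A) G)) (cyl (cyl U)) := fun A =>
    contDiffOn_add (hm _ _) (contDiffOn_smul _ (hm _ _))
  rw [poisson_of_odd hV (parityOn_subst h hF ho) hz (contDiffOn_subst h hF)]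
  rw [← subst_congr h hz (contDiffOn_sum Finset.univ fun A _ => hs A) fun y hy => by
    rw [poisson_of_odd hV ho hy hF, Finset.sum_apply]
    exact Finset.sum_congr rfl fun A _ => by
      rw [Pi.add_apply, Pi.smul_apply, neg_smul, ← sub_eq_add_neg]; rfl]
  have he : ∀ A, subst Rmap (pd (pIdx A) F * pd (qIdx A) G +
      (-sg (par A)) • (pd (qIdx A) F * pd (pIdx A) G)) z =
      subst Rmap (pd (pIdx A) F) z * subst Rmap (pd (qIdx A) G) z -
        sg (par A) • (subst Rmap (pd (qIdx A) F) z * subst Rmap (pd (pIdx A) G) z) := fun A => by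
    rw [subst_add h hz (hm _ _) (contDiffOn_smul _ (hm _ _)), subst_smul h hz (hm _ _),
      subst_mul h hz (hd hF _) (hd hG _), subst_mul h hz (hd hF _) (hd hG _), neg_smul,
      ← sub_eq_add_neg]
  rw [subst_sum h hz _ fun A _ => hs A, sum_totIdx, sum_totIdx]
  simp only [he, hqb hF, hqb hG, hpb hF, hpb hG, hqf hF, hqf hG, hpf hF, hpf hG]
  congr 1
  refine Finset.sum_congr rfl fun α _ => ?_
  rw [smul_mul_assoc, mul_smul_comm, smul_smul, ← sg_add, par_fibIdx,
    show ∀ ε : ZMod 2, ε + 1 + ε = 1 by decide, sg_one, neg_one_smul, sub_neg_eq_add, sg_add,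
    sg_one, mul_neg_one, neg_smul, sub_neg_eq_add, add_comm]

theorem subst_Rmap_liftCot_liftTot (f : SFun a b) (z : (a ⊕ d) ⊕ (a ⊕ d) → ℝ) :
    subst Rmap (liftCot (liftTot f : SFun (a ⊕ d) (b ⊕ c))) z = liftCot (liftTot f) z := by
  have h := isSuperMap_Rmap (a := a) (b := b) (c := c) (d := d) isOpen_univ
  have h1 := fun m => h.odd (Set.mem_univ z) m
  rw [subst_of_soul_eq_zero (φ := Rmap) (soul_Rmap z), liftCot_apply, liftCot_apply,
    liftTot_apply, liftTot_apply, grHom_grHom h1 (gen_map_odd _),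
    grHom_grHom (fun m => grHom_mem h1 (gen_map_odd _ m)) (gen_map_odd _),
    grHom_grHom (gen_map_odd _) (gen_map_odd _)]
  have h2 : bodyMap (Rmap : ((a ⊕ d) ⊕ (a ⊕ d)) ⊕ ((b ⊕ c) ⊕ (b ⊕ c)) → _) z ∘ Sum.inl ∘ Sum.inl =
      z ∘ Sum.inl ∘ Sum.inl := by
    funext s
    exact body_algebraMap _
  change grHom _ (f (bodyMap _ z ∘ Sum.inl ∘ Sum.inl)) = grHom _ (f (z ∘ Sum.inl ∘ Sum.inl))
  rw [h2]
  congr 2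
  funext m
  have h3 : grHom (fun m => Rmap (Sum.inr m) z) (gen (Sum.inl (Sum.inl m))) =
      (gen (Sum.inl (Sum.inl m)) : Gr ((b ⊕ c) ⊕ (b ⊕ c))) := grHom_gen h1 _
  exact (grHom_gen (fun m => grHom_mem h1 (gen_map_odd Sum.inl m)) _).trans
    (h3.trans (grHom_gen (gen_map_odd Sum.inl) (Sum.inl m)).symm)

end CanonicalMap

/-! ### Naturality of the canonical map -/

section Naturality

variable {a b c d : Type} [Fintype a] [DecidableEq a] [Fintype b] [DecidableEq b]
  [Fintype c] [DecidableEq c] [Fintype d] [DecidableEq d]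
  {M : SuperAtlas.{u} a b} {E : SuperBundle M c d} {i j : M.Idx} {z : a ⊕ d → ℝ}

/-- The pullback of the derivatives of the transition matrix of the bundle. -/
def SuperBundle.dT (E : SuperBundle M c d) (i j : M.Idx) (A : a ⊕ b) (β α : c ⊕ d) : SFun a b :=
  subst (M.tr i j) (pd A (E.T j i β α))

/-- The pullback of the derivatives of the inverse transition matrix of the bundle. -/
def SuperBundle.dInvT (E : SuperBundle M c d) (i j : M.Idx) (A : a ⊕ b) (β α : c ⊕ d) :
    SFun a b :=
  subst (M.tr i j) (pd A (E.invT j i β α))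

theorem SuperBundle.IsVectorBundle.contDiffOn_pd_T (hM : M.IsSupermanifold)
    (hE : E.IsVectorBundle) (A : a ⊕ b) (β α : c ⊕ d) :
    ContDiffOn ℝ ∞ (pd A (E.T i j β α)) (M.ovl i j) :=
  contDiffOn_pd A (hM.isOpen_ovl i j) (hE.smooth i j β α)

theorem SuperBundle.IsVectorBundle.contDiffOn_pd_invT (hM : M.IsSupermanifold)
    (hE : E.IsVectorBundle) (A : a ⊕ b) (β α : c ⊕ d) :
    ContDiffOn ℝ ∞ (pd A (E.invT i j β α)) (M.ovl i j) :=
  contDiffOn_pd A (hM.isOpen_ovl i j) (hE.contDiffOn_invT hM β α)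

theorem SuperBundle.IsVectorBundle.parityOn_dInvT (hM : M.IsSupermanifold)
    (hE : E.IsVectorBundle) (A : a ⊕ b) (β α : c ⊕ d) :
    ParityOn (M.ovl i j) (par β + par α + par A) (E.dInvT i j A β α) :=
  parityOn_subst (hM.isGlued.isSuperMap i j) (hE.contDiffOn_pd_invT hM A β α)
    (pd_mem A (hM.isOpen_ovl j i) (hE.contDiffOn_invT hM β α) (hE.parityOn_invT hM β α))

/-- The derivative of the inverse of a matrix: differentiate the relation between the matrix and
its inverse in the new chart, and pull back. -/
theorem SuperBundle.IsVectorBundle.dInvT_mul_invT (hM : M.IsSupermanifold)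
    (hE : E.IsVectorBundle) {x : a → ℝ} (hx : x ∈ M.ovl i j) (A : a ⊕ b) (β δ : c ⊕ d) :
    ∑ γ, E.dInvT i j A β γ x * E.invT i j γ δ x =
      - ∑ γ, sg (par A * (par β + par γ)) • (E.T i j β γ x * E.dT i j A γ δ x) := by
  have h := hM.isGlued.isSuperMap i j
  have hV := h.isOpen_target
  have h1 : ∀ y ∈ M.ovl j i, (∑ γ, (pd A (E.invT j i β γ) * E.T j i γ δ +
      sg (par A * (par β + par γ)) • (E.invT j i β γ * pd A (E.T j i γ δ)))) y = 0 := fun y hy => by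
    have hd : ∀ γ, DifferentiableAt ℝ (E.invT j i β γ) y := fun γ =>
      ContDiffOn.differentiableAt_of_isOpen hV (hE.contDiffOn_invT hM β γ) hy
    have hd' : ∀ γ, DifferentiableAt ℝ (E.T j i γ δ) y := fun γ =>
      ContDiffOn.differentiableAt_of_isOpen hV (hE.smooth j i γ δ) hy
    have h2 := pd_congr_of_isOpen A hV hy (f := ∑ γ, E.invT j i β γ * E.T j i γ δ)
      (g := fun _ => algebraMap ℝ (Gr b) (if β = δ then 1 else 0)) fun y hy => by
        rw [Finset.sum_apply]
        refine (matrix_mul_comm (fun α γ => hE.T_mul_invT hM hy α γ) β δ).trans ?_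
        split_ifs <;> simp
    rw [pd_const, pd_sum _ _ fun γ _ => differentiableAt_mul (hd γ) (hd' γ)] at h2
    rw [Finset.sum_apply, ← h2]
    refine Finset.sum_congr rfl fun γ _ => ?_
    rw [pd_mul A (hd γ) (hd' γ), sgn_eq_sg A (hE.parityOn_invT hM β γ y hy), smul_mul_assoc]
    rfl
  have hs : ∀ γ, ContDiffOn ℝ ∞ (pd A (E.invT j i β γ) * E.T j i γ δ) (M.ovl j i) := fun γ =>
    contDiffOn_mul (hE.contDiffOn_pd_invT hM A β γ) (hE.smooth j i γ δ)
  have hs' : ∀ γ, ContDiffOn ℝ ∞ (E.invT j i β γ * pd A (E.T j i γ δ)) (M.ovl j i) := fun γ =>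
    contDiffOn_mul (hE.contDiffOn_invT hM β γ) (hE.contDiffOn_pd_T hM A γ δ)
  have hs'' : ∀ γ, ContDiffOn ℝ ∞ (sg (par A * (par β + par γ)) •
      (E.invT j i β γ * pd A (E.T j i γ δ))) (M.ovl j i) := fun γ => contDiffOn_smul _ (hs' γ)
  have h3 := subst_congr h hx (g := 0)
    (contDiffOn_sum _ fun γ _ => contDiffOn_add (hs γ) (hs'' γ)) h1
  rw [subst_zero, subst_sum h hx _ fun γ _ => contDiffOn_add (hs γ) (hs'' γ)] at h3
  rw [eq_neg_iff_add_eq_zero, ← h3, ← Finset.sum_add_distrib]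
  refine Finset.sum_congr rfl fun γ _ => ?_
  rw [subst_add h hx (hs γ) (hs'' γ), subst_smul h hx (hs' γ),
    subst_mul h hx (hE.contDiffOn_pd_invT hM A β γ) (hE.smooth j i γ δ),
    subst_mul h hx (hE.contDiffOn_invT hM β γ) (hE.contDiffOn_pd_T hM A γ δ),
    hE.subst_invT hM hx]
  rfl

section InverseJacobians

variable (hM : M.IsSupermanifold) (hE : E.IsVectorBundle)
include hM

theorem piTot_invJac_congr (hE : E.IsVectorBundle) (hz : z ∈ E.PiTot.ovl i j)
    {C D : (a ⊕ d) ⊕ (b ⊕ c)} {g : SFun (a ⊕ d) (b ⊕ c)}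
    (h : ∀ y ∈ E.PiTot.ovl j i, pd C (E.PiTot.tr j i D) y = g y) :
    E.PiTot.invJac i j C D z = subst (E.PiTot.tr i j) g z :=
  subst_congr (isSuperMap_piTot_tr hM hE i j) hz ((isGlued_piTot hM hE).contDiffOn_pd_tr C D) h

theorem piDualTot_invJac_congr (hE : E.IsVectorBundle) (hz : z ∈ E.PiDualTot.ovl i j)
    {C D : (a ⊕ d) ⊕ (b ⊕ c)} {g : SFun (a ⊕ d) (b ⊕ c)}
    (h : ∀ y ∈ E.PiDualTot.ovl j i, pd C (E.PiDualTot.tr j i D) y = g y) :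
    E.PiDualTot.invJac i j C D z = subst (E.PiDualTot.tr i j) g z :=
  subst_congr (isSuperMap_piDualTot_tr hM hE i j) hz
    ((isGlued_piDualTot hM hE).contDiffOn_pd_tr C D) h

include hE

theorem piTot_invJac_fib_base (hz : z ∈ E.PiTot.ovl i j) (α : c ⊕ d) (A : a ⊕ b) :
    E.PiTot.invJac i j (fibIdx α) (baseIdx A) z = 0 := by
  rw [piTot_invJac_congr hM hE hz (g := 0) fun y hy => by
    rw [piTot_tr_baseIdx]
    exact pd_fibIdx_liftTot (hM.isOpen_ovl j i) (hM.smooth j i A) hy α, subst_zero]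

theorem piDualTot_invJac_fib_base (hz : z ∈ E.PiDualTot.ovl i j) (α : c ⊕ d) (A : a ⊕ b) :
    E.PiDualTot.invJac i j (fibIdx α) (baseIdx A) z = 0 := by
  rw [piDualTot_invJac_congr hM hE hz (g := 0) fun y hy => by
    rw [piDualTot_tr_baseIdx]
    exact pd_fibIdx_liftTot (hM.isOpen_ovl j i) (hM.smooth j i A) hy α, subst_zero]

theorem piTot_invJac_base_base (hz : z ∈ E.PiTot.ovl i j) (A C : a ⊕ b) :
    E.PiTot.invJac i j (baseIdx A) (baseIdx C) z = liftTot (M.invJac i j A C) z := by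
  rw [piTot_invJac_congr hM hE hz (g := liftTot (pd A (M.tr j i C))) fun y hy => by
    rw [piTot_tr_baseIdx]
    exact pd_baseIdx_liftTot (hM.isOpen_ovl j i) (hM.smooth j i C) hy A,
    subst_piTot_tr_liftTot hM hE hz (hM.isGlued.contDiffOn_pd_tr A C)]
  rfl

theorem piDualTot_invJac_base_base (hz : z ∈ E.PiDualTot.ovl i j) (A C : a ⊕ b) :
    E.PiDualTot.invJac i j (baseIdx A) (baseIdx C) z = liftTot (M.invJac i j A C) z := by
  rw [piDualTot_invJac_congr hM hE hz (g := liftTot (pd A (M.tr j i C))) fun y hy => by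
    rw [piDualTot_tr_baseIdx]
    exact pd_baseIdx_liftTot (hM.isOpen_ovl j i) (hM.smooth j i C) hy A,
    subst_piDualTot_tr_liftTot hM hE hz (hM.isGlued.contDiffOn_pd_tr A C)]
  rfl

theorem piTot_invJac_fib_fib (hz : z ∈ E.PiTot.ovl i j) (α β : c ⊕ d) :
    E.PiTot.invJac i j (fibIdx α) (fibIdx β) z = liftTot (E.invT i j α β) z := by
  rw [piTot_invJac_congr hM hE hz (g := liftTot (E.T j i α β)) fun y hy => by
    have hd : ∀ γ, DifferentiableAt ℝ (liftTot (E.T j i γ β) : SFun (a ⊕ d) (b ⊕ c)) y := fun γ =>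
      ContDiffOn.differentiableAt_of_isOpen (isOpen_cyl (hM.isOpen_ovl j i))
        (contDiffOn_liftTot (hM.isOpen_ovl j i) (hE.smooth j i γ β)) hy
    rw [piTot_tr_fibIdx, pd_sum _ _ fun γ _ => differentiableAt_mul (differentiableAt_coord _ _)
      (hd γ), Finset.sum_eq_single α]
    · rw [pd_mul _ (differentiableAt_coord _ _) (hd α), pd_coord, if_pos rfl, one_mul,
        pd_fibIdx_liftTot (hM.isOpen_ovl j i) (hE.smooth j i α β) hy, mul_zero, add_zero]
    · intro γ _ hγ
      rw [pd_mul _ (differentiableAt_coord _ _) (hd γ), pd_coord,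
        if_neg fun h => hγ (fibIdx_injective h).symm, zero_mul,
        pd_fibIdx_liftTot (hM.isOpen_ovl j i) (hE.smooth j i γ β) hy, mul_zero, add_zero]
    · simp,
    subst_piTot_tr_liftTot hM hE hz (hE.smooth j i α β)]
  rfl

theorem piDualTot_invJac_fib_fib (hz : z ∈ E.PiDualTot.ovl i j) (α β : c ⊕ d) :
    E.PiDualTot.invJac i j (fibIdx α) (fibIdx β) z =
      (sg ((par α + 1) * (par β + par α)) • liftTot (E.T i j β α) : SFun (a ⊕ d) (b ⊕ c)) z := by
  have hU := hM.isOpen_ovl j i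
  have hi := fun γ => hE.contDiffOn_invT (i := j) (j := i) hM β γ
  rw [piDualTot_invJac_congr hM hE hz
    (g := sg ((par α + 1) * (par β + par α)) • liftTot (E.invT j i β α)) fun y hy => by
    have hd : ∀ γ, DifferentiableAt ℝ (liftTot (E.invT j i β γ) : SFun (a ⊕ d) (b ⊕ c)) y :=
      fun γ => ContDiffOn.differentiableAt_of_isOpen (isOpen_cyl hU)
        (contDiffOn_liftTot hU (hi γ)) hy
    rw [piDualTot_tr_fibIdx, pd_sum _ _ fun γ _ => differentiableAt_mul (hd γ)
      (differentiableAt_coord _ _), Finset.sum_eq_single α]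
    · rw [pd_mul _ (hd α) (differentiableAt_coord _ _), pd_coord, if_pos rfl, mul_one,
        pd_fibIdx_liftTot hU (hi α) hy, zero_mul, zero_add,
        sgn_eq_sg _ (liftTot_mem (hE.parityOn_invT hM β α _ hy)), par_fibIdx]
      rfl
    · intro γ _ hγ
      rw [pd_mul _ (hd γ) (differentiableAt_coord _ _), pd_coord,
        if_neg fun h => hγ (fibIdx_injective h).symm, mul_zero,
        pd_fibIdx_liftTot hU (hi γ) hy, zero_mul, add_zero]
    · simp,
    subst_smul (isSuperMap_piDualTot_tr hM hE i j) hz (contDiffOn_liftTot hU (hi α)),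
    subst_piDualTot_tr_liftTot hM hE hz (hi α), Pi.smul_apply,
    liftTot_congr (hE.subst_invT hM hz β α)]

theorem piTot_invJac_base_fib (hz : z ∈ E.PiTot.ovl i j) (A : a ⊕ b) (β : c ⊕ d) :
    E.PiTot.invJac i j (baseIdx A) (fibIdx β) z =
      (∑ γ, sg (par A * (par γ + 1)) •
        ((∑ δ, coord (fibIdx δ) * liftTot (E.T i j δ γ)) * liftTot (E.dT i j A γ β)) :
          SFun (a ⊕ d) (b ⊕ c)) z := by
  have hU := hM.isOpen_ovl j i
  have h := isSuperMap_piTot_tr hM hE i j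
  have hp := fun γ => hE.contDiffOn_pd_T (i := j) (j := i) hM A γ β
  have hs : ∀ γ, ContDiffOn ℝ ∞ (coord (fibIdx γ) * liftTot (pd A (E.T j i γ β)) :
      SFun (a ⊕ d) (b ⊕ c)) (E.PiTot.ovl j i) := fun γ =>
    contDiffOn_mul (contDiff_coord _).contDiffOn (contDiffOn_liftTot hU (hp γ))
  rw [piTot_invJac_congr hM hE hz (g := ∑ γ, sg (par A * (par γ + 1)) •
      (coord (fibIdx γ) * liftTot (pd A (E.T j i γ β)))) fun y hy => by
    have hd : ∀ γ, DifferentiableAt ℝ (liftTot (E.T j i γ β) : SFun (a ⊕ d) (b ⊕ c)) y := fun γ =>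
      ContDiffOn.differentiableAt_of_isOpen (isOpen_cyl hU)
        (contDiffOn_liftTot hU (hE.smooth j i γ β)) hy
    rw [piTot_tr_fibIdx, pd_sum _ _ fun γ _ => differentiableAt_mul (differentiableAt_coord _ _)
      (hd γ), Finset.sum_apply]
    refine Finset.sum_congr rfl fun γ _ => ?_
    rw [pd_mul _ (differentiableAt_coord _ _) (hd γ), pd_coord, if_neg (baseIdx_ne_fibIdx A γ),
      zero_mul, zero_add, sgn_eq_sg _ (coord_mem _ _), par_baseIdx, par_fibIdx, smul_mul_assoc,
      pd_baseIdx_liftTot hU (hE.smooth j i γ β) hy]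
    rfl,
    subst_sum h hz _ fun γ _ => contDiffOn_smul _ (hs γ), Finset.sum_apply]
  refine Finset.sum_congr rfl fun γ _ => ?_
  rw [subst_smul h hz (hs γ), subst_mul h hz (contDiff_coord _).contDiffOn
    (contDiffOn_liftTot hU (hp γ)), subst_coord h hz, piTot_tr_fibIdx,
    subst_piTot_tr_liftTot hM hE hz (hp γ)]
  rfl

theorem piDualTot_invJac_base_fib (hz : z ∈ E.PiDualTot.ovl i j) (A : a ⊕ b) (β : c ⊕ d) :
    E.PiDualTot.invJac i j (baseIdx A) (fibIdx β) z =
      (∑ γ, liftTot (E.dInvT i j A β γ) * (∑ δ, liftTot (E.invT i j γ δ) * coord (fibIdx δ)) :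
          SFun (a ⊕ d) (b ⊕ c)) z := by
  have hU := hM.isOpen_ovl j i
  have h := isSuperMap_piDualTot_tr hM hE i j
  have hi := fun γ => hE.contDiffOn_invT (i := j) (j := i) hM β γ
  have hp := fun γ => hE.contDiffOn_pd_invT (i := j) (j := i) hM A β γ
  have hs : ∀ γ, ContDiffOn ℝ ∞ (liftTot (pd A (E.invT j i β γ)) * coord (fibIdx γ) :
      SFun (a ⊕ d) (b ⊕ c)) (E.PiDualTot.ovl j i) := fun γ =>
    contDiffOn_mul (contDiffOn_liftTot hU (hp γ)) (contDiff_coord _).contDiffOn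
  rw [piDualTot_invJac_congr hM hE hz (g := ∑ γ,
      liftTot (pd A (E.invT j i β γ)) * coord (fibIdx γ)) fun y hy => by
    have hd : ∀ γ, DifferentiableAt ℝ (liftTot (E.invT j i β γ) : SFun (a ⊕ d) (b ⊕ c)) y :=
      fun γ => ContDiffOn.differentiableAt_of_isOpen (isOpen_cyl hU)
        (contDiffOn_liftTot hU (hi γ)) hy
    rw [piDualTot_tr_fibIdx, pd_sum _ _ fun γ _ => differentiableAt_mul (hd γ)
      (differentiableAt_coord _ _), Finset.sum_apply]
    refine Finset.sum_congr rfl fun γ _ => ?_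
    rw [pd_mul _ (hd γ) (differentiableAt_coord _ _), pd_coord, if_neg (baseIdx_ne_fibIdx A γ),
      mul_zero, add_zero, pd_baseIdx_liftTot hU (hi γ) hy]
    rfl,
    subst_sum h hz _ fun γ _ => hs γ, Finset.sum_apply]
  refine Finset.sum_congr rfl fun γ _ => ?_
  rw [subst_mul h hz (contDiffOn_liftTot hU (hp γ)) (contDiff_coord _).contDiffOn,
    subst_coord h hz, piDualTot_tr_fibIdx, subst_piDualTot_tr_liftTot hM hE hz (hp γ)]
  rfl

end InverseJacobians

end Naturality

section Naturality

/-- The signs in the transformation law of the momenta of the base coordinates: the terms that come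
from the derivative of a matrix `T`, and those that come from the derivative `N'` of its inverse
`S`, agree after the exchange of fibre coordinates `η` and momenta `π`. -/
theorem sum_deriv_eq_sum_deriv_inv {b ι : Type} [Fintype b] [DecidableEq b] [Fintype ι]
    (p : ι → ZMod 2) (ε : ZMod 2) {T N N' S : ι → ι → Gr b} {π η : ι → Gr b}
    (hπ : ∀ β, π β ∈ grPart b (p β + 1)) (hη : ∀ β, η β ∈ grPart b (p β + 1))
    (hN' : ∀ β γ, N' β γ ∈ grPart b (p β + p γ + ε)) (hS : ∀ β γ, S β γ ∈ grPart b (p β + p γ))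
    (hW : ∀ β δ, ∑ γ, N' β γ * S γ δ = -∑ γ, sg (ε * (p β + p γ)) • (T β γ * N γ δ)) :
    ∑ β, (∑ γ, sg (ε * (p γ + 1)) • ((∑ δ, (sg (p δ) • π δ) * T δ γ) * N γ β)) * η β =
      ∑ β, (∑ γ, N' β γ * ∑ δ, S γ δ * η δ) * π β := by
  have h1 : ∀ β, (∑ γ, N' β γ * ∑ δ, S γ δ * η δ) * π β =
      ∑ δ, (∑ γ, N' β γ * S γ δ) * (η δ * π β) := fun β => by
    simp only [Finset.mul_sum, Finset.sum_mul, mul_assoc]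
    exact Finset.sum_comm
  have h2 : ∀ β, (∑ γ, sg (ε * (p γ + 1)) • ((∑ δ, (sg (p δ) • π δ) * T δ γ) * N γ β)) * η β =
      ∑ δ, (sg (p δ) • π δ) * (∑ γ, sg (ε * (p γ + 1)) • (T δ γ * N γ β)) * η β := fun β => by
    simp only [Finset.mul_sum, Finset.sum_mul, Finset.smul_sum, mul_smul_comm, smul_mul_assoc,
      mul_assoc]
    exact Finset.sum_comm
  have h3 : ∀ δ β, ∑ γ, sg (ε * (p γ + 1)) • (T δ γ * N γ β) =
      -(sg (ε * (p δ + 1)) • ∑ γ, N' δ γ * S γ β) := fun δ β => by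
    rw [hW, smul_neg, neg_neg, Finset.smul_sum]
    refine Finset.sum_congr rfl fun γ _ => ?_
    rw [smul_smul, ← sg_add]
    exact congrArg (fun e => sg e • _)
      ((by decide : ∀ e x y : ZMod 2, e * (x + 1) = e * (y + 1) + e * (y + x)) _ _ _)
  simp only [h1, h2, h3]
  rw [Finset.sum_comm]
  refine Finset.sum_congr rfl fun β _ => Finset.sum_congr rfl fun δ _ => ?_
  have h4 : (∑ γ, N' β γ * S γ δ) * η δ ∈ grPart b (p β + 1 + ε) := by
    have h5 : ∑ γ, N' β γ * S γ δ ∈ grPart b (p β + p δ + ε) :=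
      Submodule.sum_mem _ fun γ _ => by
        have := mul_mem_grPart (hN' β γ) (hS γ δ)
        rwa [show ∀ x y z e : ZMod 2, x + y + e + (y + z) = x + z + e by decide] at this
    have := mul_mem_grPart h5 (hη δ)
    rwa [show ∀ x y e : ZMod 2, x + y + e + (y + 1) = x + 1 + e by decide] at this
  rw [← mul_assoc, mul_comm_sg h4 (hπ β), mul_neg, neg_mul, smul_mul_assoc, mul_smul_comm,
    smul_mul_assoc, smul_mul_assoc, mul_assoc, smul_smul, ← sg_add, ← neg_one_smul ℝ, smul_smul,
    ← sg_one, ← sg_add]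
  exact congrArg (fun e => sg e • _)
    ((by decide : ∀ e x : ZMod 2, 1 + (x + e * (x + 1)) = (x + 1 + e) * (x + 1)) _ _)

variable {a b c d : Type} [Fintype a] [DecidableEq a] [Fintype b] [DecidableEq b]
  [Fintype c] [DecidableEq c] [Fintype d] [DecidableEq d]
  {M : SuperAtlas.{u} a b} {E : SuperBundle M c d} {i j : M.Idx} {z : (a ⊕ d) ⊕ (a ⊕ d) → ℝ}

theorem exists_algHom_liftCot_liftTot (z : (a ⊕ d) ⊕ (a ⊕ d) → ℝ) :
    ∃ Φ : Gr b →ₐ[ℝ] Gr ((b ⊕ c) ⊕ (b ⊕ c)), ∀ f : SFun a b,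
      liftCot (liftTot f : SFun (a ⊕ d) (b ⊕ c)) z = Φ (f ((z ∘ Sum.inl) ∘ Sum.inl)) :=
  ⟨(grHom fun m => gen (Sum.inl m)).comp (grHom fun m => gen (Sum.inl m)), fun f => by
    rw [liftCot_apply, liftTot_apply]; rfl⟩

theorem contDiffOn_liftCot_liftTot {U : Set (a → ℝ)} (hU : IsOpen U) {f : SFun a b}
    (hf : ContDiffOn ℝ ∞ f U) :
    ContDiffOn ℝ ∞ (liftCot (liftTot f : SFun (a ⊕ d) (b ⊕ c))) (cyl (cyl U)) :=
  contDiffOn_liftCot (isOpen_cyl hU) (contDiffOn_liftTot hU hf)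

theorem liftCot_zero (z : a ⊕ a → ℝ) : liftCot (0 : SFun a b) z = 0 := by
  rw [liftCot_apply, Pi.zero_apply, map_zero]

variable (hM : M.IsSupermanifold) (hE : E.IsVectorBundle)
include hM hE

theorem cot_piTot_tr_pIdx_fibIdx (hz : z ∈ (cot E.PiTot).ovl i j) (α : c ⊕ d) :
    (cot E.PiTot).tr i j (pIdx (fibIdx α)) z =
      (∑ β, liftCot (liftTot (E.invT i j α β)) * coord (pIdx (fibIdx β)) :
        SFun ((a ⊕ d) ⊕ (a ⊕ d)) ((b ⊕ c) ⊕ (b ⊕ c))) z := by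
  rw [cot_tr_pIdx E.PiTot i j, sym_apply, sum_totIdx, Finset.sum_eq_zero fun A _ => ?_, zero_add,
    Finset.sum_apply]
  · exact Finset.sum_congr rfl fun β _ => by
      rw [liftCot_congr (piTot_invJac_fib_fib hM hE hz α β)]; rfl
  · rw [liftCot_congr (g := 0) (piTot_invJac_fib_base hM hE hz α A), liftCot_zero, zero_mul]

theorem cot_piDualTot_tr_pIdx_fibIdx (hz : z ∈ (cot E.PiDualTot).ovl i j) (α : c ⊕ d) :
    (cot E.PiDualTot).tr i j (pIdx (fibIdx α)) z =
      ∑ β, sg ((par α + 1) * (par β + par α)) • (liftCot (liftTot (E.T i j β α)) z *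
        (coord (pIdx (fibIdx β)) : SFun ((a ⊕ d) ⊕ (a ⊕ d)) ((b ⊕ c) ⊕ (b ⊕ c))) z) := by
  rw [cot_tr_pIdx E.PiDualTot i j, sym_apply, sum_totIdx, Finset.sum_eq_zero fun A _ => ?_,
    zero_add]
  · exact Finset.sum_congr rfl fun β _ => by
      rw [liftCot_congr (piDualTot_invJac_fib_fib hM hE hz α β), liftCot_smul, Pi.smul_apply,
        smul_mul_assoc]
  · rw [liftCot_congr (g := 0) (piDualTot_invJac_fib_base hM hE hz α A), liftCot_zero, zero_mul]

theorem cot_piTot_tr_pIdx_baseIdx (hz : z ∈ (cot E.PiTot).ovl i j) (A : a ⊕ b) :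
    (cot E.PiTot).tr i j (pIdx (baseIdx A)) z =
      (∑ C, liftCot (liftTot (M.invJac i j A C)) * coord (pIdx (baseIdx C)) +
        ∑ β, (∑ γ, sg (par A * (par γ + 1)) •
          ((∑ δ, coord (qIdx (fibIdx δ)) * liftCot (liftTot (E.T i j δ γ))) *
            liftCot (liftTot (E.dT i j A γ β)))) * coord (pIdx (fibIdx β)) :
        SFun ((a ⊕ d) ⊕ (a ⊕ d)) ((b ⊕ c) ⊕ (b ⊕ c))) z := by
  rw [cot_tr_pIdx E.PiTot i j, sym_apply, sum_totIdx, Pi.add_apply, Finset.sum_apply,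
    Finset.sum_apply]
  refine congrArg₂ (· + ·) ?_ ?_
  · exact Finset.sum_congr rfl fun C _ => by
      rw [liftCot_congr (piTot_invJac_base_base hM hE hz A C)]; rfl
  · refine Finset.sum_congr rfl fun β _ => ?_
    rw [liftCot_congr (piTot_invJac_base_fib hM hE hz A β), Pi.mul_apply]
    simp only [liftCot_sum, liftCot_smul, liftCot_mul, liftCot_coord]

theorem cot_piDualTot_tr_pIdx_baseIdx (hz : z ∈ (cot E.PiDualTot).ovl i j) (A : a ⊕ b) :
    (cot E.PiDualTot).tr i j (pIdx (baseIdx A)) z =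
      (∑ C, liftCot (liftTot (M.invJac i j A C)) * coord (pIdx (baseIdx C)) +
        ∑ β, (∑ γ, liftCot (liftTot (E.dInvT i j A β γ)) *
          (∑ δ, liftCot (liftTot (E.invT i j γ δ)) * coord (qIdx (fibIdx δ)))) *
            coord (pIdx (fibIdx β)) :
        SFun ((a ⊕ d) ⊕ (a ⊕ d)) ((b ⊕ c) ⊕ (b ⊕ c))) z := by
  rw [cot_tr_pIdx E.PiDualTot i j, sym_apply, sum_totIdx, Pi.add_apply, Finset.sum_apply,
    Finset.sum_apply]
  refine congrArg₂ (· + ·) ?_ ?_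
  · exact Finset.sum_congr rfl fun C _ => by
      rw [liftCot_congr (piDualTot_invJac_base_base hM hE hz A C)]; rfl
  · refine Finset.sum_congr rfl fun β _ => ?_
    rw [liftCot_congr (piDualTot_invJac_base_fib hM hE hz A β), Pi.mul_apply]
    simp only [liftCot_sum, liftCot_mul, liftCot_coord]

theorem subst_Rmap_congr_tr {B : ((a ⊕ d) ⊕ (a ⊕ d)) ⊕ ((b ⊕ c) ⊕ (b ⊕ c))}
    {g : SFun ((a ⊕ d) ⊕ (a ⊕ d)) ((b ⊕ c) ⊕ (b ⊕ c))} (hz : z ∈ (cot E.PiTot).ovl i j)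
    (h : ∀ y ∈ (cot E.PiTot).ovl i j, (cot E.PiTot).tr i j B y = g y) :
    subst Rmap ((cot E.PiTot).tr i j B) z = subst Rmap g z :=
  subst_congr (isSuperMap_Rmap (hM.isOpen_ovl i j)) hz
    ((isSuperMap_cot_tr (isGlued_piTot hM hE) i j).smooth B) h

/-- The canonical map is compatible with the coordinate changes of the two cotangent bundles. -/
theorem subst_Rmap_cot_tr (hz : z ∈ (cot E.PiTot).ovl i j)
    (B : ((a ⊕ d) ⊕ (a ⊕ d)) ⊕ ((b ⊕ c) ⊕ (b ⊕ c))) :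
    subst Rmap ((cot E.PiTot).tr i j B) z =
      swapSign B • (cot E.PiDualTot).tr i j (swapIdx B) z := by
  have hz₀ : z ∈ cyl (cyl (M.ovl i j)) := hz
  have hz' : z ∈ (cot E.PiDualTot).ovl i j := hz₀
  have hU := hM.isOpen_ovl i j
  have h := isSuperMap_Rmap (b := b) (c := c) (d := d) hU
  have hc : ∀ C : ((a ⊕ d) ⊕ (a ⊕ d)) ⊕ ((b ⊕ c) ⊕ (b ⊕ c)), ContDiffOn ℝ ∞ (coord C :
    SFun ((a ⊕ d) ⊕ (a ⊕ d)) ((b ⊕ c) ⊕ (b ⊕ c))) (cyl (cyl (M.ovl i j))) :=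
    fun C => (contDiff_coord C).contDiffOn
  have hl : ∀ {f : SFun a b}, ContDiffOn ℝ ∞ f (M.ovl i j) → ContDiffOn ℝ ∞
      (liftCot (liftTot f : SFun (a ⊕ d) (b ⊕ c))) (cyl (cyl (M.ovl i j))) := fun hf =>
    contDiffOn_liftCot_liftTot hU hf
  have hRq : ∀ β, Rmap (qIdx (fibIdx β)) z = sg (par β) •
      (coord (pIdx (fibIdx β)) : SFun ((a ⊕ d) ⊕ (a ⊕ d)) ((b ⊕ c) ⊕ (b ⊕ c))) z := fun β => by
    rw [Rmap_apply, swapSign_qIdx_fibIdx, swapIdx_qIdx_fibIdx]; rfl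
  have hRp : ∀ β, Rmap (pIdx (fibIdx β)) z =
      (coord (qIdx (fibIdx β)) : SFun ((a ⊕ d) ⊕ (a ⊕ d)) ((b ⊕ c) ⊕ (b ⊕ c))) z := fun β => by
    rw [Rmap_apply, swapSign_pIdx_fibIdx, swapIdx_pIdx_fibIdx, one_smul]
  have hRb : ∀ A, Rmap (pIdx (baseIdx A)) z =
      (coord (pIdx (baseIdx A)) : SFun ((a ⊕ d) ⊕ (a ⊕ d)) ((b ⊕ c) ⊕ (b ⊕ c))) z := fun A => by
    rw [Rmap_apply, swapSign_pIdx_baseIdx, swapIdx_pIdx_baseIdx, one_smul]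
  have hco : ∀ C : (a ⊕ d) ⊕ (b ⊕ c), (coord (pIdx C) :
      SFun ((a ⊕ d) ⊕ (a ⊕ d)) ((b ⊕ c) ⊕ (b ⊕ c))) z ∈ grPart _ (par C) := fun C => by
    have := coord_mem (pIdx C) z
    rwa [par_pIdx] at this
  have hco' : ∀ C : (a ⊕ d) ⊕ (b ⊕ c), (coord (qIdx C) :
      SFun ((a ⊕ d) ⊕ (a ⊕ d)) ((b ⊕ c) ⊕ (b ⊕ c))) z ∈ grPart _ (par C) := fun C => by
    have := coord_mem (qIdx C) z
    rwa [par_qIdx] at this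
  revert B
  refine forall_cotIdx (forall_totIdx (fun A => ?_) fun α => ?_)
    (forall_totIdx (fun A => ?_) fun α => ?_)
  · rw [cot_tr_qIdx E.PiTot i j, piTot_tr_baseIdx, subst_Rmap_liftCot_liftTot,
      swapSign_qIdx_baseIdx, one_smul, swapIdx_qIdx_baseIdx, cot_tr_qIdx E.PiDualTot i j,
      piDualTot_tr_baseIdx]
  · have hs : ∀ β, ContDiffOn ℝ ∞ (coord (qIdx (fibIdx β)) * liftCot (liftTot (E.T i j β α)) :
        SFun ((a ⊕ d) ⊕ (a ⊕ d)) ((b ⊕ c) ⊕ (b ⊕ c))) (cyl (cyl (M.ovl i j))) := fun β =>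
      contDiffOn_mul (hc _) (hl (hE.smooth i j β α))
    rw [cot_tr_qIdx E.PiTot i j, piTot_tr_fibIdx, liftCot_sum]
    simp only [liftCot_mul, liftCot_coord]
    rw [subst_sum h hz _ fun β _ => hs β, swapSign_qIdx_fibIdx, swapIdx_qIdx_fibIdx,
      cot_piDualTot_tr_pIdx_fibIdx hM hE hz', Finset.smul_sum]
    refine Finset.sum_congr rfl fun β _ => ?_
    have h1 := hco (fibIdx β)
    rw [par_fibIdx] at h1
    rw [subst_mul h hz (hc _) (hl (hE.smooth i j β α)), subst_coord h hz, hRq,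
      subst_Rmap_liftCot_liftTot, smul_mul_assoc,
      mul_comm_sg h1 (liftCot_mem (liftTot_mem (hE.parity i j β α _ hz))), smul_smul, smul_smul,
      ← sg_add, ← sg_add]
    congr 2
    generalize (par β : ZMod 2) = x
    generalize (par α : ZMod 2) = y
    revert x y
    decide
  · have hT : ∀ γ, ContDiffOn ℝ ∞ (∑ δ, coord (qIdx (fibIdx δ)) * liftCot (liftTot (E.T i j δ γ)) :
        SFun ((a ⊕ d) ⊕ (a ⊕ d)) ((b ⊕ c) ⊕ (b ⊕ c))) (cyl (cyl (M.ovl i j))) := fun γ =>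
      contDiffOn_sum _ fun δ _ => contDiffOn_mul (hc _) (hl (hE.smooth i j δ γ))
    have hdT : ∀ γ β, ContDiffOn ℝ ∞ (E.dT i j A γ β) (M.ovl i j) := fun γ β =>
      contDiffOn_subst (hM.isGlued.isSuperMap i j) (hE.contDiffOn_pd_T hM A γ β)
    have hJ := fun C => hM.isGlued.contDiffOn_invJac (i := i) (j := j) A C
    have h1 : ∀ C, ContDiffOn ℝ ∞ (liftCot (liftTot (M.invJac i j A C)) * coord (pIdx (baseIdx C)) :
        SFun ((a ⊕ d) ⊕ (a ⊕ d)) ((b ⊕ c) ⊕ (b ⊕ c))) (cyl (cyl (M.ovl i j))) := fun C =>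
      contDiffOn_mul (hl (hJ C)) (hc _)
    have h2 : ∀ β γ, ContDiffOn ℝ ∞ ((∑ δ, coord (qIdx (fibIdx δ)) *
          liftCot (liftTot (E.T i j δ γ))) * liftCot (liftTot (E.dT i j A γ β)) :
        SFun ((a ⊕ d) ⊕ (a ⊕ d)) ((b ⊕ c) ⊕ (b ⊕ c))) (cyl (cyl (M.ovl i j))) := fun β γ =>
      contDiffOn_mul (hT γ) (hl (hdT γ β))
    have h3 : ∀ β, ContDiffOn ℝ ∞ (∑ γ, sg (par A * (par γ + 1)) •
          ((∑ δ, coord (qIdx (fibIdx δ)) * liftCot (liftTot (E.T i j δ γ))) *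
            liftCot (liftTot (E.dT i j A γ β))) :
        SFun ((a ⊕ d) ⊕ (a ⊕ d)) ((b ⊕ c) ⊕ (b ⊕ c))) (cyl (cyl (M.ovl i j))) := fun β =>
      contDiffOn_sum _ fun γ _ => contDiffOn_smul _ (h2 β γ)
    rw [subst_Rmap_congr_tr hM hE hz fun y hy => cot_piTot_tr_pIdx_baseIdx hM hE hy A,
      swapSign_pIdx_baseIdx, one_smul, swapIdx_pIdx_baseIdx,
      cot_piDualTot_tr_pIdx_baseIdx hM hE hz', Pi.add_apply, Finset.sum_apply, Finset.sum_apply,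
      subst_add h hz (contDiffOn_sum _ fun C _ => h1 C)
        (contDiffOn_sum _ fun β _ => contDiffOn_mul (h3 β) (hc _)),
      subst_sum h hz _ fun C _ => h1 C,
      subst_sum h hz _ fun β _ => contDiffOn_mul (h3 β) (hc _)]
    refine congrArg₂ (· + ·) ?_ ?_
    · refine Finset.sum_congr rfl fun C _ => ?_
      rw [subst_mul h hz (hl (hJ C)) (hc _), subst_coord h hz, hRb, subst_Rmap_liftCot_liftTot]
      rfl
    · have h4 : ∀ γ, subst Rmap (∑ δ, coord (qIdx (fibIdx δ)) * liftCot (liftTot (E.T i j δ γ))) z =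
          ∑ δ, (sg (par δ) • (coord (pIdx (fibIdx δ)) :
            SFun ((a ⊕ d) ⊕ (a ⊕ d)) ((b ⊕ c) ⊕ (b ⊕ c))) z) * liftCot (liftTot (E.T i j δ γ)) z :=
        fun γ => by
          rw [subst_sum h hz _ fun δ _ => contDiffOn_mul (hc _) (hl (hE.smooth i j δ γ))]
          refine Finset.sum_congr rfl fun δ _ => ?_
          rw [subst_mul h hz (hc _) (hl (hE.smooth i j δ γ)), subst_coord h hz, hRq,
            subst_Rmap_liftCot_liftTot]
      have h5 : ∀ β, subst Rmap (∑ γ, sg (par A * (par γ + 1)) •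
          ((∑ δ, coord (qIdx (fibIdx δ)) * liftCot (liftTot (E.T i j δ γ))) *
            liftCot (liftTot (E.dT i j A γ β)))) z =
          ∑ γ, sg (par A * (par γ + 1)) • ((∑ δ, (sg (par δ) • (coord (pIdx (fibIdx δ)) :
            SFun ((a ⊕ d) ⊕ (a ⊕ d)) ((b ⊕ c) ⊕ (b ⊕ c))) z) * liftCot (liftTot (E.T i j δ γ)) z) *
              liftCot (liftTot (E.dT i j A γ β)) z) := fun β => by
        rw [subst_sum h hz _ fun γ _ => contDiffOn_smul _ (h2 β γ)]
        refine Finset.sum_congr rfl fun γ _ => ?_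
        rw [subst_smul h hz (h2 β γ), subst_mul h hz (hT γ) (hl (hdT γ β)), h4,
          subst_Rmap_liftCot_liftTot]
      have h6 : ∀ β, subst Rmap ((∑ γ, sg (par A * (par γ + 1)) •
          ((∑ δ, coord (qIdx (fibIdx δ)) * liftCot (liftTot (E.T i j δ γ))) *
            liftCot (liftTot (E.dT i j A γ β)))) * coord (pIdx (fibIdx β))) z =
          (∑ γ, sg (par A * (par γ + 1)) • ((∑ δ, (sg (par δ) • (coord (pIdx (fibIdx δ)) :
            SFun ((a ⊕ d) ⊕ (a ⊕ d)) ((b ⊕ c) ⊕ (b ⊕ c))) z) * liftCot (liftTot (E.T i j δ γ)) z) *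
              liftCot (liftTot (E.dT i j A γ β)) z)) *
            (coord (qIdx (fibIdx β)) : SFun ((a ⊕ d) ⊕ (a ⊕ d)) ((b ⊕ c) ⊕ (b ⊕ c))) z :=
        fun β => by rw [subst_mul h hz (h3 β) (hc _), h5, subst_coord h hz, hRp]
      refine (Finset.sum_congr rfl fun β _ => h6 β).trans ?_
      refine Eq.trans (sum_deriv_eq_sum_deriv_inv (fun β : c ⊕ d => par β) (par A)
        (T := fun β γ => liftCot (liftTot (E.T i j β γ)) z)
        (N := fun β γ => liftCot (liftTot (E.dT i j A β γ)) z)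
        (N' := fun β γ => liftCot (liftTot (E.dInvT i j A β γ)) z)
        (S := fun β γ => liftCot (liftTot (E.invT i j β γ)) z)
        (π := fun β => (coord (pIdx (fibIdx β)) :
          SFun ((a ⊕ d) ⊕ (a ⊕ d)) ((b ⊕ c) ⊕ (b ⊕ c))) z)
        (η := fun β => (coord (qIdx (fibIdx β)) :
          SFun ((a ⊕ d) ⊕ (a ⊕ d)) ((b ⊕ c) ⊕ (b ⊕ c))) z)
        (fun β => ?_) (fun β => ?_)
        (fun β γ => liftCot_mem (liftTot_mem (hE.parityOn_dInvT hM A β γ _ hz)))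
        (fun β γ => liftCot_mem (liftTot_mem (hE.parityOn_invT hM β γ _ hz))) fun β δ => ?_) ?_
      · have := hco (fibIdx β)
        rwa [par_fibIdx] at this
      · have := hco' (fibIdx β)
        rwa [par_fibIdx] at this
      · obtain ⟨Φ, hΦ⟩ := exists_algHom_liftCot_liftTot (b := b) (c := c) z
        simp only [hΦ, ← map_mul, ← map_smul, ← map_sum, ← map_neg]
        exact congrArg Φ (hE.dInvT_mul_invT hM hz A β δ)
      · refine Finset.sum_congr rfl fun β _ => ?_
        simp only [Pi.mul_apply, Finset.sum_apply]
  · have hi := fun β => hE.contDiffOn_invT (i := i) (j := j) hM α β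
    rw [subst_Rmap_congr_tr hM hE hz fun y hy => cot_piTot_tr_pIdx_fibIdx hM hE hy α,
      swapSign_pIdx_fibIdx, one_smul, swapIdx_pIdx_fibIdx, cot_tr_qIdx E.PiDualTot i j,
      piDualTot_tr_fibIdx, liftCot_sum, Finset.sum_apply,
      subst_sum h hz _ fun β _ => contDiffOn_mul (hl (hi β)) (hc _)]
    refine Finset.sum_congr rfl fun β _ => ?_
    rw [subst_mul h hz (hl (hi β)) (hc _), subst_coord h hz, hRp, subst_Rmap_liftCot_liftTot,
      liftCot_mul, liftCot_coord]
    rfl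

/-- Pullback along the canonical map intertwines the coordinate changes of the two cotangent
bundles. -/
theorem subst_Rmap_subst_cot_tr (hz : z ∈ (cot E.PiTot).ovl i j)
    {F : SFun ((a ⊕ d) ⊕ (a ⊕ d)) ((b ⊕ c) ⊕ (b ⊕ c))}
    (hF : ContDiffOn ℝ ∞ F ((cot E.PiTot).ovl j i)) :
    subst Rmap (subst ((cot E.PiTot).tr i j) F) z =
      subst ((cot E.PiDualTot).tr i j) (subst Rmap F) z := by
  have h := isSuperMap_Rmap (b := b) (c := c) (d := d) (hM.isOpen_ovl i j)
  have h' := isSuperMap_Rmap (b := b) (c := c) (d := d) (hM.isOpen_ovl j i)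
  rw [Rmap_eq_relabel] at h'
  have h1 := subst_subst_of_soul_eq_zero h (fun z _ s => soul_Rmap z s)
    (isSuperMap_cot_tr (isGlued_piTot hM hE) i j) hz hF
  have hz₀ : z ∈ cyl (cyl (M.ovl i j)) := hz
  have hz' : z ∈ (cot E.PiDualTot).ovl i j := hz₀
  have h2 := subst_subst_relabel (isSuperMap_cot_tr (isGlued_piDualTot hM hE) i j) h' hz' hF
  rw [← Rmap_eq_relabel] at h2
  exact h1.trans ((subst_congr_left (fun B => subst_Rmap_cot_tr hM hE hz B) F).trans h2.symm)

/-- Local functions on the cotangent bundle of `ΠE` are compatible with the coordinate changes if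
and only if their pullbacks to the cotangent bundle of `ΠE*` are. -/
theorem subst_Rmap_compat_iff {F G : SFun ((a ⊕ d) ⊕ (a ⊕ d)) ((b ⊕ c) ⊕ (b ⊕ c))}
    (hF : ContDiffOn ℝ ∞ F ((cot E.PiTot).ovl i j))
    (hG : ContDiffOn ℝ ∞ G ((cot E.PiTot).ovl j i)) :
    (∀ z ∈ (cot E.PiTot).ovl i j, F z = subst ((cot E.PiTot).tr i j) G z) ↔
      ∀ z ∈ (cot E.PiDualTot).ovl i j,
        subst Rmap F z = subst ((cot E.PiDualTot).tr i j) (subst Rmap G) z := by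
  have hU := hM.isOpen_ovl i j
  have hs : ∀ z ∈ cyl (cyl (M.ovl i j)), subst Rmap (subst ((cot E.PiTot).tr i j) G) z =
      subst ((cot E.PiDualTot).tr i j) (subst Rmap G) z := fun z hz =>
    subst_Rmap_subst_cot_tr hM hE hz hG
  constructor
  · intro h z (hz : z ∈ cyl (cyl (M.ovl i j)))
    exact (subst_congr (isSuperMap_Rmap hU) hz hF h).trans (hs z hz)
  · intro h z hz
    have hG' : ContDiffOn ℝ ∞ (subst ((cot E.PiTot).tr i j) G) (cyl (cyl (M.ovl i j))) :=
      contDiffOn_subst (isSuperMap_cot_tr (isGlued_piTot hM hE) i j) hG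
    exact subst_Rmap_injOn hU hF hG' (fun z hz => (h z hz).trans (hs z hz).symm) hz

end Naturality

/-! ### Global functions and vector fields from local symbols -/

section LocalToGlobal

variable {a b : Type} [Fintype a] [DecidableEq a] [Fintype b] [DecidableEq b]
  {V : Set (a → ℝ)} {f g : SFun a b}

theorem funWeightOn_congr {w : a ⊕ b → ℤ} {r : ℤ} (hV : IsOpen V) (h : ∀ x ∈ V, f x = g x)
    (hg : FunWeightOn V w r g) : FunWeightOn V w r f := fun x hx => by
  rw [h x hx, ← hg x hx, act_euler, act_euler]
  exact Finset.sum_congr rfl fun A _ => by rw [pd_congr_of_isOpen A hV hx h]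

theorem funWeightOn_smul {w : a ⊕ b → ℤ} {r : ℤ} (hV : IsOpen V) (hf : ContDiffOn ℝ ∞ f V)
    (h : FunWeightOn V w r f) (t : ℝ) : FunWeightOn V w r (t • f) := fun x hx => by
  rw [Pi.smul_apply, smul_comm, ← h x hx, act_euler, act_euler, Finset.smul_sum]
  refine Finset.sum_congr rfl fun A _ => ?_
  rw [pd_const_smul A t (ContDiffOn.differentiableAt_of_isOpen hV hf hx), mul_smul_comm,
    smul_comm]

theorem parityOn_congr {ε : ZMod 2} (h : ∀ x ∈ V, f x = g x) (hg : ParityOn V ε g) :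
    ParityOn V ε f := fun x hx => h x hx ▸ hg x hx

theorem parityOn_smul {ε : ZMod 2} (h : ParityOn V ε f) (t : ℝ) : ParityOn V ε (t • f) :=
  fun x hx => Submodule.smul_mem _ _ (h x hx)

theorem poisson_congr {W : Set (a ⊕ a → ℝ)} {F F' G G' : SFun (a ⊕ a) (b ⊕ b)} (hW : IsOpen W)
    (hF : ∀ z ∈ W, F z = F' z) (hG : ∀ z ∈ W, G z = G' z) {z : a ⊕ a → ℝ} (hz : z ∈ W) :
    poisson F G z = poisson F' G' z := by
  have hi : ∀ z ∈ W, invol F z = invol F' z := fun z hz => by rw [invol, invol, hF z hz]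
  simp only [poisson, Pi.add_apply, Finset.sum_apply, Pi.sub_apply, Pi.mul_apply, Pi.neg_apply,
    pd_congr_of_isOpen _ hW hz hF, pd_congr_of_isOpen _ hW hz hG, pd_congr_of_isOpen _ hW hz hi]

variable {N : SuperAtlas.{u} a b}

theorem SmoothFn.ext_dom {f g : SmoothFn N} (h : ∀ i, ∀ x ∈ N.dom i, f.loc i x = g.loc i x) :
    f = g := by
  have : f.loc = g.loc := by
    funext i x
    by_cases hx : x ∈ N.dom i
    · exact h i x hx
    · rw [f.off i x hx, g.off i x hx]
  cases f
  cases g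
  cases this
  rfl

theorem VectField.ext_dom {X Y : VectField N}
    (h : ∀ i A, ∀ x ∈ N.dom i, X.comp i A x = Y.comp i A x) : X = Y := by
  have : X.comp = Y.comp := by
    funext i A x
    by_cases hx : x ∈ N.dom i
    · exact h i A x hx
    · rw [X.off i A x hx, Y.off i A x hx]
  cases X
  cases Y
  cases this
  rfl

/-- Smooth functions are determined by the pullbacks to the cotangent bundle. -/
theorem SmoothFn.ext_liftCot {f g : SmoothFn N}
    (h : ∀ i, ∀ z ∈ (cot N).dom i, liftCot (f.loc i) z = liftCot (g.loc i) z) : f = g :=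
  SmoothFn.ext_dom fun i _ hx => liftCot_injOn fun z hz =>
    h i z (show z ∘ Sum.inl ∈ N.dom i from hz ▸ hx)

/-- Vector fields are determined by the symbols. -/
theorem VectField.ext_symbol (hN : N.IsGlued) {X Y : VectField N}
    (h : ∀ i, ∀ z ∈ (cot N).dom i, X.symbol i z = Y.symbol i z) : X = Y :=
  VectField.ext_dom fun i A _ hx => sym_injOn (hN.isOpen_dom i) (X.smooth i) (Y.smooth i) (h i) A hx

/-- Local functions that agree on overlaps define a global function; outside its domain each local
representative is set to zero, as `SmoothFn` requires. -/
theorem exists_smoothFn (hsub : ∀ i j, N.ovl i j ⊆ N.dom i)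
    (htr : ∀ i j, IsSuperMap (N.ovl i j) (N.ovl j i) (N.tr i j)) (F : N.Idx → SFun a b)
    (hF : ∀ i, ContDiffOn ℝ ∞ (F i) (N.dom i))
    (hc : ∀ i j, ∀ x ∈ N.ovl i j, F i x = subst (N.tr i j) (F j) x) :
    ∃ f : SmoothFn N, ∀ i, ∀ x ∈ N.dom i, f.loc i x = F i x := by
  have h : ∀ i, ∀ x ∈ N.dom i, (N.dom i).indicator (F i) x = F i x := fun i x hx =>
    Set.indicator_of_mem hx _
  refine ⟨⟨fun i => (N.dom i).indicator (F i), fun i => (hF i).congr (h i), fun i j x hx => ?_,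
    fun i x hx => Set.indicator_of_notMem hx _⟩, h⟩
  rw [h i x (hsub i j hx), hc i j x hx]
  exact subst_congr (htr i j) hx ((hF j).mono (hsub j i)) fun y hy => (h j y (hsub j i hy)).symm

/-- A compatible family of functions of degree zero in the momenta is a function on the base. -/
theorem exists_smoothFn_of_momDeg_zero (hN : N.IsGlued) (F : N.Idx → SFun (a ⊕ a) (b ⊕ b))
    (hF : ∀ i, ContDiffOn ℝ ∞ (F i) ((cot N).dom i))
    (h0 : ∀ i, FunWeightOn ((cot N).dom i) momDeg 0 (F i))
    (hc : ∀ i j, ∀ z ∈ (cot N).ovl i j, F i z = subst ((cot N).tr i j) (F j) z) :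
    ∃ f : SmoothFn N, ∀ i, ∀ z ∈ (cot N).dom i, liftCot (f.loc i) z = F i z := by
  have hs : ∀ i, ContDiffOn ℝ ∞ (subst zeroSec (F i)) (N.dom i) := fun i =>
    contDiffOn_subst (isSuperMap_zeroSec (hN.isOpen_dom i)) (hF i)
  have hl : ∀ i, ∀ z ∈ (cot N).dom i, F i z = liftCot (subst zeroSec (F i)) z := fun i z hz =>
    eq_liftCot_of_momDeg_zero (hN.isOpen_dom i) (hF i) (h0 i) hz
  have hsub : ∀ i j, (cot N).ovl i j ⊆ (cot N).dom i := fun i j z hz => hN.ovl_subset i j hz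
  obtain ⟨f, hf⟩ := exists_smoothFn hN.ovl_subset hN.isSuperMap (fun i => subst zeroSec (F i)) hs
    fun i j => (liftCot_compat_iff hN ((hs j).mono (hN.ovl_subset j i))).1 fun z hz => by
      rw [← hl i z (hsub i j hz), hc i j z hz]
      exact subst_congr (isSuperMap_cot_tr hN i j) hz ((hF j).mono (hsub j i)) fun y hy =>
        hl j y (hsub j i hy)
  exact ⟨f, fun i z hz => (liftCot_congr (hf i _ hz)).trans (hl i z hz).symm⟩

/-- A compatible family of odd functions of degree one in the momenta is the symbol of an odd
vector field. -/
theorem exists_vectField_of_momDeg_one (hN : N.IsGlued) (F : N.Idx → SFun (a ⊕ a) (b ⊕ b))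
    (hF : ∀ i, ContDiffOn ℝ ∞ (F i) ((cot N).dom i)) (ho : ∀ i, ParityOn ((cot N).dom i) 1 (F i))
    (h1 : ∀ i, FunWeightOn ((cot N).dom i) momDeg 1 (F i))
    (hc : ∀ i j, ∀ z ∈ (cot N).ovl i j, F i z = subst ((cot N).tr i j) (F j) z) :
    ∃ X : VectField N, X.IsOdd ∧ ∀ i, ∀ z ∈ (cot N).dom i, X.symbol i z = F i z := by
  set C : N.Idx → a ⊕ b → SFun a b := fun i A => (N.dom i).indicator (symComp (F i) A) with hC
  have h : ∀ i A, ∀ x ∈ N.dom i, C i A x = symComp (F i) A x := fun i A x hx =>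
    Set.indicator_of_mem hx _
  have hs : ∀ i A, ContDiffOn ℝ ∞ (C i A) (N.dom i) := fun i A =>
    (contDiffOn_symComp (hN.isOpen_dom i) (hF i) A).congr (h i A)
  have hsym : ∀ i, ∀ z ∈ (cot N).dom i, sym (C i) z = F i z := fun i z hz =>
    (sym_congr fun A => h i A _ hz).trans
      (eq_sym_of_momDeg_one (hN.isOpen_dom i) (hF i) (ho i) (h1 i) hz).symm
  have hsub : ∀ i j, (cot N).ovl i j ⊆ (cot N).dom i := fun i j z hz => hN.ovl_subset i j hz
  refine ⟨⟨C, hs, fun i j => (sym_compat_iff hN (fun A => (hs i A).mono (hN.ovl_subset i j))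
    fun A => (hs j A).mono (hN.ovl_subset j i)).1 fun z hz => ?_,
    fun i A x hx => Set.indicator_of_notMem hx _⟩, fun i A => ?_, hsym⟩
  · rw [hsym i z (hsub i j hz), hc i j z hz]
    exact subst_congr (isSuperMap_cot_tr hN i j) hz ((hF j).mono (hsub j i)) fun y hy =>
      (hsym j y (hsub j i hy)).symm
  · exact parityOn_congr (h i A) (parityOn_symComp (hN.isOpen_dom i) (hF i) (ho i) A)

theorem VectField.symbol_compat (hN : N.IsGlued) (X : VectField N) (i j : N.Idx) :
    ∀ z ∈ (cot N).ovl i j, X.symbol i z = subst ((cot N).tr i j) (X.symbol j) z :=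
  (sym_compat_iff hN (fun A => (X.smooth i A).mono (hN.ovl_subset i j))
    fun A => (X.smooth j A).mono (hN.ovl_subset j i)).2 (X.compat i j)

theorem SmoothFn.liftCot_compat (hN : N.IsGlued) (f : SmoothFn N) (i j : N.Idx) :
    ∀ z ∈ (cot N).ovl i j, liftCot (f.loc i) z = subst ((cot N).tr i j) (liftCot (f.loc j)) z :=
  (liftCot_compat_iff hN ((f.smooth j).mono (hN.ovl_subset j i))).2 (f.compat i j)

end LocalToGlobal

/-! ### The structure equations -/

section StructureEquations

variable {a b c d : Type} [Fintype a] [DecidableEq a] [Fintype b] [DecidableEq b]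
  [Fintype c] [DecidableEq c] [Fintype d] [DecidableEq d] {U : Set (a → ℝ)}
  {D Q : (a ⊕ d) ⊕ (b ⊕ c) → SFun (a ⊕ d) (b ⊕ c)} {q : SFun (a ⊕ d) (b ⊕ c)}
  {S : SFun ((a ⊕ d) ⊕ (a ⊕ d)) ((b ⊕ c) ⊕ (b ⊕ c))}

/-- The equation `[D,D] = 2qD` on `ΠE` amounts to `{S,S} = -2𝒬S` on the cotangent bundle of
`ΠE*`. -/
theorem almost_homological_iff (hU : IsOpen U) (hD : ∀ A, ContDiffOn ℝ ∞ (D A) (cyl U))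
    (hDo : ∀ A, ParityOn (cyl U) (par A + 1) (D A)) (hq : ContDiffOn ℝ ∞ q (cyl U))
    (hS : ∀ z ∈ cyl (cyl U), S z = subst Rmap (sym D) z)
    (hQ : ∀ z ∈ cyl (cyl U), sym Q z = - subst Rmap (liftCot q) z) :
    (∀ A, ∀ x ∈ cyl U, lieBr 1 1 D D A x = (2 : ℝ) • (q x * D A x)) ↔
      ∀ z ∈ cyl (cyl U), poisson S S z = (-2 : ℝ) • (sym Q z * S z) := by
  have hV := isOpen_cyl (d := d) hU
  have h := isSuperMap_Rmap (b := b) (c := c) (d := d) hU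
  have hsD := contDiffOn_sym hV hD
  have hlq := contDiffOn_liftCot hV hq
  have hDD := contDiffOn_lieBr hV hD hD 1 1
  have h1 : ∀ z ∈ cyl (cyl U), poisson S S z = subst Rmap (sym (lieBr 1 1 D D)) z := fun z hz => by
    rw [poisson_congr (isOpen_cyl hV) hS hS hz,
      poisson_subst_Rmap hU hsD (parityOn_sym hDo) hsD hz]
    exact (subst_congr h hz (contDiffOn_sym hV hDD) fun y hy =>
      (poisson_sym_sym hV hD hDo hy).symm).symm
  have h2 : ∀ z ∈ cyl (cyl U), (-2 : ℝ) • (sym Q z * S z) =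
      subst Rmap ((2 : ℝ) • (liftCot q * sym D)) z := fun z hz => by
    rw [subst_smul h hz (contDiffOn_mul hlq hsD), subst_mul h hz hlq hsD, hQ z hz, hS z hz,
      neg_mul, smul_neg, neg_smul, neg_neg]
  have h3 : ∀ z, sym (fun A => (2 : ℝ) • (q * D A)) z = ((2 : ℝ) • (liftCot q * sym D)) z :=
    fun z => by
      rw [Pi.smul_apply, Pi.mul_apply, sym_apply, sym_apply, Finset.mul_sum, Finset.smul_sum]
      exact Finset.sum_congr rfl fun A _ => by
        rw [liftCot_smul, liftCot_mul, Pi.smul_apply, Pi.mul_apply, smul_mul_assoc, mul_assoc]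
  constructor
  · intro heq z hz
    rw [h1 z hz, h2 z hz]
    refine subst_congr h hz (contDiffOn_sym hV hDD) fun y hy => ?_
    rw [← h3]
    exact sym_congr fun A => heq A _ hy
  · intro heq A x hx
    refine sym_injOn hV hDD (fun A => contDiffOn_smul (2 : ℝ) (contDiffOn_mul hq (hD A)))
      (fun z hz => ?_) A hx
    rw [h3]
    exact subst_Rmap_injOn hU (contDiffOn_sym hV hDD) (contDiffOn_smul _ (contDiffOn_mul hlq hsD))
      (fun z hz => by rw [← h1 z hz, ← h2 z hz, heq z hz]) hz

/-- The equation `D(q) = 0` on `ΠE` amounts to `{𝒬,S} = 0` on the cotangent bundle of `ΠE*`. -/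
theorem curving_iff (hU : IsOpen U) (hD : ∀ A, ContDiffOn ℝ ∞ (D A) (cyl U))
    (hDo : ∀ A, ParityOn (cyl U) (par A + 1) (D A)) (hq : ContDiffOn ℝ ∞ q (cyl U))
    (hqo : ParityOn (cyl U) 1 q) (hS : ∀ z ∈ cyl (cyl U), S z = subst Rmap (sym D) z)
    (hQ : ∀ z ∈ cyl (cyl U), sym Q z = - subst Rmap (liftCot q) z) :
    (∀ x ∈ cyl U, act D q x = 0) ↔ ∀ z ∈ cyl (cyl U), poisson (sym Q) S z = 0 := by
  have hV := isOpen_cyl (d := d) hU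
  have h := isSuperMap_Rmap (b := b) (c := c) (d := d) hU
  have hq' : ContDiffOn ℝ ∞ ((-1 : ℝ) • q) (cyl U) := contDiffOn_smul _ hq
  have hqo' := parityOn_smul hqo (-1)
  have hs : ContDiffOn ℝ ∞ (act D ((-1 : ℝ) • q)) (cyl U) := contDiffOn_act hV hD hq'
  have hact : ∀ x ∈ cyl U, act D ((-1 : ℝ) • q) x = - act D q x := fun x hx => by
    rw [act_apply, act_apply, ← Finset.sum_neg_distrib]
    refine Finset.sum_congr rfl fun A _ => ?_
    rw [pd_const_smul A _ (ContDiffOn.differentiableAt_of_isOpen hV hq hx), neg_one_smul, mul_neg]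
  have h1 : ∀ z ∈ cyl (cyl U), poisson (sym Q) S z =
      subst Rmap (liftCot (act D ((-1 : ℝ) • q))) z := fun z hz => by
    rw [poisson_congr (isOpen_cyl hV) (F' := subst Rmap (liftCot ((-1 : ℝ) • q))) (fun z hz => by
      rw [hQ z hz, liftCot_smul, subst_smul h hz (contDiffOn_liftCot hV hq), neg_one_smul]) hS hz,
      poisson_subst_Rmap hU (contDiffOn_liftCot hV hq') (fun y hy => liftCot_mem (hqo' _ hy))
        (contDiffOn_sym hV hD) hz]
    exact (subst_congr h hz (contDiffOn_liftCot hV hs) fun y hy =>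
      (poisson_liftCot_sym hV hD hDo hq' hqo' hy).symm).symm
  constructor
  · intro heq z hz
    rw [h1 z hz, subst_congr h hz (g := 0) (contDiffOn_liftCot hV hs) fun y hy => ?_, subst_zero]
    rw [liftCot_congr (g := 0) (by rw [hact _ hy, heq _ hy, neg_zero]; rfl), liftCot_zero]
    rfl
  · intro heq x hx
    rw [← neg_eq_zero, ← hact x hx]
    refine liftCot_injOn (g := 0) fun z hz => ?_
    have hz' : z ∈ cyl (cyl U) := show z ∘ Sum.inl ∈ cyl U from hz ▸ hx
    rw [liftCot_zero]
    exact subst_Rmap_injOn hU (G := 0) (contDiffOn_liftCot hV hs) contDiffOn_const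
      (fun z hz => by rw [← h1 z hz, heq z hz, subst_zero]) hz'

/-- The equation `[Q,Q] = 0` holds automatically: the symbol of `Q` corresponds to a function that
does not depend on the momenta. -/
theorem homological_of_symbol_eq (hU : IsOpen U) (hQs : ∀ A, ContDiffOn ℝ ∞ (Q A) (cyl U))
    (hQo : ∀ A, ParityOn (cyl U) (par A + 1) (Q A)) (hq : ContDiffOn ℝ ∞ q (cyl U))
    (hqo : ParityOn (cyl U) 1 q) (hQ : ∀ z ∈ cyl (cyl U), sym Q z = - subst Rmap (liftCot q) z)
    (A : (a ⊕ d) ⊕ (b ⊕ c)) {x : a ⊕ d → ℝ} (hx : x ∈ cyl U) : lieBr 1 1 Q Q A x = 0 := by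
  have hV := isOpen_cyl (d := d) hU
  have h := isSuperMap_Rmap (b := b) (c := c) (d := d) hU
  have hq' : ContDiffOn ℝ ∞ ((-1 : ℝ) • q) (cyl U) := contDiffOn_smul _ hq
  have hqo' := parityOn_smul hqo (-1)
  have hQ' : ∀ z ∈ cyl (cyl U), sym Q z = subst Rmap (liftCot ((-1 : ℝ) • q)) z := fun z hz => by
    rw [hQ z hz, liftCot_smul, subst_smul h hz (contDiffOn_liftCot hV hq), neg_one_smul]
  refine sym_injOn (Y := 0) hV (contDiffOn_lieBr hV hQs hQs 1 1) (fun _ => contDiffOn_const)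
    (fun z hz => ?_) A hx
  have h0 : ∀ y ∈ cyl (cyl U), poisson (liftCot ((-1 : ℝ) • q)) (liftCot ((-1 : ℝ) • q)) y =
      (0 : SFun ((a ⊕ d) ⊕ (a ⊕ d)) ((b ⊕ c) ⊕ (b ⊕ c))) y := fun y hy =>
    poisson_liftCot_liftCot hV hq' hqo' hy
  have hl := contDiffOn_liftCot hV hq'
  rw [← poisson_sym_sym hV hQs hQo hz, poisson_congr (isOpen_cyl hV) hQ' hQ' hz,
    poisson_subst_Rmap hU hl (fun y hy => liftCot_mem (hqo' _ hy)) hl hz,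
    ← subst_congr h hz (f := 0) contDiffOn_const fun y hy => (h0 y hy).symm, subst_zero, sym_apply]
  refine (Finset.sum_eq_zero fun A _ => ?_).symm
  rw [Pi.zero_apply, liftCot_zero, zero_mul]

end StructureEquations

/-! ### The correspondence -/

section Correspondence

variable {a b c d : Type} [Fintype a] [DecidableEq a] [Fintype b] [DecidableEq b]
  [Fintype c] [DecidableEq c] [Fintype d] [DecidableEq d]
  {M : SuperAtlas.{u} a b} {E : SuperBundle M c d}

/-- A Jacobi algebroid structure and a weight-one quasi Q-structure correspond to each other under
pullback along the canonical map. -/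
def Corresponds (J : JacobiAlgebroid E) (W : WeightOneQuasiQ E) : Prop :=
  ∀ i : M.Idx, ∀ z ∈ (cot E.PiDualTot).dom i,
    J.S.loc i z = subst Rmap (W.D.symbol i) z ∧
      J.Q.symbol i z = - subst Rmap (liftCot (W.q.loc i)) z

theorem Corresponds.jacobi_unique (hM : M.IsSupermanifold) (hE : E.IsVectorBundle)
    {J J' : JacobiAlgebroid E} {W : WeightOneQuasiQ E} (h : Corresponds J W)
    (h' : Corresponds J' W) : J = J' := by
  have hS : J.S = J'.S := SmoothFn.ext_dom fun i z hz => (h i z hz).1.trans (h' i z hz).1.symm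
  have hQ : J.Q = J'.Q := VectField.ext_symbol (isGlued_piDualTot hM hE) fun i z hz =>
    (h i z hz).2.trans (h' i z hz).2.symm
  rcases J with ⟨⟨S, Q, _, _, _, _, _, _⟩, _, _⟩
  rcases J' with ⟨⟨S', Q', _, _, _, _, _, _⟩, _, _⟩
  cases hS
  cases hQ
  rfl

theorem Corresponds.quasiQ_unique (hM : M.IsSupermanifold) (hE : E.IsVectorBundle)
    {J : JacobiAlgebroid E} {W W' : WeightOneQuasiQ E} (h : Corresponds J W)
    (h' : Corresponds J W') : W = W' := by
  have hD : W.D = W'.D := VectField.ext_symbol (isGlued_piTot hM hE)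
    fun (i : M.Idx) (z : (a ⊕ d) ⊕ (a ⊕ d) → ℝ) (hz : z ∈ cyl (cyl (M.dom i))) =>
      have hU := hM.isOpen_dom i
      subst_Rmap_injOn hU (contDiffOn_sym (isOpen_cyl hU) (W.D.smooth i))
        (contDiffOn_sym (isOpen_cyl hU) (W'.D.smooth i))
        (fun z hz => (h i z hz).1.symm.trans (h' i z hz).1) hz
  have hq : W.q = W'.q := SmoothFn.ext_liftCot
    fun (i : M.Idx) (z : (a ⊕ d) ⊕ (a ⊕ d) → ℝ) (hz : z ∈ cyl (cyl (M.dom i))) =>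
      have hU := hM.isOpen_dom i
      subst_Rmap_injOn hU (contDiffOn_liftCot (isOpen_cyl hU) (W.q.smooth i))
        (contDiffOn_liftCot (isOpen_cyl hU) (W'.q.smooth i))
        (fun z hz => neg_injective ((h i z hz).2.symm.trans (h' i z hz).2)) hz
  rcases W with ⟨⟨D, q, _, _, _, _⟩, _, _⟩
  rcases W' with ⟨⟨D', q', _, _, _, _⟩, _, _⟩
  cases hD
  cases hq
  rfl

/-- The Jacobi algebroid structure of a weight-one quasi Q-structure: `S` and `𝒬` are defined by
their formulas, and `Q` is recovered from `𝒬`, which has degree one in the momenta. -/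
theorem WeightOneQuasiQ.exists_corresponds (hM : M.IsSupermanifold) (hE : E.IsVectorBundle)
    (W : WeightOneQuasiQ E) : ∃ J : JacobiAlgebroid E, Corresponds J W := by
  have hN := isGlued_piTot hM hE
  have hN' := isGlued_piDualTot hM hE
  have hU : ∀ i : M.Idx, IsOpen (M.dom i) := hM.isOpen_dom
  have hV : ∀ i : M.Idx, IsOpen (cyl (d := d) (M.dom i)) := fun i => isOpen_cyl (hU i)
  have hR : ∀ i : M.Idx, IsSuperMap (cyl (cyl (M.dom i))) (cyl (cyl (M.dom i)))
      (relabel swapSign swapFib swapFib : _ → SFun ((a ⊕ d) ⊕ (a ⊕ d)) ((b ⊕ c) ⊕ (b ⊕ c))) :=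
    fun i => isSuperMap_relabel_swapFib (hU i) fun _ => rfl
  have hsub : ∀ i j, (cot E.PiTot).ovl i j ⊆ (cot E.PiTot).dom i :=
    fun i j z hz => hN.ovl_subset i j hz
  -- the symbol of `D` and its pullback
  have hD : ∀ i : M.Idx, ContDiffOn ℝ ∞ (W.D.symbol i) (cyl (cyl (M.dom i))) := fun i =>
    contDiffOn_sym (hV i) (W.D.smooth i)
  have hDo : ∀ i : M.Idx, ParityOn (cyl (cyl (M.dom i))) 1 (W.D.symbol i) := fun i =>
    parityOn_sym (W.D_odd i)
  have hDm : ∀ i : M.Idx, FunWeightOn (cyl (cyl (M.dom i))) momDeg 1 (W.D.symbol i) := fun i =>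
    momDeg_sym (hV i) (W.D.smooth i) (W.D_odd i)
  have hDw : ∀ i : M.Idx, FunWeightOn (cyl (cyl (M.dom i))) (cotWt fibWt) 1 (W.D.symbol i) :=
    fun i => (vectWeightOn_iff (hV i) (W.D.smooth i) (W.D_odd i) fibWt 1).1 (W.D_weight i)
  obtain ⟨S, hS⟩ := exists_smoothFn (N := cot E.PiDualTot)
    (fun i j z hz => hN'.ovl_subset i j hz) (isSuperMap_cot_tr hN')
    (fun i => subst Rmap (W.D.symbol i))
    (fun i => contDiffOn_subst (isSuperMap_Rmap (hU i)) (hD i)) fun i j =>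
      (subst_Rmap_compat_iff hM hE ((hD i).mono (hsub i j)) ((hD j).mono (hsub j i))).1
        (W.D.symbol_compat hN i j)
  replace hS : ∀ i : M.Idx, ∀ z ∈ cyl (cyl (M.dom i)), S.loc i z = subst Rmap (W.D.symbol i) z := hS
  -- the function `-q` and its pullback
  have hq : ∀ i : M.Idx, ContDiffOn ℝ ∞ ((-1 : ℝ) • liftCot (W.q.loc i)) (cyl (cyl (M.dom i))) :=
    fun i => contDiffOn_smul _ (contDiffOn_liftCot (hV i) (W.q.smooth i))
  have hqo : ∀ i : M.Idx, ParityOn (cyl (cyl (M.dom i))) 1 ((-1 : ℝ) • liftCot (W.q.loc i)) :=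
    fun i => parityOn_smul (fun z hz => liftCot_mem (W.q_odd i _ hz)) _
  have hqm : ∀ i : M.Idx, FunWeightOn (cyl (cyl (M.dom i))) momDeg 0
      ((-1 : ℝ) • liftCot (W.q.loc i)) := fun i =>
    funWeightOn_smul (isOpen_cyl (hV i)) (contDiffOn_liftCot (hV i) (W.q.smooth i))
      (momDeg_liftCot (hV i) (W.q.smooth i)) _
  have hqw : ∀ i : M.Idx, FunWeightOn (cyl (cyl (M.dom i))) (cotWt fibWt) 1
      ((-1 : ℝ) • liftCot (W.q.loc i)) := fun i =>
    funWeightOn_smul (isOpen_cyl (hV i)) (contDiffOn_liftCot (hV i) (W.q.smooth i))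
      ((funWeightOn_iff (hV i) (W.q.smooth i) fibWt 1).1 (W.q_weight i)) _
  obtain ⟨Q, hQo, hQ⟩ := exists_vectField_of_momDeg_one hN'
    (fun i => subst Rmap ((-1 : ℝ) • liftCot (W.q.loc i)))
    (fun i => contDiffOn_subst (isSuperMap_Rmap (hU i)) (hq i))
    (fun i => parityOn_subst (isSuperMap_Rmap (hU i)) (hq i) (hqo i))
    (fun i => by
      rw [Rmap_eq_relabel]
      exact momDeg_relabel_swapFib (hR i) (hq i) (hqm i) (hqw i)) fun i j =>
      (subst_Rmap_compat_iff hM hE ((hq i).mono (hsub i j)) ((hq j).mono (hsub j i))).1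
        fun z hz => by
          rw [subst_smul (isSuperMap_cot_tr hN i j) hz ((contDiffOn_liftCot (hV j)
            (W.q.smooth j)).mono (hsub j i)), ← W.q.liftCot_compat hN i j z hz]
          rfl
  replace hQ : ∀ i : M.Idx, ∀ z ∈ cyl (cyl (M.dom i)), Q.symbol i z =
      subst Rmap ((-1 : ℝ) • liftCot (W.q.loc i)) z := hQ
  have hQ' : ∀ i : M.Idx, ∀ z ∈ cyl (cyl (M.dom i)), Q.symbol i z =
      - subst Rmap (liftCot (W.q.loc i)) z := fun i z hz => by
    rw [hQ i z hz, subst_smul (isSuperMap_Rmap (hU i)) hz (contDiffOn_liftCot (hV i)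
      (W.q.smooth i)), neg_one_smul]
  refine ⟨⟨⟨S, Q, fun (i : M.Idx) => ?_, fun (i : M.Idx) => ?_, hQo,
    fun (i : M.Idx) A x hx => homological_of_symbol_eq (hU i) (Q.smooth i) (hQo i) (W.q.smooth i)
      (W.q_odd i) (hQ' i) A hx,
    fun (i : M.Idx) => (curving_iff (hU i) (W.D.smooth i) (W.D_odd i) (W.q.smooth i) (W.q_odd i)
      (hS i) (hQ' i)).1 (W.curving i),
    fun (i : M.Idx) => (almost_homological_iff (hU i) (W.D.smooth i) (W.D_odd i) (W.q.smooth i)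
      (hS i) (hQ' i)).1 (W.almost_homological i)⟩, fun (i : M.Idx) => ?_, fun (i : M.Idx) => ?_⟩,
    fun i z hz => ⟨hS i z hz, hQ' i z hz⟩⟩
  · exact parityOn_congr (hS i) (parityOn_subst (isSuperMap_Rmap (hU i)) (hD i) (hDo i))
  · refine funWeightOn_congr (isOpen_cyl (hV i)) (hS i) ?_
    rw [Rmap_eq_relabel]
    exact momDeg_relabel_swapFib (hR i) (hD i) (hDm i) (hDw i)
  · refine funWeightOn_congr (isOpen_cyl (hV i)) (hS i) ?_
    rw [Rmap_eq_relabel]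
    exact cotWt_relabel_swapFib (hR i) (hD i) (hDw i)
  · refine (vectWeightOn_iff (hV i) (Q.smooth i) (hQo i) fibWt (-1)).2
      (funWeightOn_congr (isOpen_cyl (hV i)) (hQ i) ?_)
    rw [Rmap_eq_relabel]
    exact cotWt_relabel_swapFib (hR i) (hq i) (hqw i)

/-- The weight-one quasi Q-structure of a Jacobi algebroid structure: the pullbacks of `S` and `-𝒬`
along the inverse of `R` have degrees one and zero in the momenta, hence come from a vector field
and a function. -/
theorem JacobiAlgebroid.exists_corresponds (hM : M.IsSupermanifold) (hE : E.IsVectorBundle)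
    (J : JacobiAlgebroid E) : ∃ W : WeightOneQuasiQ E, Corresponds J W := by
  have hN := isGlued_piTot hM hE
  have hN' := isGlued_piDualTot hM hE
  have hU : ∀ i : M.Idx, IsOpen (M.dom i) := hM.isOpen_dom
  have hV : ∀ i : M.Idx, IsOpen (cyl (d := d) (M.dom i)) := fun i => isOpen_cyl (hU i)
  have hR : ∀ i : M.Idx, IsSuperMap (cyl (cyl (M.dom i))) (cyl (cyl (M.dom i)))
      (Rinv : _ → SFun ((a ⊕ d) ⊕ (a ⊕ d)) ((b ⊕ c) ⊕ (b ⊕ c))) := fun i => isSuperMap_Rinv (hU i)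
  have hsub : ∀ i j : M.Idx, cyl (cyl (M.ovl i j)) ⊆
      (cyl (cyl (M.dom i)) : Set ((a ⊕ d) ⊕ (a ⊕ d) → ℝ)) := fun i j z hz => hM.ovl_subset i j hz
  -- a family of functions on one cotangent bundle is compatible if its transform is on the other
  have hcompat : ∀ F : M.Idx → SFun ((a ⊕ d) ⊕ (a ⊕ d)) ((b ⊕ c) ⊕ (b ⊕ c)),
      (∀ i, ContDiffOn ℝ ∞ (F i) (cyl (cyl (M.dom i)))) → ∀ i j : M.Idx,
      (∀ z ∈ (cot E.PiDualTot).ovl i j, F i z = subst ((cot E.PiDualTot).tr i j) (F j) z) →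
      ∀ z ∈ (cot E.PiTot).ovl i j,
        subst Rinv (F i) z = subst ((cot E.PiTot).tr i j) (subst Rinv (F j)) z := by
    intro F hF i j hc
    have hs := fun i => contDiffOn_subst (hR i) (hF i)
    refine (subst_Rmap_compat_iff hM hE ((hs i).mono (hsub i j)) ((hs j).mono (hsub j i))).2
      fun z hz => ?_
    rw [subst_Rmap_Rinv (hU i) (hF i) (hsub i j hz), hc z hz]
    exact subst_congr (isSuperMap_cot_tr hN' i j) hz ((hF j).mono (hsub j i)) fun y hy =>
      (subst_Rmap_Rinv (hU j) (hF j) (hsub j i hy)).symm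
  -- the vector field `D`
  have hS : ∀ i : M.Idx, ContDiffOn ℝ ∞ (J.S.loc i) (cyl (cyl (M.dom i))) := J.S.smooth
  obtain ⟨D, hDo, hD⟩ := exists_vectField_of_momDeg_one hN (fun i => subst Rinv (J.S.loc i))
    (fun i => contDiffOn_subst (hR i) (hS i))
    (fun i => parityOn_subst (hR i) (hS i) (J.S_odd i))
    (fun i => momDeg_relabel_swapFib (hR i) (hS i) (J.S_deg i) (J.S_weight i)) fun i j =>
      hcompat (fun i => J.S.loc i) hS i j (J.S.compat i j)
  replace hD : ∀ i : M.Idx, ∀ z ∈ cyl (cyl (M.dom i)),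
      D.symbol i z = subst Rinv (J.S.loc i) z := hD
  have hS' : ∀ i : M.Idx, ∀ z ∈ cyl (cyl (M.dom i)), J.S.loc i z = subst Rmap (D.symbol i) z :=
    fun i z hz => by
      rw [← subst_Rmap_Rinv (hU i) (hS i) hz]
      exact subst_congr (isSuperMap_Rmap (hU i)) hz (contDiffOn_subst (hR i) (hS i)) fun y hy =>
        (hD i y hy).symm
  -- the function `q`
  have hsQ : ∀ i : M.Idx, ContDiffOn ℝ ∞ (J.Q.symbol i) (cyl (cyl (M.dom i))) := fun i =>
    contDiffOn_sym (hV i) (J.Q.smooth i)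
  have hQ : ∀ i : M.Idx, ContDiffOn ℝ ∞ ((-1 : ℝ) • J.Q.symbol i) (cyl (cyl (M.dom i))) := fun i =>
    contDiffOn_smul _ (hsQ i)
  have hQm : ∀ i : M.Idx, FunWeightOn (cyl (cyl (M.dom i))) momDeg 1 ((-1 : ℝ) • J.Q.symbol i) :=
    fun i => funWeightOn_smul (isOpen_cyl (hV i)) (hsQ i)
      (momDeg_sym (hV i) (J.Q.smooth i) (J.Q_odd i)) _
  have hQw : ∀ i : M.Idx, FunWeightOn (cyl (cyl (M.dom i))) (cotWt fibWt) (-1)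
      ((-1 : ℝ) • J.Q.symbol i) := fun i => funWeightOn_smul (isOpen_cyl (hV i)) (hsQ i)
    ((vectWeightOn_iff (hV i) (J.Q.smooth i) (J.Q_odd i) fibWt (-1)).1 (J.Q_weight i)) _
  obtain ⟨q, hq⟩ := exists_smoothFn_of_momDeg_zero hN
    (fun i => subst Rinv ((-1 : ℝ) • J.Q.symbol i))
    (fun i => contDiffOn_subst (hR i) (hQ i))
    (fun i => momDeg_relabel_swapFib (hR i) (hQ i) (hQm i) (hQw i)) fun i j =>
      hcompat (fun i => (-1 : ℝ) • J.Q.symbol i) hQ i j fun z hz => by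
        rw [subst_smul (isSuperMap_cot_tr hN' i j) hz ((hsQ j).mono (hsub j i)),
          ← J.Q.symbol_compat hN' i j z hz]
        rfl
  replace hq : ∀ i : M.Idx, ∀ z ∈ cyl (cyl (M.dom i)),
      liftCot (q.loc i) z = subst Rinv ((-1 : ℝ) • J.Q.symbol i) z := hq
  have hqo : q.IsOdd := fun (i : M.Idx) x hx => by
    have h1 := parityOn_congr (hq i) (parityOn_subst (hR i) (hQ i)
      (parityOn_smul (parityOn_sym (J.Q_odd i)) _))
    have h2 := parityOn_subst (isSuperMap_zeroSec (hV i))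
      (contDiffOn_liftCot (hV i) (q.smooth i)) h1 x hx
    rwa [subst_zeroSec_liftCot] at h2
  have hQ' : ∀ i : M.Idx, ∀ z ∈ cyl (cyl (M.dom i)), J.Q.symbol i z =
      - subst Rmap (liftCot (q.loc i)) z := fun i z hz => by
    have h1 : subst Rmap (liftCot (q.loc i)) z = ((-1 : ℝ) • J.Q.symbol i) z := by
      rw [← subst_Rmap_Rinv (hU i) (hQ i) hz]
      exact subst_congr (isSuperMap_Rmap (hU i)) hz (contDiffOn_liftCot (hV i) (q.smooth i)) (hq i)
    rw [h1, Pi.smul_apply, neg_one_smul, neg_neg]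
  refine ⟨⟨⟨D, q, hDo, hqo,
    fun (i : M.Idx) => (almost_homological_iff (hU i) (D.smooth i) (hDo i) (q.smooth i)
      (hS' i) (hQ' i)).2 (J.compatible i),
    fun (i : M.Idx) => (curving_iff (hU i) (D.smooth i) (hDo i) (q.smooth i) (hqo i)
      (hS' i) (hQ' i)).2 (J.invariant i)⟩, fun (i : M.Idx) => ?_, fun (i : M.Idx) => ?_⟩,
    fun i z hz => ⟨hS' i z hz, hQ' i z hz⟩⟩
  · exact (vectWeightOn_iff (hV i) (D.smooth i) (hDo i) fibWt 1).2
      (funWeightOn_congr (isOpen_cyl (hV i)) (hD i)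
        (cotWt_relabel_swapFib (hR i) (hS i) (J.S_weight i)))
  · exact (funWeightOn_iff (hV i) (q.smooth i) fibWt 1).2
      (funWeightOn_congr (isOpen_cyl (hV i)) (hq i) (cotWt_relabel_swapFib (hR i) (hQ i) (hQw i)))

end Correspondence

end SuperGeom

end

theorem mainTheorem4 {a b c d : Type} [Fintype a] [DecidableEq a] [Fintype b] [DecidableEq b]
    [Fintype c] [DecidableEq c] [Fintype d] [DecidableEq d]
    (M : SuperGeom.SuperAtlas.{u} a b) (hM : M.IsSupermanifold)
    (E : SuperGeom.SuperBundle M c d) (hE : E.IsVectorBundle) :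
    ∃ Φ : SuperGeom.JacobiAlgebroid E ≃ SuperGeom.WeightOneQuasiQ E,
      ∀ (J : SuperGeom.JacobiAlgebroid E) (i : M.Idx),
        ∀ z ∈ (SuperGeom.cot E.PiDualTot).dom i,
          J.S.loc i z = SuperGeom.subst SuperGeom.Rmap ((Φ J).D.symbol i) z ∧
          J.Q.symbol i z =
            - SuperGeom.subst SuperGeom.Rmap (SuperGeom.liftCot ((Φ J).q.loc i)) z := by
  choose f hf using fun J : SuperGeom.JacobiAlgebroid E => J.exists_corresponds hM hE
  choose g hg using fun W : SuperGeom.WeightOneQuasiQ E => W.exists_corresponds hM hE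
  exact ⟨⟨f, g, fun J => (hg (f J)).jacobi_unique hM hE (hf J),
    fun W => (hf (g W)).quasiQ_unique hM hE (hg W)⟩, hf⟩
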